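/- **Setting.** Let $\mathbb K=\bigcup_{m\ge1}\mathbb C\{t^{1/m}\}$ be the field of locally convergent Puiseux series, with $\mathrm{Val}(\sum_r a_rt^r)=-\min\{r: a_r\ne0\}$. Let $\Delta\subset\mathbb R^3$ be a convex lattice polytope such that the differences of points of $\Delta\cap\mathbb Z^3$ generate $\mathbb Z^3$, and let $N=|\Delta\cap\mathbb Z^3|-2>0$. Let $v\in\mathbb Q^3$ be neither parallel nor orthogonal to any proper positive-dimensional affine subspace of $\mathbb R^3$ spanned by points of $\Delta\cap\mathbb Z^3$, and write $\Delta\cap\mathbb Z^3=\{w_0,\dots,w_{N+1}\}$ with $\langle w_0,v\rangle<\dots<\langle w_{N+1},v\rangle$. Let $x_i=M_iv$ ($1\le i\le N$), where $0\ll M_1\ll\dots\ll M_N$ are rational; that is, $M_1>R$ and $M_j>RM_i$ for $i<j$, where $R>0$ is a sufficiently large constant depending only on $\Delta$ and $v$. Let $\overline p=(p_1,\dots,p_N)$ be any configuration of points of $(\mathbb K^*)^3$ with $\mathrm{Val}(p_i)=x_i$. Let $S$ be a tropical surface with Newton polytope $\Delta$ that contains $x_1,\dots,x_N$ and is the tropicalization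 of a surface over $\mathbb K$ with a singularity in $(\mathbb K^*)^3$. Let $F_S(X)=\max_i(c_i+\langle X,w_i\rangle)$ be its defining tropical polynomial, where $-c_i=\nu_S(w_i)$ for the convex piecewise linear function $\nu_S$ on $\Delta$ that is Legendre dual to $F_S$ (the additive constant being chosen so that the $c_i$ are rational), and let $\Sigma_S$ be the dual subdivision of $\Delta$. Let $C_S$ be a circuit (a minimal affinely dependent set) that consists of all the lattice points of a cell of $\Sigma_S$. Let $P_S$ be the set of the edges of $\Sigma_S$ dual to the $2$-faces of $S$ containing the points $x_i$ in their interiors. For a set $A=\{a_1,\dots,a_m\}$ of lattice points of $\Delta$ with $\langle a_1,v\rangle<\dots<\langle a_m,v\rangle$, let $P(A)$ be the set of segments $[a_j,a_{j+1}]$, $1\le j<m$; put $\Gamma_k=P((\Delta\cap\mathbb Z^3)\setminus\{w_k\})$ for $0\le k\le N+1$ and $\Gamma_{k,k+1}=P(\{w_0,\dots,w_k\})\cup P(\{w_{k+1},\dots,w_{N+1}\})$ for $1\le k\le N$. By $\max C_S$ we mean the point of $C_S$ with the largest value of $\langle\cdot,v\rangle$. Up to affine automorphisms of $\mathbb Z^3$,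 the circuit $C_S$ is of * type A if it is $\Pi_{p,q}=\{(0,0,0),(1,0,0),(0,1,0),(0,0,1),(1,p,q)\}$ with $p,q>0$ and $\gcd(p,q)=1$; * type B if it consists of $(0,0,0),(1,0,0),(0,1,0)$, a point $u$ and the unique interior lattice point of the tetrahedron with these four vertices, where $u$ is one of $(3,3,4)$, $(2,2,5)$, $(2,4,7)$, $(2,6,11)$, $(2,7,13)$, $(2,9,17)$, $(2,13,19)$, $(3,7,20)$; * type C if it is $\{(1,0,0),(2,1,0),(0,2,0),(1,1,0)\}$; * type D if it is $\{(0,0,0),(1,0,0),(0,1,0),(1,1,0)\}$; * type E if it is $\{(0,0,0),(0,0,1),(0,0,2)\}$. For $\Pi_{p,q}$ let $d(0,0,0)=p+q$, $d(1,0,0)=-1$, $d(0,1,0)=-p$, $d(0,0,1)=-q$, $d(1,p,q)=1$, and $d=0$ at all other points; these are the exponents of the coefficients in the discriminantal equation $\mathrm{const}\cdot a_{000}^{p+q}a_{100}^{-1}a_{010}^{-p}a_{001}^{-q}a_{1pq}=1$ of $\sum_{\omega\in\Pi_{p,q}} a_\omega Z^\omega$. The lattice volume $\mathrm{Vol}_{\mathbb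 Z}$ of a lattice polytope is the volume in its affine span, normalized so that a minimal lattice simplex has volume $1$. Let $A(S,\overline p)\subset\mathbb P^{N+1}$ be the set of enhancements of $S$: the points $\overline\alpha=(\alpha_0:\dots:\alpha_{N+1})$ with all $\alpha_i\ne0$ for which there is a polynomial $\varphi(Z)=\sum_i(\alpha_i+O(t^{>0}))\,t^{\nu_S(w_i)}Z^{w_i}$ over $\mathbb K$ that vanishes at $p_1,\dots,p_N$ and such that the complex polynomial $\sum_{w_i\in C_S}\alpha_iZ^{w_i}$ has a singularity in $(\mathbb C^*)^3$. **Lemma 4.2.** The set $A(S,\overline p)$ is finite. Furthermore: 1. Let $C_S$ be of type A, and let $\Phi_S$ be any affine automorphism of $\mathbb Z^3$ taking $C_S$ to some $\Pi_{p,q}$. Then * $|A(S,\overline p)|=|d(\Phi_S(w_k))|$ if $P_S=\Gamma_k$; * $|A(S,\overline p)|=|d(\Phi_S(w_{k+1}))|$ if $P_S=\Gamma_{k,k+1}$ and $w_{k+1}=\max C_S$; * $|A(S,\overline p)|=|d(\Phi_S(w_{k+2}))+d(\Phi_S(w_{k+1}))|$ if $P_S=\Gamma_{k,k+1}$ and $w_{k+2}=\max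 C_S$. 2. If $C_S$ is of type B, then $|A(S,\overline p)|=\mathrm{Vol}_{\mathbb Z}(\mathrm{conv}(C_S))$, unless the tetrahedron $\mathrm{conv}(C_S)$ can be taken to $\mathrm{conv}\{(0,0,0),(1,0,0),(0,1,0),(3,7,20)\}$ by an affine automorphism of $\mathbb Z^3$; in that case $|A(S,\overline p)|=\frac15\mathrm{Vol}_{\mathbb Z}(\mathrm{conv}(C_S))=4$. 3. If $C_S$ is of type C, then $|A(S,\overline p)|=3$, which is the lattice area of $\mathrm{conv}(C_S)$. 4. If $C_S$ is of type D, then $|A(S,\overline p)|=1$. 5. If $C_S$ is of type E, then $|A(S,\overline p)|=1$ if $\mathrm{conv}(C_S)$ is an edge of $P_S$, and $|A(S,\overline p)|=2$ otherwise. -/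

import Mathlib

noncomputable section

namespace TropSurf

open scoped LinearAlgebra.Projectivization Nat

/-! ### Lattice points, directions, polytopes -/

/-- A lattice point of `ℤ³`, viewed in `ℝ³`. -/
def toReal (ω : Fin 3 → ℤ) : Fin 3 → ℝ := fun j => (ω j : ℝ)

/-- `⟨X, ω⟩` for `X ∈ ℝ³` and `ω ∈ ℤ³`. -/
def pairing (X : Fin 3 → ℝ) (ω : Fin 3 → ℤ) : ℝ := ∑ j, X j * (ω j : ℝ)

/-- The value `⟨ω, v⟩` of a rational direction `v` on a lattice point; `ω ≺ ω'` means
`height v ω < height v ω'`. -/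
def height (v : Fin 3 → ℚ) (ω : Fin 3 → ℤ) : ℚ := ∑ j, v j * (ω j : ℚ)

/-- The lattice points `Δ ∩ ℤ³`. -/
def latticePoints (Δ : Set (Fin 3 → ℝ)) : Set (Fin 3 → ℤ) := {ω | toReal ω ∈ Δ}

/-- A convex lattice polytope: the convex hull of finitely many lattice points. -/
def IsLatticePolytope (Δ : Set (Fin 3 → ℝ)) : Prop :=
  ∃ V : Finset (Fin 3 → ℤ), Δ = convexHull ℝ (toReal '' (V : Set (Fin 3 → ℤ)))

/-- The differences of lattice points of `Δ` generate `ℤ³`. -/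
def GeneratesLattice (Δ : Set (Fin 3 → ℝ)) : Prop :=
  AddSubgroup.closure
    {u : Fin 3 → ℤ | ∃ ω ∈ latticePoints Δ, ∃ ω' ∈ latticePoints Δ, u = ω - ω'} = ⊤

/-- The direction `v` is neither parallel nor orthogonal to any proper (positive-dimensional)
affine subspace of `ℝ³` spanned by lattice points of `Δ`. -/
def IsGenericDirection (Δ : Set (Fin 3 → ℝ)) (v : Fin 3 → ℚ) : Prop :=
  ∀ A : Set (Fin 3 → ℤ), A ⊆ latticePoints Δ → A.Nonempty →
    (affineSpan ℝ (toReal '' A)).direction ≠ ⊥ →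
    (affineSpan ℝ (toReal '' A)).direction ≠ ⊤ →
      (fun j => (v j : ℝ)) ∉ (affineSpan ℝ (toReal '' A)).direction ∧
      ∃ u ∈ (affineSpan ℝ (toReal '' A)).direction, ∑ j, u j * (v j : ℝ) ≠ 0

/-- `V` is the lattice volume of the lattice polytope `δ`: the volume in the affine span of `δ`,
measured in coordinates `u ↦ o + ∑ uᵢ bᵢ` that identify `ℤᵈ` with the lattice points of that affine
span, and normalized (by the factor `d!`) so that a minimal lattice simplex has volume `1`. -/
def IsLatticeVolume (δ : Set (Fin 3 → ℝ)) (V : ℝ) : Prop :=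
  ∃ (d : ℕ) (o : Fin 3 → ℤ) (b : Fin d → Fin 3 → ℤ),
    LinearIndependent ℤ b ∧
    {ω : Fin 3 → ℤ | toReal ω ∈ affineSpan ℝ δ} = {ω | ∃ n : Fin d → ℤ, ω = o + ∑ i, n i • b i} ∧
    V = (d ! : ℝ) *
      (MeasureTheory.volume
        {u : Fin d → ℝ | toReal o + ∑ i, u i • toReal (b i) ∈ δ}).toReal

/-! ### Locally convergent Puiseux series -/

/-- The field `𝕂 = ⋃_{m ≥ 1} ℂ{t^{1/m}}` of locally convergent complex Puiseux series, as a subset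
of the field of Hahn series in `t` with rational exponents: the exponents have a common
denominator `m` and the series converges absolutely for some positive value of `t`. -/
def puiseux : Set (HahnSeries ℚ ℂ) :=
  {f | (∃ m : ℕ, 0 < m ∧ ∀ q : ℚ, f.coeff q ≠ 0 → ∃ n : ℤ, q = (n : ℚ) / (m : ℚ)) ∧
    ∃ ρ : ℝ, 0 < ρ ∧ Summable fun q : ℚ => ‖f.coeff q‖ * ρ ^ (q : ℝ)}

/-- `Val(∑ a_r t^r) = - min {r : a_r ≠ 0}` (used for nonzero series only). -/
def val (f : HahnSeries ℚ ℂ) : ℚ := -f.order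

/-! ### Laurent polynomials

The lattice points of the Newton polytope are listed as `w 0, w 1, …`, and coefficients are indexed
by their position in this list. -/

variable {n : ℕ}

/-- The value at `z` of `∑_{i ∈ s} aᵢ Z^{wᵢ}`. -/
def laurentEval {F : Type*} [Field F] (w : Fin n → Fin 3 → ℤ) (s : Finset (Fin n))
    (a : Fin n → F) (z : Fin 3 → F) : F :=
  ∑ i ∈ s, a i * ∏ j, z j ^ (w i j)

/-- The value at `z` of the partial derivative in the `l`-th variable of `∑_{i ∈ s} aᵢ Z^{wᵢ}`. -/
def laurentPartial {F : Type*} [Field F] (w : Fin n → Fin 3 → ℤ) (s : Finset (Fin n))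
    (a : Fin n → F) (l : Fin 3) (z : Fin 3 → F) : F :=
  ∑ i ∈ s, (w i l : F) * a i * ∏ j, z j ^ (w i j - if j = l then 1 else 0)

/-- `z` is a singular point, in the torus, of the zero locus of `∑_{i ∈ s} aᵢ Z^{wᵢ}`. -/
def IsTorusSingularPoint {F : Type*} [Field F] (w : Fin n → Fin 3 → ℤ) (s : Finset (Fin n))
    (a : Fin n → F) (z : Fin 3 → F) : Prop :=
  (∀ j, z j ≠ 0) ∧ laurentEval w s a z = 0 ∧ ∀ l, laurentPartial w s a l z = 0

/-- The polynomial `∑ aᵢ Z^{wᵢ}` over `𝕂` is nonzero and defines a surface with a singularity in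
`(𝕂*)³`. -/
def IsSingularSurface (w : Fin n → Fin 3 → ℤ) (a : Fin n → HahnSeries ℚ ℂ) : Prop :=
  a ≠ 0 ∧ (∀ i, a i ∈ puiseux) ∧
    ∃ z : Fin 3 → HahnSeries ℚ ℂ,
      (∀ j, z j ∈ puiseux) ∧ IsTorusSingularPoint w Finset.univ a z

/-! ### Tropical surfaces and their dual subdivisions -/

variable {N : ℕ}

/-- The tropical polynomial `F(X) = max_i (cᵢ + ⟨X, wᵢ⟩)`. -/
def tropPoly (w : Fin (N + 2) → Fin 3 → ℤ) (c : Fin (N + 2) → ℚ) (X : Fin 3 → ℝ) : ℝ :=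
  Finset.univ.sup' Finset.univ_nonempty fun i => (c i : ℝ) + pairing X (w i)

/-- The positions of the monomials of the tropical polynomial that attain the maximum at `X`. The
corresponding lattice points are the lattice points of the cell of the dual subdivision that is dual
to the face of the tropical surface containing `X` in its relative interior. -/
def dualCell (w : Fin (N + 2) → Fin 3 → ℤ) (c : Fin (N + 2) → ℚ) (X : Fin 3 → ℝ) :
    Set (Fin (N + 2)) :=
  {i | (c i : ℝ) + pairing X (w i) = tropPoly w c X}

/-- The tropical surface as a subset of `ℝ³`: the maximum is attained at least twice. -/
def tropSurface (w : Fin (N + 2) → Fin 3 → ℤ) (c : Fin (N + 2) → ℚ) : Set (Fin 3 → ℝ) :=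
  {X | (dualCell w c X).Nontrivial}

/-- The tropical polynomial has the largest possible coefficients among those defining the same
function, i.e. `-cᵢ` is the value at `wᵢ` of the convex piecewise linear function Legendre dual to
`tropPoly w c`. Each tropical surface (with given Newton polytope) has exactly one such polynomial
up to an additive constant. -/
def IsReduced (w : Fin (N + 2) → Fin 3 → ℤ) (c : Fin (N + 2) → ℚ) : Prop :=
  ∀ i, ∃ X, i ∈ dualCell w c X

/-- The tropical polynomial `max (Val(aᵢ) + ⟨X, wᵢ⟩)` (over the nonzero coefficients) of
`∑ aᵢ Z^{wᵢ}` is the function `tropPoly w c`. -/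
def TropicalizesTo (w : Fin (N + 2) → Fin 3 → ℤ) (a : Fin (N + 2) → HahnSeries ℚ ℂ)
    (c : Fin (N + 2) → ℚ) : Prop :=
  ∀ X : Fin 3 → ℝ,
    IsGreatest {y : ℝ | ∃ i, a i ≠ 0 ∧ y = (val (a i) : ℝ) + pairing X (w i)} (tropPoly w c X)

/-- The tropical surface given by the (reduced) tropical polynomial `c` is a singular tropical
surface: the tropicalization of a surface with a singularity in `(𝕂*)³`. -/
def IsSingularTropicalSurface (w : Fin (N + 2) → Fin 3 → ℤ) (c : Fin (N + 2) → ℚ) : Prop :=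
  IsReduced w c ∧ ∃ a, IsSingularSurface w a ∧ TropicalizesTo w a c

/-- The lattice points at the positions in `C`. -/
def points (w : Fin (N + 2) → Fin 3 → ℤ) (C : Set (Fin (N + 2))) : Set (Fin 3 → ℤ) := w '' C

/-- The convex hull of the lattice points at the positions in `C`. -/
def hull (w : Fin (N + 2) → Fin 3 → ℤ) (C : Set (Fin (N + 2))) : Set (Fin 3 → ℝ) :=
  convexHull ℝ (toReal '' points w C)

/-- The points at the positions in `C` form a circuit: a minimal affinely dependent set. -/
def IsCircuit (w : Fin (N + 2) → Fin 3 → ℤ) (C : Finset (Fin (N + 2))) : Prop :=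
  ¬ AffineIndependent ℝ (fun i : C => toReal (w i)) ∧
    ∀ D ⊂ C, AffineIndependent ℝ (fun i : D => toReal (w i))

/-- `C` is a circuit in the subdivision dual to the tropical surface: a circuit that consists of
all the lattice points of some cell of the subdivision. -/
def IsCircuitOf (w : Fin (N + 2) → Fin 3 → ℤ) (c : Fin (N + 2) → ℚ)
    (C : Finset (Fin (N + 2))) : Prop :=
  IsCircuit w C ∧ ∃ X, dualCell w c X = (C : Set (Fin (N + 2)))

/-! ### Lattice paths

A lattice path is given by the set of its edges, each edge being a segment in `ℝ³`. -/

/-- The complete lattice path `P(A)`: the segments joining consecutive points of `A`. Here the list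
`w` is in increasing order with respect to `≺`. -/
def completePath (w : Fin (N + 2) → Fin 3 → ℤ) (A : Set (Fin (N + 2))) :
    Set (Set (Fin 3 → ℝ)) :=
  {e | ∃ i ∈ A, ∃ j ∈ A, i < j ∧ (∀ l ∈ A, ¬ (i < l ∧ l < j)) ∧
    e = segment ℝ (toReal (w i)) (toReal (w j))}

/-- The path `Γ_k`, supported on all lattice points except `w k`. -/
def Gam (w : Fin (N + 2) → Fin 3 → ℤ) (k : Fin (N + 2)) : Set (Set (Fin 3 → ℝ)) :=
  completePath w {i | i ≠ k}

/-- The path with a gap `Γ_{k,k+1} = P({w_0,…,w_k}) ∪ P({w_{k+1},…,w_{N+1}})`. -/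
def GamGap (w : Fin (N + 2) → Fin 3 → ℤ) (k : Fin (N + 2)) : Set (Set (Fin 3 → ℝ)) :=
  completePath w {i | i ≤ k} ∪ completePath w {i | k < i}

/-- The lattice path of a tropical surface passing through `x_1, …, x_N`: it consists of the cells
of the dual subdivision that are dual to the faces containing the points `x_s` in their relative
interiors (for the configurations considered here these are edges dual to `2`-faces). -/
def surfacePath (w : Fin (N + 2) → Fin 3 → ℤ) (c : Fin (N + 2) → ℚ) (x : Fin N → Fin 3 → ℝ) :
    Set (Set (Fin 3 → ℝ)) :=
  {e | ∃ s, e = hull w (dualCell w c (x s))}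

/-! ### Point configurations -/

/-- The point `M_s v`. -/
def tropPoint (v : Fin 3 → ℚ) (M : Fin N → ℚ) (s : Fin N) : Fin 3 → ℝ :=
  fun j => (M s : ℝ) * (v j : ℝ)

/-- `0 ≪ M_1 ≪ … ≪ M_N`, where `R` measures what "much larger" means. -/
def IsRapidlyGrowing (R : ℚ) (M : Fin N → ℚ) : Prop :=
  (∀ s, R < M s) ∧ ∀ s s', s < s' → R * M s < M s'

/-- `p_1, …, p_N ∈ (𝕂*)³` with `Val(p_s) = M_s v`. -/
def IsLiftOf (v : Fin 3 → ℚ) (M : Fin N → ℚ) (p : Fin N → Fin 3 → HahnSeries ℚ ℂ) : Prop :=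
  ∀ s j, p s j ∈ puiseux ∧ p s j ≠ 0 ∧ val (p s j) = M s * v j

/-! ### Enhancements -/

/-- The coefficients have the form `aᵢ = (αᵢ + O(t^{>0})) t^{-cᵢ}` with `αᵢ ≠ 0`. -/
def HasInitialVector (c : Fin (N + 2) → ℚ) (a : Fin (N + 2) → HahnSeries ℚ ℂ)
    (α : Fin (N + 2) → ℂ) : Prop :=
  ∀ i, α i ≠ 0 ∧ (a i).coeff (-c i) = α i ∧ ∀ q < -c i, (a i).coeff q = 0

/-- The set `A(S, p)` of enhancements: the points `[α] ∈ ℙ^{N+1}` coming from polynomials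
`φ = ∑ (αᵢ + O(t^{>0})) t^{-cᵢ} Z^{wᵢ}` over `𝕂` with all `αᵢ ≠ 0` that vanish at all the points
`p_s`, and for which `∑_{i ∈ C} αᵢ Z^{wᵢ}` has a singularity in `(ℂ*)³`. -/
def enhancements (w : Fin (N + 2) → Fin 3 → ℤ) (c : Fin (N + 2) → ℚ) (C : Finset (Fin (N + 2)))
    (p : Fin N → Fin 3 → HahnSeries ℚ ℂ) : Set (ℙ ℂ (Fin (N + 2) → ℂ)) :=
  {P | ∃ (α : Fin (N + 2) → ℂ) (hα : α ≠ 0) (a : Fin (N + 2) → HahnSeries ℚ ℂ),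
    P = Projectivization.mk ℂ α hα ∧
    (∀ i, a i ∈ puiseux) ∧ HasInitialVector c a α ∧
    (∀ s, laurentEval w Finset.univ a (p s) = 0) ∧
    ∃ z : Fin 3 → ℂ, IsTorusSingularPoint w C α z}

/-! ### Types of circuits, up to affine automorphisms of `ℤ³` -/

/-- The group of affine automorphisms of `ℤ³`. -/
abbrev AffAut := (Fin 3 → ℤ) ≃ᵃ[ℤ] (Fin 3 → ℤ)

/-- The vertices of the pentatope `Π_{p,q}`. -/
def pentatope (p q : ℕ) : Set (Fin 3 → ℤ) :=
  {![0, 0, 0], ![1, 0, 0], ![0, 1, 0], ![0, 0, 1], ![1, (p : ℤ), (q : ℤ)]}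

/-- `Φ` identifies the point set `C` with the vertices of the pentatope `Π_{p,q}`, where `p, q > 0`
are coprime; `C` is of type A if there are such `p, q, Φ`. -/
def IsTypeAVia (C : Set (Fin 3 → ℤ)) (p q : ℕ) (Φ : AffAut) : Prop :=
  0 < p ∧ 0 < q ∧ Nat.Coprime p q ∧ Φ '' C = pentatope p q

/-- The exponent `d(ω)` of the coefficient `a_ω` in the discriminantal equation
`const · a₀₀₀^{p+q} a₁₀₀^{-1} a₀₁₀^{-p} a₀₀₁^{-q} a_{1pq} = 1` of the pentatope `Π_{p,q}`
(it is `0` for points other than the vertices, which do not occur in the equation). -/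
def discExponent (p q : ℕ) (ω : Fin 3 → ℤ) : ℤ :=
  if ω = ![0, 0, 0] then (p : ℤ) + q
  else if ω = ![1, 0, 0] then -1
  else if ω = ![0, 1, 0] then -p
  else if ω = ![0, 0, 1] then -q
  else if ω = ![1, (p : ℤ), (q : ℤ)] then 1
  else 0

/-- The eight normal forms of circuits of type B: the fourth vertex of the tetrahedron with the
other vertices `(0,0,0), (1,0,0), (0,1,0)`, and the unique lattice point in its interior. -/
def tetrahedra : Set ((Fin 3 → ℤ) × (Fin 3 → ℤ)) :=
  {(![3, 3, 4], ![1, 1, 1]), (![2, 2, 5], ![1, 1, 2]), (![2, 4, 7], ![1, 2, 3]),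
   (![2, 6, 11], ![1, 3, 5]), (![2, 7, 13], ![1, 3, 5]), (![2, 9, 17], ![1, 4, 7]),
   (![2, 13, 19], ![1, 5, 7]), (![3, 7, 20], ![1, 2, 5])}

/-- Type B: the four vertices and the interior lattice point of one of the eight tetrahedra. -/
def IsTypeB (C : Set (Fin 3 → ℤ)) : Prop :=
  ∃ T ∈ tetrahedra, ∃ Φ : AffAut, Φ '' C = {![0, 0, 0], ![1, 0, 0], ![0, 1, 0], T.1, T.2}

/-- The convex hull of `C` can be taken to the tetrahedron
`conv {(0,0,0), (1,0,0), (0,1,0), (3,7,20)}` by an affine automorphism of `ℤ³`. -/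
def IsExceptional (C : Set (Fin 3 → ℤ)) : Prop :=
  ∃ Φ : AffAut, convexHull ℝ (toReal '' (Φ '' C)) =
    convexHull ℝ (toReal '' {![0, 0, 0], ![1, 0, 0], ![0, 1, 0], ![3, 7, 20]})

/-- Type C: the vertices and the interior lattice point of a triangle of lattice area `3`. -/
def IsTypeC (C : Set (Fin 3 → ℤ)) : Prop :=
  ∃ Φ : AffAut, Φ '' C = {![1, 0, 0], ![2, 1, 0], ![0, 2, 0], ![1, 1, 0]}

/-- Type D: the vertices of a unit parallelogram. -/
def IsTypeD (C : Set (Fin 3 → ℤ)) : Prop :=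
  ∃ Φ : AffAut, Φ '' C = {![0, 0, 0], ![1, 0, 0], ![0, 1, 0], ![1, 1, 0]}

/-- Type E: the lattice points of a segment of lattice length `2`. -/
def IsTypeE (C : Set (Fin 3 → ℤ)) : Prop :=
  ∃ Φ : AffAut, Φ '' C = {![0, 0, 0], ![0, 0, 1], ![0, 0, 2]}

end TropSurf

end

/-!
Only the line `ℝ v` through the points `x_s = M_s v` matters for the position of the points. On it the
`i`-th monomial of the tropical polynomial is the linear function `c i + M * ⟨w_i, v⟩`, with slopes
increasing in `i`. At `M_s` the maximum is attained at least twice, with extreme positions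
`l s < r s`, and convexity gives `r s ≤ l (s + 1)`. As there are `N` such steps and `N + 2`
positions, the graph with the edges `{l s, r s}` has exactly two components, one of which is a single
position or an upper set (`IsStepChain.exists_isComponent`).

A vector `α` with nonzero entries is the initial vector of a polynomial over the field of Puiseux
series through the points `p_s` if and only if the dominant terms at each `p_s` cancel. These are `N`
linear equations in echelon form with pivots `r s`, so that solutions over the residue field lift to
the valuation ring (`exists_polynomial_iff`). A polynomial supported on a circuit is singular in the
torus if and only if its coefficients satisfy one binomial equation, with the primitive affine
relation `λ` of the circuit as exponents (`IsCircuit.exists_singular_iff`). If the maximum at every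
`M_s` is attained exactly twice, then the linear equations fix the ratios of the `α i` inside each
component of the graph, so that their projective solutions form a copy of `ℂ*`, on which the binomial
equation becomes `x ^ (∑_Q λ) = K`, where `Q` is a component: it has `|∑_Q λ|` solutions if the
exponent is not zero (`ncard_enhancements_of_pairs`).

The rapid growth of `M` is used twice (`exists_growth_bound_circuits`). The function `-c` differs from
a potential with increments `M_s ⟨w_{r s} - w_{l s}, v⟩` by a function that is constant on the
components, while `λ` is orthogonal to `c`, because the points of the circuit form a cell of the
subdivision. If `∑_Q λ = 0`, this is a linear equation for `M` with coefficients from a finite set, so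
that these coefficients, which determine `λ`, vanish. Similarly, if the maximum at some `M_s` is
attained three times, then the circuit lies in the dual cell of `x_s`; by the convexity of the polytope
its middle point is the midpoint of the two others (`eq_midpoint_of_circuit_subset`). Then the
circuit is of type E and is an edge of the path, and the restriction of the polynomial to it is the
square of a binomial, which leaves a single solution (`ncard_enhancements_of_midpoint`).

It remains to evaluate `|∑_Q λ|` when the maximum is attained twice everywhere. For type A the path is
given, and `λ` consists of the exponents `d`. For types B, C and E the circuit has a point `o` in the
relative interior of the convex hull of the others; no edge of the path ends there, since a linear
function maximal at `o` is constant on the circuit (`ne_of_interior`), so that `o` is a component by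
itself and the number is `|λ o|`. For type D the possible sums over a component that is a point or an
upper set are `±1`: the value `0` is excluded by the growth of `M`, and `±2` since the two diagonals
have the same midpoint. The
volumes in types B and C are computed on the models, as the volumes of simplices.
-/

noncomputable section

namespace TropSurf

/-! ### The field of locally convergent Puiseux series -/

/-- Absolute convergence at `ρ` implies absolute convergence at every smaller positive value, as the
exponents are bounded below. -/
theorem summable_norm_of_le {f : HahnSeries ℚ ℂ} {ρ ρ' : ℝ} (hρ' : 0 < ρ') (h : ρ' ≤ ρ)
    (hf : Summable fun q : ℚ => ‖f.coeff q‖ * ρ ^ (q : ℝ)) :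
    Summable fun q : ℚ => ‖f.coeff q‖ * ρ' ^ (q : ℝ) := by
  have hρ : 0 < ρ := hρ'.trans_le h
  refine Summable.of_nonneg_of_le (fun q => by positivity) (fun q => ?_)
    (hf.mul_left ((ρ' / ρ) ^ (f.order : ℝ)))
  by_cases hq : f.coeff q = 0
  · simp [hq]
  have h1 : (ρ' / ρ) ^ (q : ℝ) ≤ (ρ' / ρ) ^ (f.order : ℝ) := by
    apply Real.rpow_le_rpow_of_exponent_ge (by positivity) ((div_le_one hρ).2 h)
    exact_mod_cast HahnSeries.order_le_of_coeff_ne_zero hq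
  have h2 : ρ' ^ (q : ℝ) = (ρ' / ρ) ^ (q : ℝ) * ρ ^ (q : ℝ) := by
    rw [← Real.mul_rpow (by positivity) hρ.le, div_mul_cancel₀ _ hρ.ne']
  rw [h2]
  calc ‖f.coeff q‖ * ((ρ' / ρ) ^ (q : ℝ) * ρ ^ (q : ℝ))
      = (ρ' / ρ) ^ (q : ℝ) * (‖f.coeff q‖ * ρ ^ (q : ℝ)) := by ring
    _ ≤ _ := by gcongr

theorem single_mem_puiseux (q : ℚ) (z : ℂ) : HahnSeries.single q z ∈ puiseux := by
  refine ⟨⟨q.den, q.den_pos, fun r hr => ?_⟩, 1, one_pos, ?_⟩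
  · have : r = q := by
      by_contra h
      exact hr (HahnSeries.coeff_single_of_ne h)
    exact ⟨q.num, by rw [this]; exact (Rat.num_div_den q).symm⟩
  · apply summable_of_ne_finset_zero (s := {q})
    intro b hb
    rw [HahnSeries.coeff_single_of_ne (by simpa using hb)]
    simp

/-- Two Puiseux series have a common denominator of the exponents and a common radius of
convergence. -/
theorem exists_common_bounds {f g : HahnSeries ℚ ℂ} (hf : f ∈ puiseux) (hg : g ∈ puiseux) :
    ∃ m : ℕ, 0 < m ∧ ∃ ρ : ℝ, 0 < ρ ∧
      (∀ q : ℚ, f.coeff q ≠ 0 → ∃ n : ℤ, q = (n : ℚ) / (m : ℚ)) ∧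
      (∀ q : ℚ, g.coeff q ≠ 0 → ∃ n : ℤ, q = (n : ℚ) / (m : ℚ)) ∧
      (Summable fun q : ℚ => ‖f.coeff q‖ * ρ ^ (q : ℝ)) ∧
      Summable fun q : ℚ => ‖g.coeff q‖ * ρ ^ (q : ℝ) := by
  obtain ⟨⟨m, hm, hm'⟩, ρ, hρ, hρ'⟩ := hf
  obtain ⟨⟨k, hk, hk'⟩, σ, hσ, hσ'⟩ := hg
  have hmq : (m : ℚ) ≠ 0 := by positivity
  have hkq : (k : ℚ) ≠ 0 := by positivity
  refine ⟨m * k, by positivity, min ρ σ, lt_min hρ hσ, fun q hq => ?_, fun q hq => ?_,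
    summable_norm_of_le (lt_min hρ hσ) (min_le_left _ _) hρ',
    summable_norm_of_le (lt_min hρ hσ) (min_le_right _ _) hσ'⟩
  · obtain ⟨n, rfl⟩ := hm' q hq
    exact ⟨n * k, by push_cast; field_simp⟩
  · obtain ⟨n, rfl⟩ := hk' q hq
    exact ⟨n * m, by push_cast; field_simp⟩

theorem add_mem_puiseux {f g : HahnSeries ℚ ℂ} (hf : f ∈ puiseux) (hg : g ∈ puiseux) :
    f + g ∈ puiseux := by
  obtain ⟨m, hm, ρ, hρ, h1, h2, h3, h4⟩ := exists_common_bounds hf hg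
  refine ⟨⟨m, hm, fun q hq => ?_⟩, ρ, hρ, ?_⟩
  · by_cases hfq : f.coeff q = 0
    · exact h2 q (by simpa [hfq] using hq)
    · exact h1 q hfq
  · refine Summable.of_nonneg_of_le (fun q => by positivity) (fun q => ?_) (h3.add h4)
    rw [← add_mul]
    gcongr
    exact norm_add_le _ _

theorem neg_mem_puiseux {f : HahnSeries ℚ ℂ} (hf : f ∈ puiseux) : -f ∈ puiseux := by
  obtain ⟨⟨m, hm, h1⟩, ρ, hρ, h2⟩ := hf
  exact ⟨⟨m, hm, fun q hq => h1 q (by simpa using hq)⟩, ρ, hρ, by simpa using h2⟩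

theorem mul_mem_puiseux {f g : HahnSeries ℚ ℂ} (hf : f ∈ puiseux) (hg : g ∈ puiseux) :
    f * g ∈ puiseux := by
  obtain ⟨m, hm, ρ, hρ, h1, h2, h3, h4⟩ := exists_common_bounds hf hg
  refine ⟨⟨m, hm, fun q hq => ?_⟩, ρ, hρ, ?_⟩
  · rw [HahnSeries.coeff_mul] at hq
    obtain ⟨ij, hij, hne⟩ := Finset.exists_ne_zero_of_sum_ne_zero hq
    obtain ⟨a, ha⟩ := h1 ij.1 (left_ne_zero_of_mul hne)
    obtain ⟨b, hb⟩ := h2 ij.2 (right_ne_zero_of_mul hne)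
    refine ⟨a + b, ?_⟩
    rw [← (Finset.mem_antidiagonal.1 hij).2.2, ha, hb]
    push_cast
    ring
  · set A : ℚ → ℝ := fun q => ‖f.coeff q‖ * ρ ^ (q : ℝ)
    set B : ℚ → ℝ := fun q => ‖g.coeff q‖ * ρ ^ (q : ℝ)
    have hA : ∀ q, 0 ≤ A q := fun q => by positivity
    have hB : ∀ q, 0 ≤ B q := fun q => by positivity
    have hAB : Summable fun x : ℚ × ℚ => A x.1 * B x.2 := h3.mul_of_nonneg h4 hA hB
    let e : ℚ × ℚ ≃ ℚ × ℚ :=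
      { toFun := fun x => (x.2, x.1 - x.2)
        invFun := fun y => (y.1 + y.2, y.1)
        left_inv := fun x => by simp
        right_inv := fun y => by simp }
    have hAB' : Summable fun x : ℚ × ℚ => A x.2 * B (x.1 - x.2) := (e.summable_iff).2 hAB
    refine Summable.of_nonneg_of_le (fun q => by positivity) (fun q => ?_) hAB'.prod
    have hq : Summable fun i => A i * B (q - i) := hAB'.prod_factor q
    rw [HahnSeries.coeff_mul]
    calc ‖∑ ij ∈ Finset.antidiagonal f.isPWO_support g.isPWO_support q,
            f.coeff ij.1 * g.coeff ij.2‖ * ρ ^ (q : ℝ)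
        ≤ (∑ ij ∈ Finset.antidiagonal f.isPWO_support g.isPWO_support q,
            ‖f.coeff ij.1‖ * ‖g.coeff ij.2‖) * ρ ^ (q : ℝ) := by
          gcongr
          refine (norm_sum_le _ _).trans (le_of_eq ?_)
          simp
      _ = ∑ ij ∈ Finset.antidiagonal f.isPWO_support g.isPWO_support q,
            A ij.1 * B (q - ij.1) := by
          rw [Finset.sum_mul]
          refine Finset.sum_congr rfl fun ij hij => ?_
          have h : ij.1 + ij.2 = q := (Finset.mem_antidiagonal.1 hij).2.2
          have h' : q - ij.1 = ij.2 := by rw [← h]; ring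
          simp only [A, B, h']
          rw [← h, Rat.cast_add, Real.rpow_add hρ]
          ring
      _ = ∑ i ∈ (Finset.antidiagonal f.isPWO_support g.isPWO_support q).image Prod.fst,
            A i * B (q - i) := by
          rw [Finset.sum_image]
          intro x hx y hy hxy
          have h : x.1 + x.2 = q := (Finset.mem_antidiagonal.1 hx).2.2
          have h' : y.1 + y.2 = q := (Finset.mem_antidiagonal.1 hy).2.2
          have hxy' : x.1 = y.1 := hxy
          exact Prod.ext hxy' (by linarith)
      _ ≤ ∑' i, A i * B (q - i) :=
          hq.sum_le_tsum _ fun i _ => mul_nonneg (hA _) (hB _)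

/-- The coefficients of the reciprocal of a power series grow at most geometrically if those of
the series do. -/
theorem exists_norm_coeff_inv_le (F : PowerSeries ℂ) (h0 : PowerSeries.constantCoeff F = 1)
    (B : ℝ) (hB : 0 ≤ B) (hF : ∀ n, n ≠ 0 → ‖PowerSeries.coeff n F‖ ≤ B ^ n) (n : ℕ) :
    ‖PowerSeries.coeff n F⁻¹‖ ≤ (2 * B) ^ n := by
  induction n using Nat.strong_induction_on with
  | _ n ih =>
    rcases Nat.eq_zero_or_pos n with rfl | hn
    · simp [h0]
    have hmul : PowerSeries.coeff n (F * F⁻¹) = 0 := by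
      rw [PowerSeries.mul_inv_cancel _ (by simp [h0]), PowerSeries.coeff_one, if_neg hn.ne']
    rw [PowerSeries.coeff_mul, Finset.Nat.sum_antidiagonal_eq_sum_range_succ_mk,
      Finset.sum_range_succ'] at hmul
    have hF0 : PowerSeries.coeff 0 F = 1 := by simpa using h0
    simp only [hF0, one_mul, tsub_zero] at hmul
    rw [eq_neg_of_add_eq_zero_right hmul, norm_neg]
    calc ‖∑ k ∈ Finset.range n, PowerSeries.coeff (k + 1) F *
            PowerSeries.coeff (n - (k + 1)) F⁻¹‖
        ≤ ∑ k ∈ Finset.range n, B ^ n * 2 ^ (n - 1 - k) := by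
          refine (norm_sum_le _ _).trans (Finset.sum_le_sum fun k hk => ?_)
          have hk' : k < n := Finset.mem_range.1 hk
          rw [norm_mul]
          calc _ ≤ B ^ (k + 1) * (2 * B) ^ (n - (k + 1)) :=
                mul_le_mul (hF _ (by omega)) (ih _ (by omega)) (norm_nonneg _) (by positivity)
            _ = B ^ n * 2 ^ (n - 1 - k) := by
                rw [mul_pow, show n - 1 - k = n - (k + 1) by omega]
                rw [show B ^ n = B ^ (k + 1) * B ^ (n - (k + 1)) by
                  rw [← pow_add]; congr 1; omega]
                ring
      _ = B ^ n * ∑ k ∈ Finset.range n, 2 ^ k := by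
          rw [← Finset.mul_sum, Finset.sum_range_reflect (fun k => (2 : ℝ) ^ k) n]
      _ ≤ B ^ n * 2 ^ n := by
          gcongr
          rw [geom_sum_eq (by norm_num)]
          have : (0 : ℝ) < 2 ^ n := by positivity
          rw [div_le_iff₀ (by norm_num)]
          linarith
      _ = (2 * B) ^ n := by rw [mul_pow]; ring

/-- The embedding of power series into Hahn series that substitutes `t ^ (1 / m)` for the
variable. -/
def rootSubst (m : ℕ) (hm : 0 < m) : PowerSeries ℂ →+* HahnSeries ℚ ℂ :=
  (HahnSeries.embDomainRingHom
    ((AddMonoidHom.mulRight ((m : ℚ)⁻¹)).comp (Nat.castAddMonoidHom ℚ))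
    (fun a b h => by
      have : ((m : ℚ)⁻¹) ≠ 0 := by positivity
      simpa [this, hm.ne'] using h)
    (fun a b => by
      have : 0 < ((m : ℚ)⁻¹) := by positivity
      simp [mul_le_mul_iff_left₀ this])).comp
    (RingEquiv.toRingHom HahnSeries.toPowerSeries.symm)

theorem coeff_rootSubst (m : ℕ) (hm : 0 < m) (F : PowerSeries ℂ) (n : ℕ) :
    (rootSubst m hm F).coeff ((n : ℚ) / m) = PowerSeries.coeff n F := by
  rw [div_eq_mul_inv]
  exact HahnSeries.embDomain_coeff

theorem coeff_rootSubst_of_ne (m : ℕ) (hm : 0 < m) (F : PowerSeries ℂ) (q : ℚ)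
    (hq : ∀ n : ℕ, q ≠ (n : ℚ) / m) : (rootSubst m hm F).coeff q = 0 := by
  refine HahnSeries.embDomain_of_notMem_range ?_
  rintro ⟨n, rfl⟩
  exact hq n (by rw [div_eq_mul_inv]; rfl)

/-- A series with constant term `1` and without negative exponents is a power series in `t ^ (1 / m)`
with geometrically bounded coefficients, and so is its reciprocal. -/
theorem inv_mem_puiseux_of_coeff_zero_eq_one {f : HahnSeries ℚ ℂ} (hf : f ∈ puiseux)
    (hneg : ∀ q < 0, f.coeff q = 0) (h1 : f.coeff 0 = 1) : f⁻¹ ∈ puiseux := by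
  obtain ⟨⟨m, hm, hm'⟩, ρ, hρ, hs⟩ := hf
  have hmq : (0 : ℚ) < m := by positivity
  set F : PowerSeries ℂ := PowerSeries.mk fun n => f.coeff ((n : ℚ) / m) with hF
  have hfF : f = rootSubst m hm F := by
    ext q
    by_cases hq : ∃ n : ℕ, q = (n : ℚ) / m
    · obtain ⟨n, rfl⟩ := hq
      rw [coeff_rootSubst, hF, PowerSeries.coeff_mk]
    · rw [coeff_rootSubst_of_ne m hm F q (by simpa using hq)]
      by_contra hne
      obtain ⟨n, hn⟩ := hm' q hne
      have hq0 : 0 ≤ q := le_of_not_gt fun h => hne (hneg q h)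
      have hn0 : 0 ≤ n := by
        rw [hn, le_div_iff₀ hmq, zero_mul] at hq0
        exact_mod_cast hq0
      lift n to ℕ using hn0
      exact hq ⟨n, by simpa using hn⟩
  have hF0 : PowerSeries.constantCoeff F = 1 := by
    rw [← PowerSeries.coeff_zero_eq_constantCoeff_apply, hF, PowerSeries.coeff_mk]
    simpa using h1
  have hinv : f⁻¹ = rootSubst m hm F⁻¹ := by
    refine inv_eq_of_mul_eq_one_right ?_
    rw [hfF, ← map_mul, PowerSeries.mul_inv_cancel _ (by simp [hF0]), map_one]
  -- the terms of a convergent series are bounded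
  set σ : ℝ := ρ ^ ((m : ℝ)⁻¹) with hσ
  have hσ0 : 0 < σ := by positivity
  set A : ℝ := 1 + ∑' q : ℚ, ‖f.coeff q‖ * ρ ^ (q : ℝ) with hA
  have hA1 : 1 ≤ A := by
    rw [hA]
    have : 0 ≤ ∑' q : ℚ, ‖f.coeff q‖ * ρ ^ (q : ℝ) := tsum_nonneg fun q => by positivity
    linarith
  have hA0 : 0 < A := by linarith
  have hbound : ∀ n, n ≠ 0 → ‖PowerSeries.coeff n F‖ ≤ (A / σ) ^ n := by
    intro n hn
    rw [hF, PowerSeries.coeff_mk, div_pow, le_div_iff₀ (by positivity)]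
    have h2 : σ ^ n = ρ ^ (((n : ℚ) / m : ℚ) : ℝ) := by
      rw [hσ, ← Real.rpow_natCast, ← Real.rpow_mul hρ.le]
      congr 1
      push_cast
      ring
    rw [h2]
    calc _ ≤ ∑' q : ℚ, ‖f.coeff q‖ * ρ ^ (q : ℝ) :=
          hs.le_tsum ((n : ℚ) / m) fun q _ => by positivity
      _ ≤ A := by rw [hA]; linarith
      _ ≤ A ^ n := le_self_pow₀ hA1 hn
  have hcoeff := exists_norm_coeff_inv_le F hF0 (A / σ) (by positivity) hbound
  refine ⟨⟨m, hm, fun q hq => ?_⟩, (σ / (4 * A)) ^ (m : ℝ), by positivity, ?_⟩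
  · by_contra hcon
    rw [hinv] at hq
    exact hq (coeff_rootSubst_of_ne m hm _ q fun n hn => hcon ⟨n, by simpa using hn⟩)
  · have hinj : Function.Injective fun n : ℕ => ((n : ℚ) / m) := by
      intro a b hab
      have := (div_left_inj' hmq.ne').1 hab
      exact_mod_cast this
    refine (hinj.summable_iff fun q hq => ?_).1 ?_
    · rw [hinv, coeff_rootSubst_of_ne m hm _ q fun n hn => hq ⟨n, hn.symm⟩]
      simp
    · refine Summable.of_nonneg_of_le
        (fun n => mul_nonneg (norm_nonneg _) (Real.rpow_nonneg (by positivity) _)) (fun n => ?_)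
        (summable_geometric_of_lt_one (r := (1 / 2 : ℝ)) (by norm_num) (by norm_num))
      have h3 : ((σ / (4 * A)) ^ (m : ℝ)) ^ (((n : ℚ) / m : ℚ) : ℝ) = (σ / (4 * A)) ^ n := by
        rw [← Real.rpow_mul (by positivity), ← Real.rpow_natCast]
        congr 1
        have : (m : ℝ) ≠ 0 := by positivity
        push_cast
        field_simp
      simp only [Function.comp]
      rw [h3, hinv, coeff_rootSubst]
      calc _ ≤ (2 * (A / σ)) ^ n * (σ / (4 * A)) ^ n := by gcongr; exact hcoeff n
        _ = (1 / 2 : ℝ) ^ n := by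
          rw [← mul_pow]
          congr 1
          field_simp
          norm_num

theorem inv_mem_puiseux {f : HahnSeries ℚ ℂ} (hf : f ∈ puiseux) : f⁻¹ ∈ puiseux := by
  by_cases h0 : f = 0
  · simpa [h0] using hf
  have hc : f.coeff f.order ≠ 0 := fun h => h0 (HahnSeries.coeff_order_eq_zero.1 h)
  set s : HahnSeries ℚ ℂ := HahnSeries.single (-f.order) (f.coeff f.order)⁻¹ with hs
  have hs0 : s ≠ 0 := HahnSeries.single_ne_zero (inv_ne_zero hc)
  have hcoeff : ∀ q, (s * f).coeff q = (f.coeff f.order)⁻¹ * f.coeff (q + f.order) := by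
    intro q
    rw [hs, HahnSeries.coeff_single_mul, sub_neg_eq_add]
  have h := inv_mem_puiseux_of_coeff_zero_eq_one
    (mul_mem_puiseux (single_mem_puiseux (-f.order) (f.coeff f.order)⁻¹) hf)
    (fun q hq => by
      have hlt : q + f.order < f.order := by linarith
      rw [hcoeff, HahnSeries.coeff_eq_zero_of_lt_order hlt, mul_zero])
    (by rw [hcoeff, zero_add, inv_mul_cancel₀ hc])
  have : f⁻¹ = s * (s * f)⁻¹ := by
    field_simp
  rw [this]
  exact mul_mem_puiseux (single_mem_puiseux _ _) h

/-! ### Lifting initial coefficients to polynomials over the field of Puiseux series -/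

variable {N : ℕ}

/-- The locally convergent Puiseux series form a subfield of the Hahn series. -/
def puiseuxSubfield : Subfield (HahnSeries ℚ ℂ) where
  carrier := puiseux
  mul_mem' := mul_mem_puiseux
  one_mem' := single_mem_puiseux 0 1
  add_mem' := add_mem_puiseux
  zero_mem' := by simpa using single_mem_puiseux 0 0
  neg_mem' := neg_mem_puiseux
  inv_mem' := fun _ => inv_mem_puiseux

theorem coeff_mul_eq_zero_of_neg {f g : HahnSeries ℚ ℂ} (hf : ∀ q < 0, f.coeff q = 0)
    (hg : ∀ q < 0, g.coeff q = 0) (q : ℚ) (hq : q < 0) : (f * g).coeff q = 0 := by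
  rw [HahnSeries.coeff_mul]
  refine Finset.sum_eq_zero fun ij hij => ?_
  have h : ij.1 + ij.2 = q := (Finset.mem_antidiagonal.1 hij).2.2
  rcases lt_or_ge ij.1 0 with h1 | h1
  · rw [hf _ h1, zero_mul]
  · rw [hg _ (by linarith), mul_zero]

theorem coeff_zero_mul {f g : HahnSeries ℚ ℂ} (hf : ∀ q < 0, f.coeff q = 0)
    (hg : ∀ q < 0, g.coeff q = 0) : (f * g).coeff 0 = f.coeff 0 * g.coeff 0 := by
  rw [HahnSeries.coeff_mul]
  have key : ∀ ij ∈ Finset.antidiagonal f.isPWO_support g.isPWO_support (0 : ℚ),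
      ij = (0, 0) := by
    intro ij hij
    obtain ⟨h1, h2, h3⟩ := Finset.mem_antidiagonal.1 hij
    have h1' : 0 ≤ ij.1 := le_of_not_gt fun h => h1 (hf _ h)
    have h2' : 0 ≤ ij.2 := le_of_not_gt fun h => h2 (hg _ h)
    exact Prod.ext (by simp only; linarith) (by simp only; linarith)
  by_cases h : (0, 0) ∈ Finset.antidiagonal f.isPWO_support g.isPWO_support (0 : ℚ)
  · exact Finset.sum_eq_single_of_mem _ h fun b hb hne => absurd (key b hb) hne
  · rw [Finset.sum_eq_zero fun ij hij => absurd (key ij hij ▸ hij) h]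
    by_contra hne
    have h' := Ne.symm hne
    exact h (Finset.mem_antidiagonal.2
      ⟨left_ne_zero_of_mul h', right_ne_zero_of_mul h', add_zero 0⟩)

/-- The valuation ring of the field of Puiseux series: no negative exponents occur. -/
def puiseuxIntegers : Subring (HahnSeries ℚ ℂ) where
  carrier := {f | f ∈ puiseux ∧ ∀ q < 0, f.coeff q = 0}
  mul_mem' := fun hf hg => ⟨mul_mem_puiseux hf.1 hg.1, coeff_mul_eq_zero_of_neg hf.2 hg.2⟩
  one_mem' := ⟨single_mem_puiseux 0 1, fun q hq => HahnSeries.coeff_single_of_ne hq.ne⟩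
  add_mem' := fun hf hg => ⟨add_mem_puiseux hf.1 hg.1, fun q hq => by
    simp [hf.2 q hq, hg.2 q hq]⟩
  zero_mem' := ⟨puiseuxSubfield.zero_mem, fun q _ => rfl⟩
  neg_mem' := fun hf => ⟨neg_mem_puiseux hf.1, fun q hq => by simp [hf.2 q hq]⟩

/-- The residue map of the valuation ring: the constant term. -/
def residue : puiseuxIntegers →+* ℂ where
  toFun f := f.1.coeff 0
  map_one' := HahnSeries.coeff_single_same 0 1
  map_mul' f g := coeff_zero_mul f.2.2 g.2.2
  map_zero' := rfl
  map_add' _ _ := rfl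

theorem residue_apply (f : puiseuxIntegers) : residue f = f.1.coeff 0 := rfl

theorem isUnit_of_residue_ne_zero (f : puiseuxIntegers) (hf : residue f ≠ 0) : IsUnit f := by
  have hf0 : f.1 ≠ 0 := fun h => hf (by rw [residue_apply, h]; rfl)
  have hord : f.1.order = 0 := by
    refine le_antisymm (HahnSeries.order_le_of_coeff_ne_zero hf) (le_of_not_gt fun h => hf0 ?_)
    exact HahnSeries.coeff_order_eq_zero.1 (f.2.2 _ h)
  have hord' : (f.1⁻¹).order = 0 := by
    have := HahnSeries.order_mul hf0 (inv_ne_zero hf0)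
    rw [mul_inv_cancel₀ hf0, HahnSeries.order_one, hord, zero_add] at this
    exact this.symm
  refine IsUnit.of_mul_eq_one ⟨f.1⁻¹, inv_mem_puiseux f.2.1, fun q hq => ?_⟩ (Subtype.ext ?_)
  · exact HahnSeries.coeff_eq_zero_of_lt_order (by rwa [hord'])
  · exact mul_inv_cancel₀ hf0

/-- Solutions of a homogeneous linear system over the residue field lift to solutions over a local
ring, if some maximal minor is nonzero in the residue field: the unknowns of the minor can be
corrected so as to compensate the error of any lift. -/
theorem exists_lift_of_det_ne_zero {R k ι σ : Type*} [CommRing R] [Field k] [Fintype ι]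
    [DecidableEq ι] [Fintype σ] [DecidableEq σ] (π : R →+* k) (hπ : ∀ x, π x ≠ 0 → IsUnit x)
    (U : σ → ι → R) (r : σ → ι) (hdet : (Matrix.of fun s s' => π (U s (r s'))).det ≠ 0)
    (y₀ : ι → R) (h₀ : ∀ s, ∑ i, π (U s i) * π (y₀ i) = 0) :
    ∃ y : ι → R, (∀ s, ∑ i, U s i * y i = 0) ∧ ∀ i, π (y i) = π (y₀ i) := by
  set A : Matrix σ σ R := Matrix.of fun s s' => U s (r s') with hA
  have hAdet : IsUnit A.det := by
    refine hπ _ ?_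
    rw [RingHom.map_det]
    exact hdet
  set b : σ → R := fun s => ∑ i, U s i * y₀ i with hb
  have hb0 : ∀ s, π (b s) = 0 := fun s => by
    simp only [hb, map_sum, map_mul]
    exact h₀ s
  set z : σ → R := -(A⁻¹.mulVec b) with hz
  have hz0 : ∀ s, π (z s) = 0 := fun s => by
    simp [hz, Matrix.mulVec, dotProduct, hb0]
  have hAz : ∀ s, ∑ s', U s (r s') * z s' = -b s := by
    intro s
    have : A.mulVec z = -b := by
      rw [hz, Matrix.mulVec_neg, Matrix.mulVec_mulVec, Matrix.mul_nonsing_inv _ hAdet,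
        Matrix.one_mulVec]
    exact congrFun this s
  refine ⟨fun i => y₀ i + ∑ s', if r s' = i then z s' else 0, fun s => ?_, fun i => ?_⟩
  · simp only [mul_add, Finset.sum_add_distrib, Finset.mul_sum, mul_ite, mul_zero]
    rw [Finset.sum_comm (s := Finset.univ (α := ι)) (t := Finset.univ (α := σ))]
    simp [hAz, hb]
  · simp only [map_add, map_sum, apply_ite π, hz0, map_zero]
    simp

/-- The leading coefficient, as a multiplicative homomorphism. -/
def leadingHom : HahnSeries ℚ ℂ →*₀ ℂ where
  toFun f := f.leadingCoeff
  map_zero' := HahnSeries.leadingCoeff_zero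
  map_one' := HahnSeries.leadingCoeff_one
  map_mul' f g := HahnSeries.leadingCoeff_mul f g

/-- The order of nonzero Hahn series, as a homomorphism to the additive group `ℚ`. -/
def orderHom : (HahnSeries ℚ ℂ)ˣ →* Multiplicative ℚ where
  toFun f := Multiplicative.ofAdd f.1.order
  map_one' := by simp
  map_mul' f g := by
    rw [Units.val_mul, HahnSeries.order_mul f.ne_zero g.ne_zero]
    rfl

/-- The initial coefficients of a point of the torus over the field of Puiseux series. -/
def initialPoint {n : ℕ} (p : Fin n → HahnSeries ℚ ℂ) (j : Fin n) : ℂ := (p j).leadingCoeff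

theorem initialPoint_ne_zero {n : ℕ} {p : Fin n → HahnSeries ℚ ℂ} (hp : ∀ j, p j ≠ 0) (j : Fin n) :
    initialPoint p j ≠ 0 :=
  HahnSeries.leadingCoeff_ne_zero.2 (hp j)

theorem leadingCoeff_monomial {n : ℕ} (p : Fin n → HahnSeries ℚ ℂ) (ω : Fin n → ℤ) :
    (∏ j, p j ^ ω j).leadingCoeff = ∏ j, initialPoint p j ^ ω j := by
  have := map_prod leadingHom (fun j => p j ^ ω j) Finset.univ
  simp only [map_zpow₀] at this
  exact this

theorem order_monomial {n : ℕ} {p : Fin n → HahnSeries ℚ ℂ} (hp : ∀ j, p j ≠ 0) (ω : Fin n → ℤ) :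
    (∏ j, p j ^ ω j).order = ∑ j, (ω j : ℚ) * (p j).order := by
  have := map_prod orderHom (fun j => Units.mk0 (p j) (hp j) ^ ω j) Finset.univ
  simp only [map_zpow] at this
  have h2 := congrArg Multiplicative.toAdd this
  rw [toAdd_prod] at h2
  simp only [toAdd_zpow, orderHom, MonoidHom.coe_mk, OneHom.coe_mk, Units.val_mk0, toAdd_ofAdd,
    zsmul_eq_mul] at h2
  rw [← h2]
  congr 1
  push_cast
  simp

theorem monomial_mem_puiseux {v : Fin 3 → ℚ} {M : Fin N → ℚ}
    {p : Fin N → Fin 3 → HahnSeries ℚ ℂ} (hp : IsLiftOf v M p) (s : Fin N) (ω : Fin 3 → ℤ) :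
    ∏ j, p s j ^ ω j ∈ puiseux :=
  puiseuxSubfield.prod_mem fun j _ => puiseuxSubfield.zpow_mem (hp s j).1 _

theorem order_monomial_of_isLiftOf {v : Fin 3 → ℚ} {M : Fin N → ℚ}
    {p : Fin N → Fin 3 → HahnSeries ℚ ℂ} (hp : IsLiftOf v M p) (s : Fin N) (ω : Fin 3 → ℤ) :
    (∏ j, p s j ^ ω j).order = -(M s * height v ω) := by
  rw [order_monomial fun j => (hp s j).2.1]
  have : ∀ j, (p s j).order = -(M s * v j) := fun j => by
    have := (hp s j).2.2
    rw [val] at this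
    linarith
  simp only [this, height, Finset.mul_sum, ← Finset.sum_neg_distrib]
  exact Finset.sum_congr rfl fun j _ => by ring

/-- A vector `α` with nonzero entries is the vector of initial coefficients of a polynomial through
the points `p_s` if and only if, for every `s`, the terms of maximal valuation at `p_s` cancel in
lowest order. The hypotheses on `r` say that the linear system for `α` is in echelon form, with
pivots `r s`. -/
theorem exists_polynomial_iff {v : Fin 3 → ℚ} {M : Fin N → ℚ}
    {p : Fin N → Fin 3 → HahnSeries ℚ ℂ} (hp : IsLiftOf v M p) (w : Fin (N + 2) → Fin 3 → ℤ)
    (c : Fin (N + 2) → ℚ) (T : Fin N → ℚ) (hT : ∀ s i, c i + M s * height v (w i) ≤ T s)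
    (r : Fin N → Fin (N + 2)) (hr : StrictMono r)
    (hrT : ∀ s, c (r s) + M s * height v (w (r s)) = T s)
    (hrmax : ∀ s i, c i + M s * height v (w i) = T s → i ≤ r s)
    (α : Fin (N + 2) → ℂ) :
    (∃ a : Fin (N + 2) → HahnSeries ℚ ℂ, (∀ i, a i ∈ puiseux) ∧ HasInitialVector c a α ∧
      ∀ s, laurentEval w Finset.univ a (p s) = 0) ↔
    (∀ i, α i ≠ 0) ∧ ∀ s, ∑ i, (if c i + M s * height v (w i) = T s then
      ∏ j, initialPoint (p s) j ^ w i j else 0) * α i = 0 := by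
  -- the coefficients of the normalized system
  have hu : ∀ s i, ((HahnSeries.single (T s - c i) 1 * ∏ j, p s j ^ w i j : HahnSeries ℚ ℂ)) ∈
      puiseuxIntegers := by
    intro s i
    refine ⟨mul_mem_puiseux (single_mem_puiseux _ _) (monomial_mem_puiseux hp s _), fun q hq => ?_⟩
    rw [HahnSeries.coeff_single_mul, one_mul]
    refine HahnSeries.coeff_eq_zero_of_lt_order ?_
    rw [order_monomial_of_isLiftOf hp]
    linarith [hT s i]
  set U : Fin N → Fin (N + 2) → puiseuxIntegers := fun s i => ⟨_, hu s i⟩ with hU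
  have hres : ∀ s i, residue (U s i) = if c i + M s * height v (w i) = T s then
      ∏ j, initialPoint (p s) j ^ w i j else 0 := by
    intro s i
    rw [residue_apply, hU]
    simp only
    rw [HahnSeries.coeff_single_mul, one_mul]
    split_ifs with h
    · rw [← leadingCoeff_monomial, HahnSeries.leadingCoeff_eq, order_monomial_of_isLiftOf hp]
      congr 1
      linarith
    · refine HahnSeries.coeff_eq_zero_of_lt_order ?_
      rw [order_monomial_of_isLiftOf hp]
      have := lt_of_le_of_ne (hT s i) h
      linarith
  have hUa : ∀ (a : Fin (N + 2) → HahnSeries ℚ ℂ) s,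
      ∑ i, (U s i : HahnSeries ℚ ℂ) * (HahnSeries.single (c i) 1 * a i) =
        HahnSeries.single (T s) 1 * laurentEval w Finset.univ a (p s) := by
    intro a s
    rw [laurentEval, Finset.mul_sum]
    refine Finset.sum_congr rfl fun i _ => ?_
    have : (HahnSeries.single (T s) 1 : HahnSeries ℚ ℂ) =
        HahnSeries.single (T s - c i) 1 * HahnSeries.single (c i) 1 := by
      rw [HahnSeries.single_mul_single]
      simp
    rw [this, hU]
    ring
  simp only [← hres]
  constructor
  · rintro ⟨a, ha, hα, hvan⟩
    refine ⟨fun i => (hα i).1, fun s => ?_⟩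
    have hy : ∀ i, (HahnSeries.single (c i) 1 * a i : HahnSeries ℚ ℂ) ∈ puiseuxIntegers := by
      intro i
      refine ⟨mul_mem_puiseux (single_mem_puiseux _ _) (ha i), fun q hq => ?_⟩
      rw [HahnSeries.coeff_single_mul, one_mul]
      exact (hα i).2.2 _ (by linarith)
    have hyα : ∀ i, residue ⟨_, hy i⟩ = α i := by
      intro i
      rw [residue_apply, HahnSeries.coeff_single_mul, one_mul, zero_sub]
      exact (hα i).2.1
    have h := hUa a s
    rw [hvan s, mul_zero] at h
    have h' : ∑ i, U s i * ⟨_, hy i⟩ = 0 := by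
      apply Subtype.ext
      push_cast
      exact h
    have := congrArg residue h'
    simpa [map_sum, hyα] using this
  · rintro ⟨hα, hlin⟩
    have hC : ∀ z : ℂ, (HahnSeries.single (0 : ℚ) z) ∈ puiseuxIntegers := fun z =>
      ⟨single_mem_puiseux _ _, fun q hq => HahnSeries.coeff_single_of_ne hq.ne⟩
    have hCres : ∀ z, residue ⟨_, hC z⟩ = z := fun z => HahnSeries.coeff_single_same 0 z
    have hdet : (Matrix.of fun s s' => residue (U s (r s'))).det ≠ 0 := by
      rw [Matrix.det_of_isLowerTriangular]
      · refine Finset.prod_ne_zero_iff.2 fun s _ => ?_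
        rw [Matrix.of_apply, hres, if_pos (hrT s)]
        exact Finset.prod_ne_zero_iff.2 fun j _ =>
          zpow_ne_zero _ (initialPoint_ne_zero (fun j => (hp s j).2.1) j)
      · intro s s' hss'
        have hlt : s < s' := hss'
        rw [Matrix.of_apply, hres, if_neg]
        exact fun h => absurd (hrmax s _ h) (not_le.2 (hr hlt))
    obtain ⟨y, hy, hyα⟩ := exists_lift_of_det_ne_zero residue isUnit_of_residue_ne_zero U r hdet
      (fun i => ⟨_, hC (α i)⟩) (fun s => by simpa only [hCres] using hlin s)
    have hinv : ∀ i, (HahnSeries.single (c i) 1 * (HahnSeries.single (-c i) 1 * (y i).1) :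
        HahnSeries ℚ ℂ) = (y i).1 := by
      intro i
      rw [← mul_assoc, HahnSeries.single_mul_single]
      simp
    refine ⟨fun i => HahnSeries.single (-c i) 1 * (y i).1,
      fun i => mul_mem_puiseux (single_mem_puiseux _ _) (y i).2.1, fun i => ⟨hα i, ?_, ?_⟩,
      fun s => ?_⟩
    · rw [HahnSeries.coeff_single_mul, one_mul, sub_self, ← residue_apply, hyα, hCres]
    · intro q hq
      rw [HahnSeries.coeff_single_mul, one_mul]
      exact (y i).2.2 _ (by linarith)
    · have h := hUa (fun i => HahnSeries.single (-c i) 1 * (y i).1) s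
      simp only [hinv] at h
      have h' := congrArg Subtype.val (hy s)
      push_cast at h'
      rw [h'] at h
      exact (mul_eq_zero.1 h.symm).resolve_left (HahnSeries.single_ne_zero one_ne_zero)

/-! ### Chains of steps and their components -/

/-- The `N` pairs `(l s, r s)` form a chain of disjoint steps in the linearly ordered set of
`N + 2` positions. -/
def IsStepChain (l r : Fin N → Fin (N + 2)) : Prop :=
  (∀ s, l s < r s) ∧ ∀ s s', s < s' → r s ≤ l s'

theorem IsStepChain.strictMono {l r : Fin N → Fin (N + 2)} (h : IsStepChain l r) : StrictMono r :=
  fun s s' hs => (h.2 s s' hs).trans_lt (h.1 s')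

theorem IsStepChain.le_left {l r : Fin N → Fin (N + 2)} (h : IsStepChain l r) (n : ℕ)
    (hn : n < N) : n ≤ (l ⟨n, hn⟩ : ℕ) := by
  induction n with
  | zero => exact Nat.zero_le _
  | succ n ih =>
    have h1 := ih (by omega)
    have h2 : (l ⟨n, by omega⟩ : ℕ) < r ⟨n, by omega⟩ := h.1 _
    have h3 : (r ⟨n, by omega⟩ : ℕ) ≤ l ⟨n + 1, hn⟩ := h.2 _ _ (Nat.lt_succ_self n)
    omega

theorem IsStepChain.right_le {l r : Fin N → Fin (N + 2)} (h : IsStepChain l r) (n : ℕ)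
    (hn : n < N) : (r ⟨n, hn⟩ : ℕ) ≤ n + 2 := by
  suffices H : ∀ d n (hn : n < N), n + 1 + d = N → (r ⟨n, hn⟩ : ℕ) + d ≤ N + 1 by
    have := H (N - (n + 1)) n hn (by omega)
    omega
  intro d
  induction d with
  | zero => intro n hn _; have := (r ⟨n, hn⟩).2; omega
  | succ d ih =>
    intro n hn hd
    have h1 := ih (n + 1) (by omega) (by omega)
    have h2 : (l ⟨n + 1, by omega⟩ : ℕ) < r ⟨n + 1, by omega⟩ := h.1 _
    have h3 : (r ⟨n, hn⟩ : ℕ) ≤ l ⟨n + 1, by omega⟩ := h.2 _ _ (Nat.lt_succ_self n)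
    omega

/-- A chain of `N` steps on `N + 2` positions either consists of all elementary steps but one, or
of elementary steps and one step of length two. -/
theorem IsStepChain.classification {l r : Fin N → Fin (N + 2)} (h : IsStepChain l r) :
    ∃ k ≤ N, (∀ n (hn : n < N), (l ⟨n, hn⟩ : ℕ) = if n < k then n else n + 1) ∧
      ((∀ n (hn : n < N), (r ⟨n, hn⟩ : ℕ) = (l ⟨n, hn⟩ : ℕ) + 1) ∨
        1 ≤ k ∧ ∀ n (hn : n < N), (r ⟨n, hn⟩ : ℕ) =
          if n + 1 = k then k + 1 else (l ⟨n, hn⟩ : ℕ) + 1) := by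
  classical
  have hex : ∃ k, ∀ hk : k < N, (l ⟨k, hk⟩ : ℕ) ≠ k := ⟨N, fun hk => absurd hk (lt_irrefl _)⟩
  obtain ⟨k, hkspec, hmin⟩ : ∃ k, (∀ hk : k < N, (l ⟨k, hk⟩ : ℕ) ≠ k) ∧
      ∀ n < k, ¬ ∀ hn : n < N, (l ⟨n, hn⟩ : ℕ) ≠ n :=
    ⟨Nat.find hex, Nat.find_spec hex, fun n hn => Nat.find_min hex hn⟩
  have hkN : k ≤ N := le_of_not_gt fun hk => hmin N hk fun hn => absurd hn (lt_irrefl _)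
  have hlt : ∀ n (hn : n < N), n < k → (l ⟨n, hn⟩ : ℕ) = n := by
    intro n hn hnk
    have := hmin n hnk
    push Not at this
    obtain ⟨_, h2⟩ := this
    exact h2
  have hbound : ∀ n (hn : n < N), (l ⟨n, hn⟩ : ℕ) < r ⟨n, hn⟩ := fun n hn => h.1 _
  have hstep : ∀ n (hn : n + 1 < N), (r ⟨n, by omega⟩ : ℕ) ≤ l ⟨n + 1, hn⟩ :=
    fun n hn => h.2 _ _ (Nat.lt_succ_self n)
  have hge : ∀ d (hn : k + d < N), (l ⟨k + d, hn⟩ : ℕ) = k + d + 1 := by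
    intro d
    induction d with
    | zero =>
      intro hn
      have h1 := hkspec hn
      have h2 := h.le_left k hn
      have h3 := h.right_le k hn
      have h4 := hbound k hn
      simp only [add_zero]
      omega
    | succ d ih =>
      intro hn
      have h1 := ih (by omega)
      have h2 := hbound (k + d) (by omega)
      have h3 := hstep (k + d) hn
      have h4 := hbound (k + (d + 1)) hn
      have h5 := h.right_le (k + (d + 1)) hn
      have h6 : (l ⟨k + (d + 1), hn⟩ : ℕ) = l ⟨k + d + 1, hn⟩ := rfl
      omega
  have hge' : ∀ n (hn : n < N), k ≤ n → (l ⟨n, hn⟩ : ℕ) = n + 1 := by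
    intro n hn hkn
    obtain ⟨d, rfl⟩ := Nat.exists_eq_add_of_le hkn
    exact hge d hn
  have hr : ∀ n (hn : n < N), n + 1 ≠ k → (r ⟨n, hn⟩ : ℕ) = (l ⟨n, hn⟩ : ℕ) + 1 := by
    intro n hn hnk
    have h2 := hbound n hn
    rcases lt_or_ge n k with h1 | h1
    · have h3 := hstep n (by omega)
      rw [hlt (n + 1) (by omega) (by omega)] at h3
      have h4 := hlt n hn h1
      omega
    · have h3 := h.right_le n hn
      have h4 := hge' n hn h1
      omega
  refine ⟨k, hkN, fun n hn => ?_, ?_⟩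
  · split_ifs with h1
    · exact hlt n hn h1
    · exact hge' n hn (not_lt.1 h1)
  · by_cases hk0 : k = 0
    · exact Or.inl fun n hn => hr n hn (by omega)
    have hk1 : k - 1 < N := by omega
    have h1 := hlt (k - 1) hk1 (by omega)
    have h2 := hbound (k - 1) hk1
    have h3 := h.right_le (k - 1) hk1
    by_cases h4 : (r ⟨k - 1, hk1⟩ : ℕ) = k
    · left
      intro n hn
      by_cases h5 : n + 1 = k
      · have h6 : n = k - 1 := by omega
        subst h6
        omega
      · exact hr n hn h5
    · right
      refine ⟨by omega, fun n hn => ?_⟩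
      split_ifs with h5
      · have h6 : n = k - 1 := by omega
        subst h6
        omega
      · exact hr n hn h5

/-- The graph on the positions with edges `{l s, r s}` has exactly the two connected components
`Q` and its complement. -/
structure IsComponent (l r : Fin N → Fin (N + 2)) (Q : Finset (Fin (N + 2))) : Prop where
  nonempty : Q.Nonempty
  compl_nonempty : Qᶜ.Nonempty
  mem_iff : ∀ s, l s ∈ Q ↔ r s ∈ Q
  eq_of_mem_iff : ∀ (X : Type) (g : Fin (N + 2) → X), (∀ s, g (l s) = g (r s)) →
    ∀ i j, (i ∈ Q ↔ j ∈ Q) → g i = g j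

/-- The graph of a chain of steps has two components, one of which is an upper set (if there is a gap
between consecutive steps) or a single position (if it is skipped by a step of length two). -/
theorem IsStepChain.exists_isComponent {l r : Fin N → Fin (N + 2)} (h : IsStepChain l r) :
    ∃ Q, IsComponent l r Q ∧ ∃ k, Q = {k} ∨ Q = Finset.univ.filter (k < ·) := by
  obtain ⟨k, hkN, hl, hr | ⟨hk, hr⟩⟩ := h.classification
  · refine ⟨Finset.univ.filter ((⟨k, by omega⟩ : Fin (N + 2)) < ·), ⟨?_, ?_, ?_, ?_⟩, _, Or.inr rfl⟩
    · exact ⟨Fin.last _, by simp [Fin.lt_def]; omega⟩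
    · exact ⟨0, by simp⟩
    · rintro ⟨n, hn⟩
      simp only [Finset.mem_filter, Finset.mem_univ, true_and, Fin.lt_def, hr n hn, hl n hn]
      split_ifs <;> omega
    · intro X g hg
      have hedge : ∀ n (hn : n + 1 < N + 2), n ≠ k → g ⟨n + 1, hn⟩ = g ⟨n, by omega⟩ := by
        intro n hn hnk
        have hex : ∃ m, ∃ hm : m < N, (l ⟨m, hm⟩ : ℕ) = n := by
          rcases lt_or_ge n k with h1 | h1
          · exact ⟨n, by omega, by rw [hl]; simp [h1]⟩
          · exact ⟨n - 1, by omega, by rw [hl, if_neg (by omega)]; omega⟩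
        obtain ⟨m, hm, hlm⟩ := hex
        have h1 : l ⟨m, hm⟩ = ⟨n, by omega⟩ := Fin.ext hlm
        have h2 : r ⟨m, hm⟩ = ⟨n + 1, hn⟩ := Fin.ext (by rw [hr, hlm])
        rw [← h1, ← h2, hg]
      have hlow : ∀ n (hn : n < N + 2), n ≤ k → g ⟨n, hn⟩ = g 0 := by
        intro n
        induction n with
        | zero => intro _ _; rfl
        | succ n ih => intro hn hnk; rw [hedge n hn (by omega), ih (by omega) (by omega)]
      have hhigh : ∀ d (hn : k + 1 + d < N + 2), g ⟨k + 1 + d, hn⟩ = g ⟨k + 1, by omega⟩ := by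
        intro d
        induction d with
        | zero => intro _; rfl
        | succ d ih =>
          intro hn
          rw [← ih (by omega)]
          exact hedge (k + 1 + d) hn (by omega)
      rintro ⟨i, hi⟩ ⟨j, hj⟩ hij
      simp only [Finset.mem_filter, Finset.mem_univ, true_and, Fin.lt_def] at hij
      by_cases hik : k < i
      · obtain ⟨d, rfl⟩ := Nat.exists_eq_add_of_le (Nat.succ_le_of_lt hik)
        obtain ⟨d', rfl⟩ := Nat.exists_eq_add_of_le (Nat.succ_le_of_lt (hij.1 hik))
        exact (hhigh d hi).trans (hhigh d' hj).symm
      · rw [hlow i hi (by omega), hlow j hj (by omega)]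
  · refine ⟨{⟨k, by omega⟩}, ⟨?_, ?_, ?_, ?_⟩, _, Or.inl rfl⟩
    · exact ⟨_, Finset.mem_singleton_self _⟩
    · refine ⟨0, ?_⟩
      simp only [Finset.mem_compl, Finset.mem_singleton, Fin.ext_iff, Fin.val_zero]
      omega
    · rintro ⟨n, hn⟩
      simp only [Finset.mem_singleton, Fin.ext_iff, hr n hn, hl n hn]
      split_ifs <;> omega
    · intro X g hg
      have hedge : ∀ n (hn : n + 1 < N + 2), n ≠ k → n + 1 ≠ k →
          g ⟨n + 1, hn⟩ = g ⟨n, by omega⟩ := by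
        intro n hn hnk hnk'
        have hex : ∃ m, ∃ hm : m < N, (l ⟨m, hm⟩ : ℕ) = n ∧ m + 1 ≠ k := by
          rcases lt_or_ge n k with h1 | h1
          · exact ⟨n, by omega, by rw [hl]; simp [h1], by omega⟩
          · exact ⟨n - 1, by omega, by rw [hl, if_neg (by omega)]; omega, by omega⟩
        obtain ⟨m, hm, hlm, hmk⟩ := hex
        have h1 : l ⟨m, hm⟩ = ⟨n, by omega⟩ := Fin.ext hlm
        have h2 : r ⟨m, hm⟩ = ⟨n + 1, hn⟩ := Fin.ext (by rw [hr, if_neg hmk, hlm])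
        rw [← h1, ← h2, hg]
      have hskip : g ⟨k + 1, by omega⟩ = g ⟨k - 1, by omega⟩ := by
        have h1 : l ⟨k - 1, by omega⟩ = ⟨k - 1, by omega⟩ :=
          Fin.ext (by rw [hl, if_pos (by omega)])
        have h2 : r ⟨k - 1, by omega⟩ = ⟨k + 1, by omega⟩ :=
          Fin.ext (by rw [hr, if_pos (by omega)])
        rw [← h1, ← h2, hg]
      have hall : ∀ n, (∀ hn : n < N + 2, n ≠ k → g ⟨n, hn⟩ = g 0) := by
        intro n
        induction n using Nat.strong_induction_on with
        | _ n ih =>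
          intro hn hnk
          rcases n with _ | n
          · rfl
          by_cases h1 : n = k
          · subst h1
            rw [hskip]
            exact ih (n - 1) (by omega) _ (by omega)
          · rw [hedge n hn h1 hnk]
            exact ih n (by omega) _ h1
      rintro ⟨i, hi⟩ ⟨j, hj⟩ hij
      simp only [Finset.mem_singleton, Fin.ext_iff] at hij
      by_cases hik : i = k
      · have : j = k := hij.1 hik
        subst this
        subst hik
        rfl
      · rw [hall i hi hik, hall j hj fun hjk => hik (hij.2 hjk)]

/-- A proper nonempty union of components is one of the two components. -/
theorem IsComponent.eq_or_eq_compl {l r : Fin N → Fin (N + 2)} {Q : Finset (Fin (N + 2))}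
    (hQ : IsComponent l r Q) {P : Finset (Fin (N + 2))} (hP : P.Nonempty) (hP' : Pᶜ.Nonempty)
    (hPl : ∀ s, l s ∈ P ↔ r s ∈ P) : P = Q ∨ P = Qᶜ := by
  have hconst : ∀ i j, (i ∈ Q ↔ j ∈ Q) → (i ∈ P ↔ j ∈ P) := fun i j hij =>
    iff_of_eq (hQ.eq_of_mem_iff Prop (· ∈ P) (fun s => propext (hPl s)) i j hij)
  obtain ⟨i, hi⟩ := hP
  obtain ⟨j, hj⟩ := hP'
  rw [Finset.mem_compl] at hj
  by_cases hiQ : i ∈ Q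
  · left
    ext x
    have h1 := hconst i x
    have h2 := hconst j x
    have h3 := hconst i j
    tauto
  · right
    ext x
    rw [Finset.mem_compl]
    have h1 := hconst i x
    have h2 := hconst j x
    have h3 := hconst i j
    tauto

theorem abs_sum_eq_of_eq_or_eq_compl {ι : Type*} [Fintype ι] [DecidableEq ι] {P Q : Finset ι}
    (h : P = Q ∨ P = Qᶜ) (f : ι → ℤ) (hf : ∑ i, f i = 0) :
    |∑ i ∈ Q, f i| = |∑ i ∈ P, f i| := by
  rcases h with rfl | rfl
  · rfl
  · have := Finset.sum_add_sum_compl Q f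
    rw [hf] at this
    rw [eq_neg_of_add_eq_zero_left this, abs_neg]

/-- If the position `o` lies on no edge, then it is a component by itself. -/
theorem IsComponent.singleton {l r : Fin N → Fin (N + 2)} {Q : Finset (Fin (N + 2))}
    (hQ : IsComponent l r Q) {o : Fin (N + 2)} (ho : ∀ s, l s ≠ o ∧ r s ≠ o) :
    {o} = Q ∨ {o} = Qᶜ :=
  hQ.eq_or_eq_compl ⟨o, Finset.mem_singleton_self o⟩
    ⟨o + 1, by simp⟩ fun s => by simp [(ho s).1, (ho s).2]

theorem IsStepChain.succ_le_left {l r : Fin N → Fin (N + 2)} (h : IsStepChain l r) {s : Fin N}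
    (hs : (s : ℕ) + 2 ≤ r s) (n : ℕ) (hn : n < N) (hsn : (s : ℕ) < n) :
    n + 1 ≤ (l ⟨n, hn⟩ : ℕ) := by
  induction n with
  | zero => omega
  | succ n ih =>
    have a2 : (l ⟨n, by omega⟩ : ℕ) < r ⟨n, by omega⟩ := h.1 _
    have a3 : (r ⟨n, by omega⟩ : ℕ) ≤ l ⟨n + 1, hn⟩ := h.2 _ _ (Nat.lt_succ_self n)
    rcases Nat.lt_or_ge (s : ℕ) n with h5 | h5
    · have := ih (by omega) h5
      omega
    · have h6 : n = s := by omega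
      subst h6
      simp only [Fin.eta] at a2 a3
      omega

/-- The position inside a step of length two is a component by itself, and it lies inside no other
step. -/
theorem IsStepChain.eq_of_between {l r : Fin N → Fin (N + 2)} (h : IsStepChain l r)
    {s : Fin N} {k : Fin (N + 2)} (h1 : l s < k) (h2 : k < r s) :
    (k : ℕ) = l s + 1 ∧ (r s : ℕ) = k + 1 ∧ (∀ s', l s' ≠ k ∧ r s' ≠ k) ∧
      ∀ s' i, l s' < i → i < r s' → s' = s := by
  have hb1 := h.le_left s s.2
  have hb2 := h.right_le s s.2
  simp only [Fin.eta] at hb1 hb2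
  have h1' : (l s : ℕ) < k := h1
  have h2' : (k : ℕ) < r s := h2
  refine ⟨by omega, by omega, fun s' => ?_, fun s' i hi hi' => ?_⟩
  · rcases lt_trichotomy s' s with hs | rfl | hs
    · have := h.2 _ _ hs
      have h3 := h.1 s'
      exact ⟨((h3.trans_le this).trans h1).ne, (this.trans_lt h1).ne⟩
    · exact ⟨h1.ne, h2.ne'⟩
    · have := h.2 _ _ hs
      have h3 := h.1 s'
      exact ⟨(h2.trans_le this).ne', ((h2.trans_le this).trans h3).ne'⟩
  · have hc1 := h.le_left s' s'.2
    have hc2 := h.right_le s' s'.2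
    simp only [Fin.eta] at hc1 hc2
    have hi1 : (l s' : ℕ) < i := hi
    have hi2 : (i : ℕ) < r s' := hi'
    rcases lt_trichotomy s' s with hs | rfl | hs
    · have := h.succ_le_left (s := s') (by omega) s s.2 hs
      simp only [Fin.eta] at this
      omega
    · rfl
    · have := h.succ_le_left (s := s) (by omega) s' s'.2 hs
      simp only [Fin.eta] at this
      omega

/-- The function on the positions whose ratio along every edge is prescribed, for a chain of steps
with the ends `r s`. In the additive version the increments are prescribed. -/
@[to_additive]
def prodPotential {G : Type*} [CommMonoid G] (r : Fin N → Fin (N + 2)) (ρ : Fin N → G)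
    (i : Fin (N + 2)) : G :=
  ∏ s ∈ Finset.univ.filter (fun s => r s ≤ i), ρ s

@[to_additive]
theorem IsStepChain.prodPotential_right {G : Type*} [CommMonoid G] {l r : Fin N → Fin (N + 2)}
    (h : IsStepChain l r) (ρ : Fin N → G) (s : Fin N) :
    prodPotential r ρ (r s) = ρ s * prodPotential r ρ (l s) := by
  classical
  have : Finset.univ.filter (fun s' => r s' ≤ r s) =
      insert s (Finset.univ.filter (fun s' => r s' ≤ l s)) := by
    ext s'
    simp only [Finset.mem_filter, Finset.mem_univ, true_and, Finset.mem_insert,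
      h.strictMono.le_iff_le]
    constructor
    · intro hs
      rcases hs.eq_or_lt with h1 | h1
      · exact Or.inl h1
      · exact Or.inr (h.2 _ _ h1)
    · rintro (rfl | h1)
      · exact le_rfl
      · exact (h.strictMono.le_iff_le).1 (h1.trans (h.1 s).le)
  rw [prodPotential, this, Finset.prod_insert]
  · rfl
  · simp [h.1 s]

theorem sum_mul_sumPotential (r : Fin N → Fin (N + 2)) (f : Fin (N + 2) → ℚ) (d : Fin N → ℚ) :
    ∑ i, f i * sumPotential r d i =
      ∑ s, d s * ∑ i ∈ Finset.univ.filter (fun i => r s ≤ i), f i := by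
  simp only [sumPotential, Finset.sum_filter, Finset.mul_sum]
  rw [Finset.sum_comm]
  refine Finset.sum_congr rfl fun s _ => Finset.sum_congr rfl fun i _ => ?_
  split_ifs <;> ring

/-- A function with vanishing sums over both components is orthogonal to the functions that are
constant on the components. -/
theorem IsComponent.sum_mul_eq_zero {l r : Fin N → Fin (N + 2)} {Q : Finset (Fin (N + 2))}
    (hQ : IsComponent l r Q) {f : Fin (N + 2) → ℚ} (hf : ∑ i, f i = 0) (hfQ : ∑ i ∈ Q, f i = 0)
    (g : Fin (N + 2) → ℚ) (hg : ∀ s, g (l s) = g (r s)) : ∑ i, f i * g i = 0 := by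
  obtain ⟨i, hi⟩ := hQ.nonempty
  obtain ⟨j, hj⟩ := hQ.compl_nonempty
  rw [Finset.mem_compl] at hj
  have hsum := Finset.sum_add_sum_compl Q f
  rw [hf, hfQ, zero_add] at hsum
  rw [← Finset.sum_add_sum_compl Q]
  have h1 : ∑ x ∈ Q, f x * g x = ∑ x ∈ Q, f x * g i := Finset.sum_congr rfl fun x hx => by
    rw [hQ.eq_of_mem_iff ℚ g hg x i (by simp [hx, hi])]
  have h2 : ∑ x ∈ Qᶜ, f x * g x = ∑ x ∈ Qᶜ, f x * g j := Finset.sum_congr rfl fun x hx => by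
    rw [hQ.eq_of_mem_iff ℚ g hg x j (by simp [Finset.mem_compl.1 hx, hj])]
  rw [h1, h2, ← Finset.sum_mul, ← Finset.sum_mul, hfQ, hsum]
  ring

/-- A function with vanishing sums over both components and over all upper sets that start at the
end of a step is zero: it is orthogonal to every function `g`, as `g` differs from a potential by a
function that is constant on both components. -/
theorem IsStepChain.eq_zero_of_upper_sums {l r : Fin N → Fin (N + 2)} (h : IsStepChain l r)
    {Q : Finset (Fin (N + 2))} (hQ : IsComponent l r Q) {f : Fin (N + 2) → ℚ}
    (hf : ∑ i, f i = 0) (hfQ : ∑ i ∈ Q, f i = 0)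
    (hup : ∀ s, ∑ i ∈ Finset.univ.filter (fun i => r s ≤ i), f i = 0) : f = 0 := by
  have key : ∀ g : Fin (N + 2) → ℚ, ∑ i, f i * g i = 0 := by
    intro g
    have h1 := hQ.sum_mul_eq_zero hf hfQ
      (fun i => g i - sumPotential r (fun s => g (r s) - g (l s)) i) (fun s => by
        rw [h.sumPotential_right]
        ring)
    simp only [mul_sub, Finset.sum_sub_distrib, sum_mul_sumPotential, hup, mul_zero,
      Finset.sum_const_zero, sub_zero] at h1
    exact h1
  funext i
  simpa [Pi.single_apply] using key (Pi.single i 1)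

/-! ### Rapidly growing slopes, and the relations of a circuit -/

theorem IsRapidlyGrowing.mono {R R' : ℚ} (hR : 0 < R) (h : R ≤ R') {M : Fin N → ℚ}
    (hM : IsRapidlyGrowing R' M) : IsRapidlyGrowing R M :=
  ⟨fun s => h.trans_lt (hM.1 s), fun s s' hs =>
    (mul_le_mul_of_nonneg_right h ((hR.le.trans h).trans (hM.1 s).le)).trans_lt (hM.2 s s' hs)⟩

/-- For a rapidly growing vector `M` a linear form in `M` vanishes only if all its coefficients
do, as its last nonzero term dominates. -/
theorem exists_growth_bound_single (e : Fin N → ℚ) : ∃ R : ℚ, 0 < R ∧ ∀ M : Fin N → ℚ,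
    IsRapidlyGrowing R M → ∑ s, M s * e s = 0 → e = 0 := by
  classical
  by_cases he : e = 0
  · exact ⟨1, one_pos, fun _ _ _ => he⟩
  obtain ⟨s₁, hs₁⟩ : ∃ s, e s ≠ 0 := by
    by_contra hcon
    push Not at hcon
    exact he (funext hcon)
  set F := Finset.univ.filter fun s => e s ≠ 0 with hF
  have hFne : F.Nonempty := ⟨s₁, by simp [hF, hs₁]⟩
  set t := F.max' hFne with ht
  have het : e t ≠ 0 := by
    have := F.max'_mem hFne
    simpa [hF] using this
  have htop : ∀ s, t < s → e s = 0 := by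
    intro s hs
    by_contra hne
    exact absurd (F.le_max' s (by simp [hF, hne])) (not_le.2 hs)
  have hpos : 0 < |e t| := abs_pos.2 het
  set B := ∑ s, |e s| with hB
  have hB0 : 0 ≤ B := Finset.sum_nonneg fun s _ => abs_nonneg _
  refine ⟨(B + 1) / |e t|, by positivity, fun M hM hsum => ?_⟩
  exfalso
  have hR : 0 < (B + 1) / |e t| := by positivity
  have hMpos : ∀ s, 0 < M s := fun s => hR.trans (hM.1 s)
  rw [← Finset.add_sum_erase _ _ (Finset.mem_univ t)] at hsum
  have h1 : M t * |e t| ≤ ∑ s ∈ Finset.univ.erase t, M s * |e s| := by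
    have h2 : M t * e t = -∑ s ∈ Finset.univ.erase t, M s * e s := by linarith
    calc M t * |e t| = |M t * e t| := by rw [abs_mul, abs_of_pos (hMpos t)]
      _ = |∑ s ∈ Finset.univ.erase t, M s * e s| := by rw [h2, abs_neg]
      _ ≤ ∑ s ∈ Finset.univ.erase t, |M s * e s| := Finset.abs_sum_le_sum_abs _ _
      _ = _ := Finset.sum_congr rfl fun s _ => by rw [abs_mul, abs_of_pos (hMpos s)]
  have h3 : (B + 1) * ∑ s ∈ Finset.univ.erase t, M s * |e s| ≤ M t * |e t| * B := by
    rw [Finset.mul_sum]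
    calc ∑ s ∈ Finset.univ.erase t, (B + 1) * (M s * |e s|)
        ≤ ∑ s ∈ Finset.univ.erase t, M t * |e t| * |e s| := by
          refine Finset.sum_le_sum fun s hs => ?_
          have hne : s ≠ t := Finset.ne_of_mem_erase hs
          rcases lt_or_gt_of_ne hne with h4 | h4
          · have h5 := (hM.2 s t h4).le
            rw [div_mul_eq_mul_div, div_le_iff₀ hpos] at h5
            rw [← mul_assoc]
            gcongr
          · simp [htop s h4]
      _ = M t * |e t| * ∑ s ∈ Finset.univ.erase t, |e s| := by rw [Finset.mul_sum]
      _ ≤ M t * |e t| * B := by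
          have := (hMpos t).le
          gcongr
          exact Finset.sum_le_sum_of_subset_of_nonneg (Finset.erase_subset _ _)
            fun s _ _ => abs_nonneg _
  have h6 : (B + 1) * (M t * |e t|) ≤ M t * |e t| * B :=
    (mul_le_mul_of_nonneg_left h1 (by positivity)).trans h3
  have h7 : 0 < M t * |e t| := mul_pos (hMpos t) hpos
  linarith

theorem exists_growth_bound {F : Set (Fin N → ℚ)} (hF : F.Finite) : ∃ R : ℚ, 0 < R ∧
    ∀ M : Fin N → ℚ, IsRapidlyGrowing R M → ∀ e ∈ F, ∑ s, M s * e s = 0 → e = 0 := by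
  induction F, hF using Set.Finite.induction_on with
  | empty => exact ⟨1, one_pos, fun _ _ e he => absurd he (Set.notMem_empty e)⟩
  | @insert e F _ _ ih =>
    obtain ⟨R, hR, h⟩ := ih
    obtain ⟨R', hR', h'⟩ := exists_growth_bound_single e
    refine ⟨max R R', lt_max_of_lt_left hR, fun M hM e₁ he₁ => ?_⟩
    rcases he₁ with rfl | he₁
    · exact h' M (hM.mono hR' (le_max_right _ _))
    · exact h M (hM.mono hR (le_max_left _ _)) e₁ he₁

/-- `κ` is an affine relation, supported in `C`, between the lattice points `w i`. -/
structure IsRelation {k : Type*} [Field k] (w : Fin (N + 2) → Fin 3 → ℤ) (C : Finset (Fin (N + 2)))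
    (κ : Fin (N + 2) → k) : Prop where
  eq_zero : ∀ i ∉ C, κ i = 0
  sum_eq : ∑ i, κ i = 0
  moment_eq : ∀ j, ∑ i, κ i * (w i j : k) = 0

theorem affineIndependent_iff_isRelation (w : Fin (N + 2) → Fin 3 → ℤ) (D : Finset (Fin (N + 2))) :
    AffineIndependent ℝ (fun i : D => toReal (w i)) ↔
      ∀ κ : Fin (N + 2) → ℝ, IsRelation w D κ → κ = 0 := by
  classical
  rw [affineIndependent_iff]
  constructor
  · intro h κ hκ
    funext i
    by_cases hi : i ∈ D
    · refine h Finset.univ (fun i => κ i) ?_ ?_ ⟨i, hi⟩ (Finset.mem_univ _)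
      · rw [Finset.sum_coe_sort D κ, ← hκ.sum_eq]
        exact Finset.sum_subset (Finset.subset_univ D) fun i _ hi => hκ.eq_zero i hi
      · funext j
        rw [Finset.sum_apply, Pi.zero_apply, ← hκ.moment_eq j]
        simp only [Pi.smul_apply, smul_eq_mul, toReal]
        rw [Finset.sum_coe_sort D fun i => κ i * (w i j : ℝ)]
        exact Finset.sum_subset (Finset.subset_univ D) fun i _ hi => by
          rw [hκ.eq_zero i hi, zero_mul]
    · exact hκ.eq_zero i hi
  · intro h s f hs hs' i hi
    have key : ∀ g : Fin (N + 2) → ℝ,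
        ∑ x, (if hx : x ∈ D then if (⟨x, hx⟩ : D) ∈ s then f ⟨x, hx⟩ else 0 else 0) * g x =
          ∑ x ∈ s, f x * g x := by
      intro g
      rw [← Finset.sum_subset (Finset.subset_univ D) fun x _ hx => by simp [hx],
        ← Finset.sum_coe_sort D, ← Finset.sum_subset (Finset.subset_univ s)]
      · exact Finset.sum_congr rfl fun x hx => by simp [hx]
      · intro x _ hx
        simp [hx]
    have h0 := h (fun x => if hx : x ∈ D then if (⟨x, hx⟩ : D) ∈ s then f ⟨x, hx⟩ else 0 else 0)
      ⟨fun x hx => by simp [hx], ?_, fun j => ?_⟩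
    · have := congrFun h0 i
      simpa [hi] using this
    · have := key fun _ => 1
      simpa [hs] using this
    · rw [key fun x => (w x j : ℝ)]
      have := congrFun hs' j
      simpa [toReal] using this

theorem IsCircuit.eq_zero_of_ssubset {w : Fin (N + 2) → Fin 3 → ℤ} {C : Finset (Fin (N + 2))}
    (hC : IsCircuit w C) {D : Finset (Fin (N + 2))} (hD : D ⊂ C) {κ : Fin (N + 2) → ℝ}
    (hκ : IsRelation w D κ) : κ = 0 :=
  (affineIndependent_iff_isRelation w D).1 (hC.2 D hD) κ hκ

/-- A primitive integral affine relation whose support is exactly `C`. -/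
structure IsPrimitiveRelation (w : Fin (N + 2) → Fin 3 → ℤ) (C : Finset (Fin (N + 2)))
    (lam : Fin (N + 2) → ℤ) : Prop where
  ne_zero_iff : ∀ i, lam i ≠ 0 ↔ i ∈ C
  sum_eq : ∑ i, lam i = 0
  moment_eq : ∀ j, ∑ i, lam i * w i j = 0
  primitive : ∃ n : Fin (N + 2) → ℤ, ∑ i, n i * lam i = 1

theorem IsPrimitiveRelation.isRelation {w : Fin (N + 2) → Fin 3 → ℤ} {C : Finset (Fin (N + 2))}
    {lam : Fin (N + 2) → ℤ} (h : IsPrimitiveRelation w C lam) (k : Type*) [Field k] :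
    IsRelation w C (fun i => (lam i : k)) := by
  refine ⟨fun i hi => ?_, ?_, fun j => ?_⟩
  · have : lam i = 0 := by
      by_contra hne
      exact hi ((h.ne_zero_iff i).1 hne)
    simp [this]
  · exact_mod_cast congrArg (Int.cast (R := k)) h.sum_eq
  · exact_mod_cast congrArg (Int.cast (R := k)) (h.moment_eq j)

theorem IsCircuit.exists_isPrimitiveRelation {w : Fin (N + 2) → Fin 3 → ℤ}
    {C : Finset (Fin (N + 2))} (hC : IsCircuit w C) : ∃ lam, IsPrimitiveRelation w C lam := by
  classical
  -- a rational relation, obtained from a real one by a `ℚ`-linear functional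
  obtain ⟨κ, hκ, hκ0⟩ : ∃ κ : Fin (N + 2) → ℝ, IsRelation w C κ ∧ κ ≠ 0 := by
    have := hC.1
    rw [affineIndependent_iff_isRelation] at this
    push Not at this
    exact this
  obtain ⟨i₀, hi₀⟩ := Function.ne_iff.1 hκ0
  obtain ⟨φ, hφ⟩ : ∃ φ : Module.Dual ℚ ℝ, φ (κ i₀) ≠ 0 := by
    by_contra hcon
    push Not at hcon
    exact hi₀ ((Module.forall_dual_apply_eq_zero_iff ℚ (κ i₀)).1 hcon)
  have hq : IsRelation w C (fun i => φ (κ i)) := by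
    refine ⟨fun i hi => by simp [hκ.eq_zero i hi], ?_, fun j => ?_⟩
    · rw [← map_sum, hκ.sum_eq, map_zero]
    · have := congrArg φ (hκ.moment_eq j)
      rw [map_sum, map_zero] at this
      rw [← this]
      refine Finset.sum_congr rfl fun i _ => ?_
      rw [mul_comm (κ i), show ((w i j : ℤ) : ℝ) * κ i = (w i j : ℚ) • κ i by
        rw [Rat.smul_def]; push_cast; rfl, map_smul, smul_eq_mul, mul_comm]
  -- an integral relation
  set q : Fin (N + 2) → ℚ := fun i => φ (κ i) with hqdef
  set D : ℤ := ∏ i, ((q i).den : ℤ) with hD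
  have hD0 : D ≠ 0 := Finset.prod_ne_zero_iff.2 fun i _ => by exact_mod_cast (q i).den_ne_zero
  have hint : ∀ i, ∃ z : ℤ, (z : ℚ) = q i * D := by
    intro i
    refine ⟨(q i).num * ∏ x ∈ Finset.univ.erase i, ((q x).den : ℤ), ?_⟩
    rw [hD, ← Finset.mul_prod_erase Finset.univ _ (Finset.mem_univ i)]
    push_cast
    rw [← mul_assoc, Rat.mul_den_eq_num]
  choose μ hμ using hint
  have hμ0 : μ i₀ ≠ 0 := by
    intro h
    have h1 := hμ i₀
    rw [h, Int.cast_zero] at h1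
    exact (mul_ne_zero hφ (by exact_mod_cast hD0)) h1.symm
  -- division by the greatest common divisor
  obtain ⟨g, hg⟩ := (IsPrincipalIdealRing.principal (Ideal.span (Set.range μ))).principal
  have hdvd : ∀ i, ∃ z, μ i = z * g := by
    intro i
    have : μ i ∈ Ideal.span (Set.range μ) := Ideal.subset_span ⟨i, rfl⟩
    rw [hg] at this
    obtain ⟨z, hz⟩ := Ideal.mem_span_singleton'.1 this
    exact ⟨z, hz.symm⟩
  choose lam hlam using hdvd
  have hg0 : g ≠ 0 := by
    rintro rfl
    exact hμ0 (by rw [hlam i₀, mul_zero])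
  obtain ⟨n, hn⟩ : ∃ n : Fin (N + 2) → ℤ, ∑ i, n i * μ i = g := by
    have : g ∈ Ideal.span (Set.range μ) := by
      rw [hg]
      exact Ideal.mem_span_singleton_self g
    obtain ⟨n, hn⟩ := (Submodule.mem_span_range_iff_exists_fun ℤ).1 this
    exact ⟨n, by simpa using hn⟩
  have hlamq : ∀ i, (lam i : ℚ) * g = q i * D := fun i => by
    rw [← hμ, hlam]
    push_cast
    rfl
  have hgq : (g : ℚ) ≠ 0 := by exact_mod_cast hg0
  have hlamq' : ∀ i, (lam i : ℚ) = D / g * q i := fun i => by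
    field_simp
    rw [hlamq, mul_comm]
  have hrelq : IsRelation w C (fun i => (lam i : ℚ)) := by
    simp only [hlamq']
    refine ⟨fun i hi => by rw [hq.eq_zero i hi, mul_zero], ?_, fun j => ?_⟩
    · rw [← Finset.mul_sum, hq.sum_eq, mul_zero]
    · simp only [mul_assoc]
      rw [← Finset.mul_sum, hq.moment_eq j, mul_zero]
  have hsum : ∑ i, lam i = 0 := by exact_mod_cast hrelq.sum_eq
  have hmom : ∀ j, ∑ i, lam i * w i j = 0 := fun j => by exact_mod_cast hrelq.moment_eq j
  refine ⟨lam, fun i => ⟨fun hi => ?_, fun hi h0 => ?_⟩, hsum, hmom, n, ?_⟩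
  · by_contra hiC
    exact hi (by exact_mod_cast hrelq.eq_zero i hiC)
  · have hrelR : IsRelation w (C.erase i) (fun i => (lam i : ℝ)) := by
      refine ⟨fun x hx => ?_, by exact_mod_cast hsum, fun j => by exact_mod_cast hmom j⟩
      by_cases hxi : x = i
      · rw [hxi, h0, Int.cast_zero]
      · have : lam x = 0 := by
          have := hrelq.eq_zero x fun hxC => hx (Finset.mem_erase.2 ⟨hxi, hxC⟩)
          exact_mod_cast this
        rw [this, Int.cast_zero]
    have := congrFun (hC.eq_zero_of_ssubset (Finset.erase_ssubset hi) hrelR) i₀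
    have h1 : lam i₀ = 0 := by simpa using this
    exact hμ0 (by rw [hlam, h1, zero_mul])
  · have h1 : (∑ i, n i * lam i) * g = 1 * g := by
      rw [Finset.sum_mul, one_mul]
      refine Eq.trans (Finset.sum_congr rfl fun i _ => ?_) hn
      rw [hlam i, mul_assoc]
    exact mul_right_cancel₀ hg0 h1

/-- The affine relations supported in a circuit form a line. -/
theorem IsCircuit.mul_eq_mul {w : Fin (N + 2) → Fin 3 → ℤ} {C : Finset (Fin (N + 2))}
    (hC : IsCircuit w C) {κ κ' : Fin (N + 2) → ℂ} (hκ : IsRelation w C κ) (hκ' : IsRelation w C κ')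
    (i j : Fin (N + 2)) : κ i * κ' j = κ j * κ' i := by
  classical
  by_cases hj : j ∈ C
  · have hrel : IsRelation w (C.erase j) (fun i => κ i * κ' j - κ j * κ' i) := by
      refine ⟨fun x hx => ?_, ?_, fun l => ?_⟩
      · by_cases hxj : x = j
        · simp [hxj]
        · have hxC : x ∉ C := fun h => hx (Finset.mem_erase.2 ⟨hxj, h⟩)
          simp [hκ.eq_zero x hxC, hκ'.eq_zero x hxC]
      · rw [Finset.sum_sub_distrib, ← Finset.sum_mul, ← Finset.mul_sum, hκ.sum_eq, hκ'.sum_eq]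
        ring
      · have : ∀ x, (κ x * κ' j - κ j * κ' x) * (w x l : ℂ) =
            κ' j * (κ x * w x l) - κ j * (κ' x * w x l) := fun x => by ring
        simp only [this, Finset.sum_sub_distrib, ← Finset.mul_sum, hκ.moment_eq, hκ'.moment_eq]
        ring
    set δ : Fin (N + 2) → ℂ := fun i => κ i * κ' j - κ j * κ' i with hδ
    have hre : IsRelation w (C.erase j) (fun i => (δ i).re) := by
      refine ⟨fun x hx => by rw [hrel.eq_zero x hx, Complex.zero_re], ?_, fun l => ?_⟩
      · rw [← Complex.re_sum, hrel.sum_eq, Complex.zero_re]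
      · have := congrArg Complex.re (hrel.moment_eq l)
        simpa using this
    have him : IsRelation w (C.erase j) (fun i => (δ i).im) := by
      refine ⟨fun x hx => by rw [hrel.eq_zero x hx, Complex.zero_im], ?_, fun l => ?_⟩
      · rw [← Complex.im_sum, hrel.sum_eq, Complex.zero_im]
      · have := congrArg Complex.im (hrel.moment_eq l)
        simpa using this
    have h1 := congrFun (hC.eq_zero_of_ssubset (Finset.erase_ssubset hj) hre) i
    have h2 := congrFun (hC.eq_zero_of_ssubset (Finset.erase_ssubset hj) him) i
    exact sub_eq_zero.1 (Complex.ext h1 h2)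
  · rw [hκ.eq_zero j hj, hκ'.eq_zero j hj]
    ring

/-! ### The discriminantal equation of a circuit -/

/-- At a point of the torus, being singular means that the values of the monomials satisfy the
affine relations of the exponents. -/
theorem isTorusSingularPoint_iff {w : Fin (N + 2) → Fin 3 → ℤ} {C : Finset (Fin (N + 2))}
    {α : Fin (N + 2) → ℂ} {z : Fin 3 → ℂ} :
    IsTorusSingularPoint w C α z ↔ (∀ j, z j ≠ 0) ∧
      IsRelation w C (fun i => if i ∈ C then α i * ∏ j, z j ^ w i j else 0) := by
  rw [IsTorusSingularPoint, and_congr_right_iff]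
  intro hz
  have hshift : ∀ l, z l * laurentPartial w C α l z =
      ∑ i ∈ C, (α i * ∏ j, z j ^ w i j) * (w i l : ℂ) := by
    intro l
    rw [laurentPartial, Finset.mul_sum]
    refine Finset.sum_congr rfl fun i _ => ?_
    have : ∏ j, z j ^ w i j = z l * ∏ j, z j ^ (w i j - if j = l then 1 else 0) := by
      rw [← Finset.mul_prod_erase Finset.univ _ (Finset.mem_univ l),
        ← Finset.mul_prod_erase Finset.univ (fun j => z j ^ (w i j - if j = l then 1 else 0))
          (Finset.mem_univ l), ← mul_assoc]
      congr 1
      · rw [if_pos rfl, zpow_sub_one₀ (hz l)]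
        field_simp [hz l]
      · refine Finset.prod_congr rfl fun j hj => ?_
        rw [if_neg (Finset.ne_of_mem_erase hj), sub_zero]
    rw [this]
    ring
  have hmom : ∀ l, ∑ i, (if i ∈ C then α i * ∏ j, z j ^ w i j else 0) * (w i l : ℂ) =
      z l * laurentPartial w C α l z := by
    intro l
    rw [hshift, ← Finset.sum_subset (Finset.subset_univ C) fun i _ hi => by simp [hi]]
    exact Finset.sum_congr rfl fun i hi => by rw [if_pos hi]
  have hsum : ∑ i, (if i ∈ C then α i * ∏ j, z j ^ w i j else 0) = laurentEval w C α z := by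
    rw [laurentEval, Finset.sum_ite_mem, Finset.univ_inter]
  constructor
  · rintro ⟨h1, h2⟩
    exact ⟨fun i hi => if_neg hi, by rw [hsum, h1], fun l => by rw [hmom, h2, mul_zero]⟩
  · rintro ⟨_, h1, h2⟩
    refine ⟨by rw [← hsum, h1], fun l => ?_⟩
    have := h2 l
    rw [hmom] at this
    exact (mul_eq_zero.1 this).resolve_left (hz l)

theorem IsPrimitiveRelation.sum_mem {w : Fin (N + 2) → Fin 3 → ℤ} {C : Finset (Fin (N + 2))}
    {lam : Fin (N + 2) → ℤ} (h : IsPrimitiveRelation w C lam) : ∑ i ∈ C, lam i = 0 := by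
  rw [← h.sum_eq]
  exact Finset.sum_subset (Finset.subset_univ C) fun i _ hi => by
    by_contra hne
    exact hi ((h.ne_zero_iff i).1 hne)

theorem IsPrimitiveRelation.nonempty {w : Fin (N + 2) → Fin 3 → ℤ} {C : Finset (Fin (N + 2))}
    {lam : Fin (N + 2) → ℤ} (h : IsPrimitiveRelation w C lam) : C.Nonempty := by
  by_contra hC
  obtain ⟨n, hn⟩ := h.primitive
  have : ∀ i, lam i = 0 := fun i => by
    by_contra hne
    exact hC ⟨i, (h.ne_zero_iff i).1 hne⟩
  simp [this] at hn

theorem prod_const_zpow {ι : Type*} (D : Finset ι) {x : ℂ} (hx : x ≠ 0) (f : ι → ℤ) :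
    ∏ i ∈ D, x ^ f i = x ^ ∑ i ∈ D, f i := by
  classical
  induction D using Finset.induction_on with
  | empty => simp
  | insert a D ha ih => rw [Finset.prod_insert ha, Finset.sum_insert ha, zpow_add₀ hx, ih]

/-- Monomials are multiplicatively orthogonal to the affine relations of their exponents. -/
theorem IsPrimitiveRelation.prod_monomial_zpow {w : Fin (N + 2) → Fin 3 → ℤ}
    {C : Finset (Fin (N + 2))} {lam : Fin (N + 2) → ℤ} (h : IsPrimitiveRelation w C lam)
    {z : Fin 3 → ℂ} (hz : ∀ j, z j ≠ 0) : ∏ i ∈ C, (∏ j, z j ^ w i j) ^ lam i = 1 := by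
  have : ∀ i, (∏ j, z j ^ w i j) ^ lam i = ∏ j, z j ^ (lam i * w i j) := fun i => by
    rw [← Finset.prod_zpow]
    exact Finset.prod_congr rfl fun j _ => by rw [← zpow_mul, mul_comm]
  simp only [this]
  rw [Finset.prod_comm]
  refine Finset.prod_eq_one fun j _ => ?_
  have hsum : ∑ i ∈ C, lam i * w i j = 0 := by
    rw [← h.moment_eq j]
    exact Finset.sum_subset (Finset.subset_univ C) fun i _ hi => by
      have : lam i = 0 := by
        by_contra hne
        exact hi ((h.ne_zero_iff i).1 hne)
      rw [this, zero_mul]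
  rw [prod_const_zpow C (hz j), hsum, zpow_zero]

/-- A complex vector that is orthogonal to the relation of a circuit is the restriction of an affine
function to the points of the circuit. -/
theorem IsCircuit.exists_affine {w : Fin (N + 2) → Fin 3 → ℤ} {C : Finset (Fin (N + 2))}
    (hC : IsCircuit w C) {lam : Fin (N + 2) → ℤ} (hlam : IsPrimitiveRelation w C lam)
    (b : Fin (N + 2) → ℂ) (hb : ∑ i ∈ C, (lam i : ℂ) * b i = 0) :
    ∃ (m : ℂ) (ζ : Fin 3 → ℂ), ∀ i ∈ C, m + ∑ j, ζ j * (w i j : ℂ) = b i := by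
  classical
  let T : (ℂ × (Fin 3 → ℂ)) →ₗ[ℂ] (Fin (N + 2) → ℂ) :=
    { toFun := fun x i => if i ∈ C then x.1 + ∑ j, x.2 j * (w i j : ℂ) else 0
      map_add' := fun x y => by
        funext i
        simp only [Prod.fst_add, Prod.snd_add, Pi.add_apply, add_mul, Finset.sum_add_distrib]
        split_ifs
        · ring
        · simp
      map_smul' := fun a x => by
        funext i
        simp only [Prod.smul_fst, Prod.smul_snd, Pi.smul_apply, smul_eq_mul, RingHom.id_apply,
          mul_assoc, mul_ite, mul_zero, mul_add, Finset.mul_sum] }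
  have hT : ∀ x i, T x i = if i ∈ C then x.1 + ∑ j, x.2 j * (w i j : ℂ) else 0 := fun _ _ => rfl
  set b' : Fin (N + 2) → ℂ := fun i => if i ∈ C then b i else 0 with hb'
  by_cases hmem : b' ∈ LinearMap.range T
  · obtain ⟨x, hx⟩ := hmem
    refine ⟨x.1, x.2, fun i hi => ?_⟩
    have := congrFun hx i
    rw [hT, if_pos hi, hb'] at this
    simpa [hi] using this
  exfalso
  obtain ⟨φ, hφ, hφT⟩ := Submodule.exists_dual_map_eq_bot_of_notMem hmem inferInstance
  have hφT' : ∀ x, φ (T x) = 0 := fun x => by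
    have : φ (T x) ∈ (LinearMap.range T).map φ := ⟨T x, ⟨x, rfl⟩, rfl⟩
    rw [hφT] at this
    exact this
  have hφsum : ∀ y, φ y = ∑ i, φ (Pi.single i 1) * y i := by
    intro y
    rw [LinearMap.pi_apply_eq_sum_univ φ y]
    refine Finset.sum_congr rfl fun i _ => ?_
    rw [smul_eq_mul, mul_comm]
    congr 2
    funext j
    simp [Pi.single_apply, eq_comm]
  set κ : Fin (N + 2) → ℂ := fun i => if i ∈ C then φ (Pi.single i 1) else 0 with hκ
  have hφC : ∀ y : Fin (N + 2) → ℂ, φ (fun i => if i ∈ C then y i else 0) = ∑ i, κ i * y i := by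
    intro y
    rw [hφsum]
    refine Finset.sum_congr rfl fun i _ => ?_
    simp only [hκ]
    split_ifs <;> simp
  have hrel : IsRelation w C κ := by
    refine ⟨fun i hi => if_neg hi, ?_, fun j => ?_⟩
    · have := hφT' (1, 0)
      rw [show T (1, 0) = fun i => if i ∈ C then (1 : ℂ) else 0 by
        funext i; rw [hT]; simp, hφC] at this
      simpa using this
    · have := hφT' (0, Pi.single j 1)
      rw [show T (0, Pi.single j 1) = fun i => if i ∈ C then (w i j : ℂ) else 0 by
        funext i; rw [hT]; simp [Pi.single_apply], hφC] at this
      exact this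
  obtain ⟨i₀, hi₀⟩ := hlam.nonempty
  have hne : (lam i₀ : ℂ) ≠ 0 := by exact_mod_cast (hlam.ne_zero_iff i₀).2 hi₀
  refine hφ ?_
  rw [hb', hφC]
  have h1 : (lam i₀ : ℂ) * ∑ i, κ i * b i = κ i₀ * ∑ i ∈ C, (lam i : ℂ) * b i := by
    rw [Finset.mul_sum, Finset.mul_sum, ← Finset.sum_subset (Finset.subset_univ C) fun i _ hi => by
      rw [hrel.eq_zero i hi, zero_mul, mul_zero]]
    refine Finset.sum_congr rfl fun i _ => ?_
    have := hC.mul_eq_mul hrel (hlam.isRelation ℂ) i i₀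
    linear_combination b i * this
  rw [hb, mul_zero] at h1
  exact (mul_eq_zero.1 h1).resolve_left hne

/-- The discriminantal equation of a circuit: a polynomial supported on a circuit with nonzero
coefficients is singular in the torus if and only if the coefficients satisfy one binomial
equation, whose exponents form the primitive affine relation. -/
theorem IsCircuit.exists_singular_iff {w : Fin (N + 2) → Fin 3 → ℤ} {C : Finset (Fin (N + 2))}
    (hC : IsCircuit w C) {lam : Fin (N + 2) → ℤ} (hlam : IsPrimitiveRelation w C lam)
    {α : Fin (N + 2) → ℂ} (hα : ∀ i, α i ≠ 0) :
    (∃ z, IsTorusSingularPoint w C α z) ↔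
      ∏ i ∈ C, α i ^ lam i = ∏ i ∈ C, (lam i : ℂ) ^ lam i := by
  have hlam0 : ∀ i ∈ C, (lam i : ℂ) ≠ 0 := fun i hi => by
    exact_mod_cast (hlam.ne_zero_iff i).2 hi
  constructor
  · rintro ⟨z, hz⟩
    obtain ⟨hz0, hrel⟩ := isTorusSingularPoint_iff.1 hz
    obtain ⟨j, hj⟩ := hlam.nonempty
    set μ : ℂ := α j * (∏ l, z l ^ w j l) / lam j with hμ
    have hmon : ∀ i, ∏ l, z l ^ w i l ≠ 0 := fun i =>
      Finset.prod_ne_zero_iff.2 fun l _ => zpow_ne_zero _ (hz0 l)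
    have hμ0 : μ ≠ 0 := div_ne_zero (mul_ne_zero (hα j) (hmon j)) (hlam0 j hj)
    have hval : ∀ i ∈ C, α i * ∏ l, z l ^ w i l = μ * lam i := by
      intro i hi
      have := hC.mul_eq_mul hrel (hlam.isRelation ℂ) i j
      simp only [if_pos hi, if_pos hj] at this
      rw [hμ, div_mul_eq_mul_div, eq_div_iff (hlam0 j hj)]
      exact this
    have h1 : ∏ i ∈ C, (α i * ∏ l, z l ^ w i l) ^ lam i = ∏ i ∈ C, (μ * lam i) ^ lam i :=
      Finset.prod_congr rfl fun i hi => by rw [hval i hi]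
    simp only [mul_zpow] at h1
    rw [Finset.prod_mul_distrib, Finset.prod_mul_distrib, hlam.prod_monomial_zpow hz0, mul_one,
      prod_const_zpow C hμ0, hlam.sum_mem, zpow_zero, one_mul] at h1
    exact h1
  · intro h
    set b : Fin (N + 2) → ℂ := fun i => Complex.log (lam i / α i) with hb
    have hexp : ∀ i ∈ C, Complex.exp (b i) = lam i / α i := fun i hi =>
      Complex.exp_log (div_ne_zero (hlam0 i hi) (hα i))
    have hprod : Complex.exp (∑ i ∈ C, (lam i : ℂ) * b i) = 1 := by
      rw [Complex.exp_sum]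
      have : ∀ i ∈ C, Complex.exp ((lam i : ℂ) * b i) = (lam i : ℂ) ^ lam i / α i ^ lam i := by
        intro i hi
        rw [Complex.exp_int_mul, hexp i hi, div_zpow]
      rw [Finset.prod_congr rfl this, Finset.prod_div_distrib, ← h, div_self]
      exact Finset.prod_ne_zero_iff.2 fun i _ => zpow_ne_zero _ (hα i)
    obtain ⟨n, hn⟩ := Complex.exp_eq_one_iff.1 hprod
    obtain ⟨e, he⟩ := hlam.primitive
    have heC : ∑ i ∈ C, (lam i : ℂ) * e i = 1 := by
      have h1 : ∑ i ∈ C, e i * lam i = 1 := by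
        rw [← he]
        exact Finset.sum_subset (Finset.subset_univ C) fun i _ hi => by
          have : lam i = 0 := by
            by_contra hne
            exact hi ((hlam.ne_zero_iff i).1 hne)
          rw [this, mul_zero]
      have h2 := congrArg (Int.cast (R := ℂ)) h1
      push_cast at h2
      rw [← h2]
      exact Finset.sum_congr rfl fun i _ => mul_comm _ _
    -- the logarithms are adjusted by multiples of `2πi` so as to become orthogonal to `lam`
    obtain ⟨m, ζ, hmζ⟩ := hC.exists_affine hlam
      (fun i => b i - (e i : ℂ) * (n * (2 * Real.pi * Complex.I))) (by
        have : ∀ i, (lam i : ℂ) * (b i - (e i : ℂ) * (n * (2 * Real.pi * Complex.I))) =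
            lam i * b i - lam i * e i * (n * (2 * Real.pi * Complex.I)) := fun i => by ring
        simp only [this]
        rw [Finset.sum_sub_distrib, ← Finset.sum_mul, heC, hn]
        ring)
    have hz : ∀ i ∈ C, α i * ∏ j, Complex.exp (ζ j) ^ w i j = Complex.exp (-m) * lam i := by
      intro i hi
      have h1 : ∏ j, Complex.exp (ζ j) ^ w i j = Complex.exp (∑ j, ζ j * (w i j : ℂ)) := by
        rw [Complex.exp_sum]
        exact Finset.prod_congr rfl fun j _ => by
          rw [mul_comm, Complex.exp_int_mul]
      have h2 : ∑ j, ζ j * (w i j : ℂ) =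
          -m + b i - ((e i * n : ℤ) : ℂ) * (2 * Real.pi * Complex.I) := by
        push_cast
        linear_combination hmζ i hi
      rw [h1, h2, Complex.exp_sub, Complex.exp_add, Complex.exp_int_mul_two_pi_mul_I, hexp i hi]
      have := hα i
      field_simp
    refine ⟨fun j => Complex.exp (ζ j), isTorusSingularPoint_iff.2
      ⟨fun j => Complex.exp_ne_zero _, ?_⟩⟩
    have : (fun i => if i ∈ C then α i * ∏ j, Complex.exp (ζ j) ^ w i j else 0) =
        fun i => Complex.exp (-m) * (lam i : ℂ) := by
      funext i
      split_ifs with hi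
      · exact hz i hi
      · rw [(hlam.isRelation ℂ).eq_zero i hi, mul_zero]
    rw [this]
    have hrel := hlam.isRelation ℂ
    refine ⟨fun i hi => by rw [hrel.eq_zero i hi, mul_zero], ?_, fun j => ?_⟩
    · rw [← Finset.mul_sum, hrel.sum_eq, mul_zero]
    · simp only [mul_assoc]
      rw [← Finset.mul_sum, hrel.moment_eq j, mul_zero]

/-! ### The restriction of the tropical polynomial to the line through the points -/

open scoped LinearAlgebra.Projectivization

/-- `T s` is the maximum of the tropical polynomial at `M_s v`, where the `i`-th monomial has the
value `c i + M s * h i`, and `l s < r s` are the extreme positions at which the maximum is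
attained. -/
structure IsStepData (h c : Fin (N + 2) → ℚ) (M T : Fin N → ℚ) (l r : Fin N → Fin (N + 2)) :
    Prop where
  le : ∀ s i, c i + M s * h i ≤ T s
  left_eq : ∀ s, c (l s) + M s * h (l s) = T s
  right_eq : ∀ s, c (r s) + M s * h (r s) = T s
  left_le : ∀ s i, c i + M s * h i = T s → l s ≤ i
  le_right : ∀ s i, c i + M s * h i = T s → i ≤ r s
  chain : IsStepChain l r

theorem pairing_tropPoint (v : Fin 3 → ℚ) (M : Fin N → ℚ) (s : Fin N) (ω : Fin 3 → ℤ) :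
    pairing (tropPoint v M s) ω = ((M s * height v ω : ℚ) : ℝ) := by
  rw [pairing, height, Finset.mul_sum]
  push_cast
  exact Finset.sum_congr rfl fun j _ => by rw [tropPoint]; ring

/-- The maximum of the tropical polynomial at `M_s v`, as a rational number. -/
def tropMax (h c : Fin (N + 2) → ℚ) (M : Fin N → ℚ) (s : Fin N) : ℚ :=
  Finset.univ.sup' Finset.univ_nonempty fun i => c i + M s * h i

theorem mem_dualCell_tropPoint (w : Fin (N + 2) → Fin 3 → ℤ) (c : Fin (N + 2) → ℚ)
    (v : Fin 3 → ℚ) (M : Fin N → ℚ) (s : Fin N) (i : Fin (N + 2)) :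
    i ∈ dualCell w c (tropPoint v M s) ↔
      c i + M s * height v (w i) = tropMax (fun i => height v (w i)) c M s := by
  have h1 : ∀ i, (c i : ℝ) + pairing (tropPoint v M s) (w i) =
      ((c i + M s * height v (w i) : ℚ) : ℝ) := fun i => by
    rw [pairing_tropPoint]
    push_cast
    rfl
  have h2 : tropPoly w c (tropPoint v M s) =
      ((tropMax (fun i => height v (w i)) c M s : ℚ) : ℝ) := by
    rw [tropPoly, tropMax]
    simp only [h1]
    refine (Finset.apply_sup'_eq_sup'_comp (γ := ℝ) Finset.univ_nonempty (fun q : ℚ => (q : ℝ))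
      (fun x y => ?_)).symm
    exact Rat.cast_max x y
  rw [dualCell, Set.mem_ofPred_eq, h1, h2, Rat.cast_inj]

theorem exists_isStepData {w : Fin (N + 2) → Fin 3 → ℤ} {c : Fin (N + 2) → ℚ} {v : Fin 3 → ℚ}
    {M : Fin N → ℚ} (hmono : StrictMono fun i => height v (w i)) (hM : StrictMono M)
    (hS : ∀ s, tropPoint v M s ∈ tropSurface w c) :
    ∃ l r, IsStepData (fun i => height v (w i)) c M
      (tropMax (fun i => height v (w i)) c M) l r := by
  classical
  set h : Fin (N + 2) → ℚ := fun i => height v (w i) with hh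
  set T := tropMax h c M with hT
  have hle : ∀ s i, c i + M s * h i ≤ T s := fun s i =>
    Finset.le_sup' (fun i => c i + M s * h i) (Finset.mem_univ i)
  set A : Fin N → Finset (Fin (N + 2)) := fun s =>
    Finset.univ.filter fun i => c i + M s * h i = T s with hA
  have hmem : ∀ s i, i ∈ A s ↔ c i + M s * h i = T s := fun s i => by simp [hA]
  have hnt : ∀ s, ∃ i ∈ A s, ∃ j ∈ A s, i < j := by
    intro s
    obtain ⟨i, hi, j, hj, hij⟩ := hS s
    rw [mem_dualCell_tropPoint] at hi hj
    rcases lt_or_gt_of_ne hij with h1 | h1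
    · exact ⟨i, (hmem s i).2 hi, j, (hmem s j).2 hj, h1⟩
    · exact ⟨j, (hmem s j).2 hj, i, (hmem s i).2 hi, h1⟩
  have hne : ∀ s, (A s).Nonempty := fun s => by
    obtain ⟨i, hi, _⟩ := hnt s
    exact ⟨i, hi⟩
  have hl := fun s => (hmem s _).1 ((A s).min'_mem (hne s))
  have hr := fun s => (hmem s _).1 ((A s).max'_mem (hne s))
  refine ⟨fun s => (A s).min' (hne s), fun s => (A s).max' (hne s), hle, hl, hr,
    fun s i hi => (A s).min'_le i ((hmem s i).2 hi), fun s i hi => (A s).le_max' i ((hmem s i).2 hi),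
    fun s => ?_, fun s s' hs => ?_⟩
  · obtain ⟨i, hi, j, hj, hij⟩ := hnt s
    exact ((A s).min'_le i hi).trans_lt (hij.trans_le ((A s).le_max' j hj))
  · by_contra hcon
    rw [not_le] at hcon
    have h1 := hmono hcon
    have h2 := hM hs
    have h3 := hle s ((A s').min' (hne s'))
    have h4 := hle s' ((A s).max' (hne s))
    rw [← hr s] at h3
    rw [← hl s'] at h4
    have h5 : (M s' - M s) * (h ((A s).max' (hne s)) - h ((A s').min' (hne s'))) ≤ 0 := by
      linarith
    have h6 : 0 < (M s' - M s) * (h ((A s).max' (hne s)) - h ((A s').min' (hne s'))) :=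
      mul_pos (by linarith) (by simp only [hh]; linarith)
    linarith

/-- If the slopes grow rapidly, then a vector from a given finite set that is orthogonal to the
coefficients `c` and to the components of the chain is zero. -/
theorem exists_growth_bound_orthogonal {h : Fin (N + 2) → ℚ} (hmono : StrictMono h)
    {F : Set (Fin (N + 2) → ℚ)} (hF : F.Finite) :
    ∃ R : ℚ, 0 < R ∧ ∀ M : Fin N → ℚ, IsRapidlyGrowing R M → ∀ c T l r, IsStepData h c M T l r →
      ∀ Q, IsComponent l r Q → ∀ f ∈ F, ∑ i, f i = 0 → ∑ i ∈ Q, f i = 0 → ∑ i, f i * c i = 0 →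
        f = 0 := by
  have hfin : (Set.image (fun x : ((Fin N → Fin (N + 2)) × (Fin N → Fin (N + 2))) ×
      (Fin (N + 2) → ℚ) => fun s => (h (x.1.2 s) - h (x.1.1 s)) *
        ∑ i ∈ Finset.univ.filter (fun i => x.1.2 s ≤ i), x.2 i) (Set.univ ×ˢ F)).Finite :=
    (Set.finite_univ.prod hF).image _
  obtain ⟨R, hR, hRM⟩ := exists_growth_bound hfin
  refine ⟨R, hR, fun M hM c T l r hd Q hQ f hf hf0 hfQ hfc => ?_⟩
  refine hd.chain.eq_zero_of_upper_sums hQ hf0 hfQ fun s => ?_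
  set d : Fin N → ℚ := fun s => M s * (h (r s) - h (l s)) with hdd
  have h1 := hQ.sum_mul_eq_zero hf0 hfQ (fun i => c i + sumPotential r d i) (fun s => by
    rw [hd.chain.sumPotential_right]
    have a1 := hd.left_eq s
    have a2 := hd.right_eq s
    simp only [hdd]
    linarith)
  simp only [mul_add, Finset.sum_add_distrib, hfc, zero_add, sum_mul_sumPotential] at h1
  have h2 := hRM M hM (fun s => (h (r s) - h (l s)) *
    ∑ i ∈ Finset.univ.filter (fun i => r s ≤ i), f i) ⟨((l, r), f), ⟨trivial, hf⟩, rfl⟩ (by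
      rw [← h1]
      exact Finset.sum_congr rfl fun s _ => by simp only [hdd]; ring)
  have h3 := congrFun h2 s
  have h4 : h (r s) - h (l s) ≠ 0 := (sub_pos.2 (hmono (hd.chain.1 s))).ne'
  exact (mul_eq_zero.1 h3).resolve_left h4

/-- The vector `f`, with the mass at `k` distributed among `a` and `b` so that the sum and the first
moment with respect to `h` are preserved. -/
def redistribute (h f : Fin (N + 2) → ℚ) (a k b : Fin (N + 2)) : Fin (N + 2) → ℚ :=
  f + f k • (((h b - h k) / (h b - h a)) • Pi.single a 1 + ((h k - h a) / (h b - h a)) •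
    Pi.single b 1 - Pi.single k 1)

theorem sum_redistribute_mul {h : Fin (N + 2) → ℚ} (f : Fin (N + 2) → ℚ)
    (a k b : Fin (N + 2)) (g : Fin (N + 2) → ℚ) :
    ∑ i, redistribute h f a k b i * g i = ∑ i, f i * g i +
      f k * ((h b - h k) / (h b - h a) * g a + (h k - h a) / (h b - h a) * g b - g k) := by
  simp only [redistribute, Pi.add_apply, Pi.smul_apply, Pi.sub_apply, smul_eq_mul, add_mul,
    sub_mul, mul_sub, mul_add, Finset.sum_add_distrib, Finset.sum_sub_distrib]
  simp [Pi.single_apply, mul_assoc]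

/-- The coefficients `c` satisfy the affine relations of the circuit `C`. -/
def IsOrthogonalToRelations (w : Fin (N + 2) → Fin 3 → ℤ) (c : Fin (N + 2) → ℚ)
    (C : Finset (Fin (N + 2))) : Prop :=
  ∀ lam, IsPrimitiveRelation w C lam → ∑ i, (lam i : ℚ) * c i = 0

theorem IsCircuitOf.isOrthogonalToRelations {w : Fin (N + 2) → Fin 3 → ℤ} {c : Fin (N + 2) → ℚ}
    {C : Finset (Fin (N + 2))} (hC : IsCircuitOf w c C) : IsOrthogonalToRelations w c C := by
  intro lam hlam
  obtain ⟨X, hX⟩ := hC.2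
  have h1 : ∀ i ∈ C, (c i : ℝ) = tropPoly w c X - pairing X (w i) := by
    intro i hi
    have : i ∈ dualCell w c X := by
      rw [hX]
      exact hi
    have h2 : (c i : ℝ) + pairing X (w i) = tropPoly w c X := this
    linarith
  have hrel := hlam.isRelation ℝ
  have h2 : ∑ i, (lam i : ℝ) * c i =
      ∑ i, ((lam i : ℝ) * tropPoly w c X - ∑ j, X j * ((lam i : ℝ) * w i j)) := by
    refine Finset.sum_congr rfl fun i _ => ?_
    by_cases hi : i ∈ C
    · rw [h1 i hi, pairing, mul_sub, Finset.mul_sum]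
      congr 1
      exact Finset.sum_congr rfl fun j _ => by ring
    · rw [hrel.eq_zero i hi]
      simp
  rw [Finset.sum_sub_distrib, ← Finset.sum_mul, hrel.sum_eq, Finset.sum_comm] at h2
  simp only [← Finset.mul_sum, hrel.moment_eq, mul_zero, zero_mul, Finset.sum_const_zero,
    sub_zero] at h2
  exact_mod_cast h2

/-- For rapidly growing slopes, no relation of a circuit has sum zero over a component of the chain,
and if the maximum at some `M_s v` is attained at three positions, then these carry all
circuits. -/
theorem exists_growth_bound_circuits {w : Fin (N + 2) → Fin 3 → ℤ} {h : Fin (N + 2) → ℚ}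
    (hmono : StrictMono h) :
    ∃ R : ℚ, 1 ≤ R ∧ ∀ M : Fin N → ℚ, IsRapidlyGrowing R M → ∀ c T l r, IsStepData h c M T l r →
      ∀ Q, IsComponent l r Q → ∀ C, IsCircuit w C → IsOrthogonalToRelations w c C →
        (∀ lam, IsPrimitiveRelation w C lam → ∑ i ∈ Q, lam i ≠ 0) ∧
        ∀ s k, l s < k → k < r s → c k + M s * h k = T s →
          ∀ i ∈ C, i = l s ∨ i = k ∨ i = r s := by
  classical
  choose! L hL using fun C (hC : IsCircuit w C) => hC.exists_isPrimitiveRelation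
  set F : Set (Fin (N + 2) → ℚ) := Set.range (fun C i => (L C i : ℚ)) ∪
    Set.range (fun x : Finset (Fin (N + 2)) × Fin (N + 2) × Fin (N + 2) × Fin (N + 2) =>
      redistribute h (fun i => (L x.1 i : ℚ)) x.2.1 x.2.2.1 x.2.2.2) with hF
  obtain ⟨R, hR, hRM⟩ := exists_growth_bound_orthogonal (F := F) hmono
    ((Set.finite_range _).union (Set.finite_range _))
  refine ⟨max 1 R, le_max_left _ _, fun M hM c T l r hd Q hQ C hC hc => ?_⟩
  have hRM' := hRM M (hM.mono hR (le_max_right _ _)) c T l r hd Q hQ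
  have hLC := hL C hC
  have hLrel := hLC.isRelation ℚ
  refine ⟨fun lam hlam h0 => ?_, fun s k hlk hkr hk => ?_⟩
  · obtain ⟨j, hj⟩ := hlam.nonempty
    have hprop : ∀ i, L C i * lam j = L C j * lam i := fun i => by
      have := hC.mul_eq_mul (hLC.isRelation ℂ) (hlam.isRelation ℂ) i j
      exact_mod_cast this
    have hsum : ∑ i ∈ Q, L C i = 0 := by
      have h1 : (∑ i ∈ Q, L C i) * lam j = 0 := by
        rw [Finset.sum_mul, Finset.sum_congr rfl fun i _ => hprop i, ← Finset.mul_sum, h0, mul_zero]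
      exact (mul_eq_zero.1 h1).resolve_right ((hlam.ne_zero_iff j).2 hj)
    have h2 := hRM' (fun i => (L C i : ℚ)) (Or.inl ⟨C, rfl⟩) hLrel.sum_eq
      (by exact_mod_cast hsum) (hc _ hLC)
    have h3 : L C j = 0 := by simpa using congrFun h2 j
    exact (hLC.ne_zero_iff j).2 hj h3
  · obtain ⟨-, -, hedge, -⟩ := hd.chain.eq_of_between hlk hkr
    set f := redistribute h (fun i => (L C i : ℚ)) (l s) k (r s) with hf
    have hhlt : h (l s) < h (r s) := hmono (hd.chain.1 s)
    have hsub : h (r s) - h (l s) ≠ 0 := by linarith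
    have hfk : f k = 0 := by
      simp [hf, redistribute, (hedge s).1.symm, (hedge s).2.symm]
    have hsum : ∑ i, f i = 0 := by
      have h1 := sum_redistribute_mul (h := h) (fun i => (L C i : ℚ)) (l s) k (r s) fun _ => 1
      simp only [mul_one, hLrel.sum_eq, zero_add] at h1
      rw [hf, h1]
      field_simp
      ring
    have hsumQ : ∑ i ∈ Q, f i = 0 := by
      rcases hQ.singleton hedge with h1 | h1
      · rw [← h1, Finset.sum_singleton, hfk]
      · have h2 := Finset.sum_add_sum_compl Q f
        rw [← h1, Finset.sum_singleton, hfk, hsum, add_zero] at h2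
        exact h2
    have hfc : ∑ i, f i * c i = 0 := by
      rw [hf, sum_redistribute_mul, hc _ hLC]
      have a1 : c (l s) = T s - M s * h (l s) := by linarith [hd.left_eq s]
      have a2 : c (r s) = T s - M s * h (r s) := by linarith [hd.right_eq s]
      have a3 : c k = T s - M s * h k := by linarith
      rw [a1, a2, a3]
      field_simp
      ring
    have hf0 := hRM' f (Or.inr ⟨(C, l s, k, r s), rfl⟩) hsum hsumQ hfc
    intro i hi
    by_contra hcon
    push Not at hcon
    obtain ⟨h1, h2, h3⟩ := hcon
    have h4 := congrFun hf0 i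
    have h5 : L C i = 0 := by
      have : (L C i : ℚ) = 0 := by
        simpa [hf, redistribute, h1, h2, h3] using h4
      exact_mod_cast this
    exact (hLC.ne_zero_iff i).2 hi h5

theorem ncard_pow_eq {n : ℕ} (hn : n ≠ 0) {K : ℂ} (hK : K ≠ 0) :
    {x : ℂ | x ^ n = K}.Finite ∧ {x : ℂ | x ^ n = K}.ncard = n := by
  classical
  have hζ := Complex.isPrimitiveRoot_exp n hn
  have hset : {x : ℂ | x ^ n = K} = ((Polynomial.nthRoots n K).toFinset : Set ℂ) := by
    ext x
    simp [Polynomial.mem_nthRoots (Nat.pos_of_ne_zero hn)]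
  refine ⟨by rw [hset]; exact Finset.finite_toSet _, ?_⟩
  rw [hset, Set.ncard_coe_finset, Multiset.toFinset_card_of_nodup (hζ.nthRoots_nodup hK),
    hζ.card_nthRoots, if_pos]
  exact ⟨_, Complex.cpow_nat_inv_pow K hn⟩

theorem ncard_zpow_eq {n : ℤ} (hn : n ≠ 0) {K : ℂ} (hK : K ≠ 0) :
    {x : ℂ | x ^ n = K}.Finite ∧ ({x : ℂ | x ^ n = K}.ncard : ℤ) = |n| := by
  have hset : {x : ℂ | x ^ n = K} = {x : ℂ | x ^ n.natAbs = if 0 ≤ n then K else K⁻¹} := by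
    ext x
    simp only [Set.mem_ofPred_eq]
    split_ifs with h
    · rw [← zpow_natCast, Int.natAbs_of_nonneg h]
    · rw [← zpow_natCast, Int.ofNat_natAbs_of_nonpos (by omega), zpow_neg, inv_inj]
  have hK' : (if 0 ≤ n then K else K⁻¹) ≠ 0 := by
    split_ifs
    exacts [hK, inv_ne_zero hK]
  obtain ⟨h1, h2⟩ := ncard_pow_eq (Int.natAbs_ne_zero.2 hn) hK'
  rw [hset]
  exact ⟨h1, by rw [h2, Int.natCast_natAbs]⟩

/-! ### Counting enhancements -/

/-- The enhancements are the vectors with nonzero entries that satisfy the linear equations given by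
the lowest order terms at the points `p_s` and the discriminantal equation of the circuit. -/
theorem mem_enhancements_iff {v : Fin 3 → ℚ} {M : Fin N → ℚ}
    {p : Fin N → Fin 3 → HahnSeries ℚ ℂ} (hp : IsLiftOf v M p) {w : Fin (N + 2) → Fin 3 → ℤ}
    {c : Fin (N + 2) → ℚ} {T : Fin N → ℚ} {l r : Fin N → Fin (N + 2)}
    (hd : IsStepData (fun i => height v (w i)) c M T l r) {C : Finset (Fin (N + 2))}
    (hC : IsCircuit w C) {lam : Fin (N + 2) → ℤ} (hlam : IsPrimitiveRelation w C lam)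
    (P : ℙ ℂ (Fin (N + 2) → ℂ)) :
    P ∈ enhancements w c C p ↔ ∃ (α : Fin (N + 2) → ℂ) (hα : α ≠ 0),
      P = Projectivization.mk ℂ α hα ∧ (∀ i, α i ≠ 0) ∧
      (∀ s, ∑ i, (if c i + M s * height v (w i) = T s then
        ∏ j, initialPoint (p s) j ^ w i j else 0) * α i = 0) ∧
      ∏ i ∈ C, α i ^ lam i = ∏ i ∈ C, (lam i : ℂ) ^ lam i := by
  have hiff := exists_polynomial_iff hp w c T hd.le r hd.chain.strictMono hd.right_eq hd.le_right
  constructor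
  · rintro ⟨α, hα, a, hP, h1, h2, h3, h4⟩
    obtain ⟨h5, h6⟩ := (hiff α).1 ⟨a, h1, h2, h3⟩
    exact ⟨α, hα, hP, h5, h6, (hC.exists_singular_iff hlam h5).1 h4⟩
  · rintro ⟨α, hα, hP, h5, h6, h7⟩
    obtain ⟨a, h1, h2, h3⟩ := (hiff α).2 ⟨h5, h6⟩
    exact ⟨α, hα, a, hP, h1, h2, h3, (hC.exists_singular_iff hlam h5).2 h7⟩

theorem prod_mul_zpow_of_sum_eq_zero {ι : Type*} {D : Finset ι} {x : ℂ} (hx : x ≠ 0) {f : ι → ℤ}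
    (hf : ∑ i ∈ D, f i = 0) (α : ι → ℂ) : ∏ i ∈ D, (x * α i) ^ f i = ∏ i ∈ D, α i ^ f i := by
  simp only [mul_zpow, Finset.prod_mul_distrib]
  rw [prod_const_zpow D hx, hf, zpow_zero, one_mul]

/-- If the maximum at every `M_s v` is attained exactly twice, then the solutions of the linear
equations form a pencil, in which the discriminantal equation is binomial; its degree is the sum of
the exponents over a component of the chain. -/
theorem ncard_enhancements_of_pairs {v : Fin 3 → ℚ} {M : Fin N → ℚ}
    {p : Fin N → Fin 3 → HahnSeries ℚ ℂ} (hp : IsLiftOf v M p) {w : Fin (N + 2) → Fin 3 → ℤ}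
    {c : Fin (N + 2) → ℚ} {T : Fin N → ℚ} {l r : Fin N → Fin (N + 2)}
    (hd : IsStepData (fun i => height v (w i)) c M T l r)
    (hpair : ∀ s i, c i + M s * height v (w i) = T s → i = l s ∨ i = r s)
    {Q : Finset (Fin (N + 2))} (hQ : IsComponent l r Q) {C : Finset (Fin (N + 2))}
    (hC : IsCircuit w C) {lam : Fin (N + 2) → ℤ} (hlam : IsPrimitiveRelation w C lam)
    (hsum : ∑ i ∈ Q, lam i ≠ 0) :
    (enhancements w c C p).Finite ∧ ((enhancements w c C p).ncard : ℤ) = |∑ i ∈ Q, lam i| := by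
  classical
  set mon : Fin N → Fin (N + 2) → ℂ := fun s i => ∏ j, initialPoint (p s) j ^ w i j with hmon
  have hmon0 : ∀ s i, mon s i ≠ 0 := fun s i => Finset.prod_ne_zero_iff.2 fun j _ =>
    zpow_ne_zero _ (initialPoint_ne_zero (fun j => (hp s j).2.1) j)
  -- the linear equations prescribe the ratio of the coefficients along every edge of the chain
  set ρ : Fin N → ℂ := fun s => -mon s (l s) / mon s (r s) with hρ
  have hlin : ∀ (α : Fin (N + 2) → ℂ) s, (∑ i, (if c i + M s * height v (w i) = T s then
      mon s i else 0) * α i = 0) ↔ α (r s) = ρ s * α (l s) := by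
    intro α s
    have hne : l s ≠ r s := (hd.chain.1 s).ne
    rw [← Finset.sum_subset (Finset.subset_univ {l s, r s}), Finset.sum_pair hne,
      if_pos (hd.left_eq s), if_pos (hd.right_eq s), hρ]
    · have := hmon0 s (r s)
      constructor
      · intro h
        field_simp
        linear_combination h
      · intro h
        rw [h]
        field_simp
        ring
    · intro i _ hi
      rw [if_neg, zero_mul]
      intro h
      simpa using hi (by simpa using hpair s i h)
  set α₀ := prodPotential r ρ with hα₀
  have hα₀0 : ∀ i, α₀ i ≠ 0 := fun i => Finset.prod_ne_zero_iff.2 fun s _ =>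
    div_ne_zero (neg_ne_zero.2 (hmon0 _ _)) (hmon0 _ _)
  have hα₀r : ∀ s, α₀ (r s) = ρ s * α₀ (l s) := hd.chain.prodPotential_right ρ
  set A : ℂ → Fin (N + 2) → ℂ := fun x i => (if i ∈ Q then x else 1) * α₀ i with hA
  have hA0 : ∀ x, A x ≠ 0 := by
    intro x h
    obtain ⟨j, hj⟩ := hQ.compl_nonempty
    have := congrFun h j
    simp only [hA, if_neg (Finset.mem_compl.1 hj), one_mul] at this
    exact hα₀0 j this
  have hAlin : ∀ x s, A x (r s) = ρ s * A x (l s) := by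
    intro x s
    simp only [hA, hQ.mem_iff s, hα₀r]
    ring
  have hlam0 : ∀ i ∉ C, lam i = 0 := fun i hi => by
    by_contra hne
    exact hi ((hlam.ne_zero_iff i).1 hne)
  have hAprod : ∀ x, x ≠ 0 → ∏ i ∈ C, A x i ^ lam i =
      x ^ (∑ i ∈ Q, lam i) * ∏ i ∈ C, α₀ i ^ lam i := by
    intro x hx
    simp only [hA, mul_zpow, Finset.prod_mul_distrib]
    congr 1
    have h1 : ∀ i ∈ C, (if i ∈ Q then x else 1) ^ lam i = if i ∈ Q then x ^ lam i else 1 := by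
      intro i _
      split_ifs <;> simp
    rw [Finset.prod_congr rfl h1, Finset.prod_ite_mem, prod_const_zpow _ hx]
    congr 1
    exact Finset.sum_subset Finset.inter_subset_right fun i hi hi' =>
      hlam0 i fun hiC => hi' (Finset.mem_inter.2 ⟨hiC, hi⟩)
  have hα₀C : ∏ i ∈ C, α₀ i ^ lam i ≠ 0 :=
    Finset.prod_ne_zero_iff.2 fun i _ => zpow_ne_zero _ (hα₀0 i)
  set K : ℂ := (∏ i ∈ C, (lam i : ℂ) ^ lam i) / ∏ i ∈ C, α₀ i ^ lam i with hK
  have hK0 : K ≠ 0 := div_ne_zero (Finset.prod_ne_zero_iff.2 fun i hi => zpow_ne_zero _ (by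
    exact_mod_cast (hlam.ne_zero_iff i).2 hi)) hα₀C
  obtain ⟨hfin, hcard⟩ := ncard_zpow_eq hsum hK0
  have hx0 : ∀ x, x ^ (∑ i ∈ Q, lam i) = K → x ≠ 0 := by
    rintro x hx rfl
    rw [zero_zpow _ hsum] at hx
    exact hK0 hx.symm
  have himage : enhancements w c C p =
      (fun x => Projectivization.mk ℂ (A x) (hA0 x)) '' {x : ℂ | x ^ (∑ i ∈ Q, lam i) = K} := by
    ext P
    rw [mem_enhancements_iff hp hd hC hlam]
    constructor
    · rintro ⟨α, hα, rfl, hα0, hαlin, hαC⟩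
      have hratio : ∀ s, α (l s) / α₀ (l s) = α (r s) / α₀ (r s) := by
        intro s
        rw [(hlin α s).1 (hαlin s), hα₀r, mul_div_mul_left _ _
          (div_ne_zero (neg_ne_zero.2 (hmon0 _ _)) (hmon0 _ _))]
      obtain ⟨i₁, hi₁⟩ := hQ.nonempty
      obtain ⟨i₀, hi₀⟩ := hQ.compl_nonempty
      rw [Finset.mem_compl] at hi₀
      set σ := α i₀ / α₀ i₀ with hσ
      set τ := α i₁ / α₀ i₁ with hτ
      have hσ0 : σ ≠ 0 := div_ne_zero (hα0 _) (hα₀0 _)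
      have hτ0 : τ ≠ 0 := div_ne_zero (hα0 _) (hα₀0 _)
      have hαA : ∀ i, α i = σ * A (τ / σ) i := by
        intro i
        have hc := hQ.eq_of_mem_iff ℂ (fun i => α i / α₀ i) hratio i
        simp only [hA]
        split_ifs with hi
        · have h1 := hc i₁ (by simp [hi, hi₁])
          rw [← mul_assoc, mul_div_cancel₀ _ hσ0, hτ, ← h1, div_mul_cancel₀ _ (hα₀0 i)]
        · have h1 := hc i₀ (by simp [hi, hi₀])
          rw [one_mul, hσ, ← h1, div_mul_cancel₀ _ (hα₀0 i)]
      refine ⟨τ / σ, ?_, ?_⟩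
      · simp only [hαA] at hαC
        rw [prod_mul_zpow_of_sum_eq_zero hσ0 hlam.sum_mem, hAprod _ (div_ne_zero hτ0 hσ0)] at hαC
        exact (eq_div_iff hα₀C).2 hαC
      · refine ((Projectivization.mk_eq_mk_iff' ℂ _ _ _ _).2 ⟨σ⁻¹, ?_⟩)
        funext i
        rw [Pi.smul_apply, smul_eq_mul, hαA i, inv_mul_cancel_left₀ hσ0]
    · rintro ⟨x, hx, rfl⟩
      have hxne := hx0 x hx
      refine ⟨A x, hA0 x, rfl, fun i => ?_, fun s => (hlin _ s).2 (hAlin x s), ?_⟩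
      · simp only [hA]
        refine mul_ne_zero ?_ (hα₀0 i)
        split_ifs
        exacts [hxne, one_ne_zero]
      · rw [hAprod x hxne, show x ^ (∑ i ∈ Q, lam i) = K from hx, hK, div_mul_cancel₀ _ hα₀C]
  have hinj : Function.Injective fun x => Projectivization.mk ℂ (A x) (hA0 x) := by
    intro x y hxy
    obtain ⟨a, ha⟩ := (Projectivization.mk_eq_mk_iff' ℂ _ _ _ _).1 hxy
    obtain ⟨i₁, hi₁⟩ := hQ.nonempty
    obtain ⟨i₀, hi₀⟩ := hQ.compl_nonempty
    have h0 := congrFun ha i₀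
    have h1 := congrFun ha i₁
    simp only [hA, Pi.smul_apply, smul_eq_mul, if_pos hi₁, if_neg (Finset.mem_compl.1 hi₀),
      one_mul] at h0 h1
    have ha1 : a = 1 := mul_right_cancel₀ (hα₀0 i₀) (by rw [h0, one_mul])
    rw [ha1, one_mul] at h1
    exact (mul_right_cancel₀ (hα₀0 i₁) h1).symm
  rw [himage]
  exact ⟨hfin.image _, by rw [Set.ncard_image_of_injective _ hinj, hcard]⟩

/-- If the maximum at some `M_s v` is attained at three positions that form a circuit with one point
in the middle of the two others, then the enhancement is unique: the restriction of the polynomial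
to the circuit is the square of a binomial that vanishes at the initial point of `p_s`. -/
theorem ncard_enhancements_of_midpoint {v : Fin 3 → ℚ} {M : Fin N → ℚ}
    {p : Fin N → Fin 3 → HahnSeries ℚ ℂ} (hp : IsLiftOf v M p) {w : Fin (N + 2) → Fin 3 → ℤ}
    {c : Fin (N + 2) → ℚ} {T : Fin N → ℚ} {l r : Fin N → Fin (N + 2)}
    (hd : IsStepData (fun i => height v (w i)) c M T l r) {Q : Finset (Fin (N + 2))}
    (hQ : IsComponent l r Q) {s₀ : Fin N} {k : Fin (N + 2)} (hlk : l s₀ < k) (hkr : k < r s₀)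
    (hk : c k + M s₀ * height v (w k) = T s₀) {C : Finset (Fin (N + 2))}
    (hCeq : C = {l s₀, k, r s₀}) (hC : IsCircuit w C)
    (hmid : ∀ j, 2 * w k j = w (l s₀) j + w (r s₀) j) :
    (enhancements w c C p).Finite ∧ (enhancements w c C p).ncard = 1 := by
  classical
  obtain ⟨hkl, hrk, hedge, hother⟩ := hd.chain.eq_of_between hlk hkr
  have hne1 : l s₀ ≠ k := hlk.ne
  have hne2 : k ≠ r s₀ := hkr.ne
  have hne3 : l s₀ ≠ r s₀ := (hlk.trans hkr).ne
  set lam : Fin (N + 2) → ℤ := fun i => if i = k then -2 else if i ∈ C then 1 else 0 with hlamdef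
  have hlk1 : lam k = -2 := by simp [hlamdef]
  have hll : lam (l s₀) = 1 := by simp [hlamdef, hne1, hCeq]
  have hlr : lam (r s₀) = 1 := by simp [hlamdef, hne2.symm, hCeq]
  have hlam0 : ∀ i ∉ C, lam i = 0 := by
    intro i hi
    have : i ≠ k := by
      rintro rfl
      simp [hCeq] at hi
    simp [hlamdef, hi, this]
  have hsumC : ∀ g : Fin (N + 2) → ℤ, (∀ i ∉ C, g i = 0) →
      ∑ i, g i = g (l s₀) + (g k + g (r s₀)) := by
    intro g hg
    rw [← Finset.sum_subset (Finset.subset_univ C) fun i _ hi => hg i hi, hCeq,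
      Finset.sum_insert (by simp [hne1, hne3]), Finset.sum_pair hne2]
  have hprodC : ∀ g : Fin (N + 2) → ℂ, ∏ i ∈ C, g i = g (l s₀) * (g k * g (r s₀)) := by
    intro g
    rw [hCeq, Finset.prod_insert (by simp [hne1, hne3]), Finset.prod_pair hne2]
  have hlam : IsPrimitiveRelation w C lam := by
    refine ⟨fun i => ⟨fun hi => ?_, fun hi => ?_⟩, ?_, fun j => ?_, Pi.single (l s₀) 1, ?_⟩
    · by_contra hiC
      exact hi (hlam0 i hiC)
    · simp only [hlamdef, if_pos hi]
      split_ifs <;> norm_num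
    · rw [hsumC _ hlam0, hlk1, hll, hlr]
      norm_num
    · rw [hsumC _ fun i hi => by rw [hlam0 i hi, zero_mul], hlk1, hll, hlr]
      linarith [hmid j]
    · simp [Pi.single_apply, hll]
  set mon : Fin N → Fin (N + 2) → ℂ := fun s i => ∏ j, initialPoint (p s) j ^ w i j with hmon
  have hmon0 : ∀ s i, mon s i ≠ 0 := fun s i => Finset.prod_ne_zero_iff.2 fun j _ =>
    zpow_ne_zero _ (initialPoint_ne_zero (fun j => (hp s j).2.1) j)
  have hmonmid : mon s₀ (l s₀) * mon s₀ (r s₀) = mon s₀ k ^ 2 := by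
    simp only [hmon]
    rw [← Finset.prod_mul_distrib, ← Finset.prod_pow]
    refine Finset.prod_congr rfl fun j _ => ?_
    have h0 : initialPoint (p s₀) j ≠ 0 := initialPoint_ne_zero (fun j => (hp s₀ j).2.1) j
    rw [← zpow_add₀ h0, ← hmid j, mul_comm, zpow_mul, zpow_ofNat]
  -- the linear equations at the points other than `p s₀` are binomial
  have hlin : ∀ (α : Fin (N + 2) → ℂ) s, s ≠ s₀ → ((∑ i, (if c i + M s * height v (w i) = T s then
      mon s i else 0) * α i = 0) ↔ α (r s) = -mon s (l s) / mon s (r s) * α (l s)) := by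
    intro α s hs
    have hne : l s ≠ r s := (hd.chain.1 s).ne
    rw [← Finset.sum_subset (Finset.subset_univ {l s, r s}), Finset.sum_pair hne,
      if_pos (hd.left_eq s), if_pos (hd.right_eq s)]
    · have := hmon0 s (r s)
      constructor
      · intro h
        field_simp
        linear_combination h
      · intro h
        rw [h]
        field_simp
        ring
    · intro i _ hi
      rw [if_neg, zero_mul]
      intro h
      simp only [Finset.mem_insert, Finset.mem_singleton, not_or] at hi
      exact hs (hother s i ((hd.left_le s i h).lt_of_ne (Ne.symm hi.1))
        ((hd.le_right s i h).lt_of_ne hi.2))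
  have hlin₀ : ∀ α : Fin (N + 2) → ℂ, ∑ i, (if c i + M s₀ * height v (w i) = T s₀ then
      mon s₀ i else 0) * α i = mon s₀ (l s₀) * α (l s₀) +
        (mon s₀ k * α k + mon s₀ (r s₀) * α (r s₀)) := by
    intro α
    rw [← Finset.sum_subset (Finset.subset_univ {l s₀, k, r s₀}),
      Finset.sum_insert (by simp [hne1, hne3]), Finset.sum_pair hne2,
      if_pos (hd.left_eq s₀), if_pos (hd.right_eq s₀), if_pos hk]
    intro i _ hi
    rw [if_neg, zero_mul]
    intro h
    simp only [Finset.mem_insert, Finset.mem_singleton, not_or] at hi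
    have h1 : (l s₀ : ℕ) < i := (hd.left_le s₀ i h).lt_of_ne (Ne.symm hi.1)
    have h2 : (i : ℕ) < r s₀ := (hd.le_right s₀ i h).lt_of_ne hi.2.2
    have h3 : (i : ℕ) ≠ k := fun h => hi.2.1 (Fin.ext h)
    omega
  -- along the long edge the two extreme terms at the initial point are equal
  set ρ : Fin N → ℂ := fun s => (if s = s₀ then 1 else -1) * (mon s (l s) / mon s (r s)) with hρ
  have hρ0 : ∀ s, ρ s ≠ 0 := fun s => by
    simp only [hρ]
    refine mul_ne_zero ?_ (div_ne_zero (hmon0 _ _) (hmon0 _ _))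
    split_ifs <;> norm_num
  have hρs : ∀ s, s ≠ s₀ → ρ s = -mon s (l s) / mon s (r s) := fun s hs => by
    simp only [hρ, if_neg hs]
    ring
  have hρs₀ : ρ s₀ = mon s₀ (l s₀) / mon s₀ (r s₀) := by simp [hρ]
  set α₀ := prodPotential r ρ with hα₀
  have hα₀0 : ∀ i, α₀ i ≠ 0 := fun i => Finset.prod_ne_zero_iff.2 fun s _ => hρ0 s
  have hα₀r : ∀ s, α₀ (r s) = ρ s * α₀ (l s) := hd.chain.prodPotential_right ρ
  set β : Fin (N + 2) → ℂ := fun i =>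
    if i = k then -2 * mon s₀ (l s₀) * α₀ (l s₀) / mon s₀ k else α₀ i with hβ
  have hβk : β k = -2 * mon s₀ (l s₀) * α₀ (l s₀) / mon s₀ k := by simp [hβ]
  have hβne : ∀ i, i ≠ k → β i = α₀ i := fun i hi => by simp [hβ, hi]
  have hβ0 : ∀ i, β i ≠ 0 := by
    intro i
    by_cases hi : i = k
    · rw [hi, hβk]
      exact div_ne_zero (mul_ne_zero (mul_ne_zero (by norm_num) (hmon0 _ _)) (hα₀0 _)) (hmon0 _ _)
    · rw [hβne i hi]
      exact hα₀0 i
  have hβv : β ≠ 0 := fun h => hβ0 k (congrFun h k)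
  have hm1 := hmon0 s₀ (l s₀)
  have hm2 := hmon0 s₀ k
  have hm3 := hmon0 s₀ (r s₀)
  have hK : ∏ i ∈ C, (lam i : ℂ) ^ lam i = 1 / 4 := by
    rw [hprodC, hlk1, hll, hlr]
    norm_num [zpow_neg]
  have hsingle : enhancements w c C p = {Projectivization.mk ℂ β hβv} := by
    ext P
    rw [mem_enhancements_iff hp hd hC hlam, Set.mem_singleton_iff]
    constructor
    · rintro ⟨α, hα, rfl, hα0, hαlin, hαC⟩
      have h1 := hαlin s₀
      rw [hlin₀ α] at h1
      rw [hK, hprodC, hlk1, hll, hlr, zpow_one, zpow_one, zpow_neg, zpow_ofNat] at hαC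
      have hak := hα0 k
      have h2 : 4 * (α (l s₀) * α (r s₀)) = α k ^ 2 := by
        field_simp at hαC
        linear_combination hαC
      have h3 : mon s₀ (l s₀) * α (l s₀) = mon s₀ (r s₀) * α (r s₀) := by
        have h4 : mon s₀ k * α k = -(mon s₀ (l s₀) * α (l s₀) + mon s₀ (r s₀) * α (r s₀)) := by
          linear_combination h1
        have h5 : (mon s₀ (l s₀) * α (l s₀) - mon s₀ (r s₀) * α (r s₀)) ^ 2 = 0 := by
          have h6 : (mon s₀ k * α k) ^ 2 =
              4 * ((mon s₀ (l s₀) * mon s₀ (r s₀)) * (α (l s₀) * α (r s₀))) := by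
            rw [hmonmid]
            linear_combination (-(mon s₀ k ^ 2)) * h2
          rw [h4] at h6
          linear_combination h6
        exact sub_eq_zero.1 (pow_eq_zero_iff (two_ne_zero)|>.1 h5)
      have hαr : ∀ s, α (r s) = ρ s * α (l s) := by
        intro s
        by_cases hs : s = s₀
        · rw [hs, hρs₀]
          field_simp
          linear_combination -h3
        · rw [hρs s hs]
          exact (hlin α s hs).1 (hαlin s)
      have hratio : ∀ s, α (l s) / α₀ (l s) = α (r s) / α₀ (r s) := by
        intro s
        rw [hαr, hα₀r, mul_div_mul_left _ _ (hρ0 s)]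
      have hconst : ∀ i, i ≠ k → α i / α₀ i = α (l s₀) / α₀ (l s₀) := by
        intro i hi
        refine hQ.eq_of_mem_iff ℂ (fun i => α i / α₀ i) hratio i (l s₀) ?_
        have hx : ∀ x : Fin (N + 2), x ≠ k → (x ∈ Q ↔ k ∉ Q) := by
          intro x hx
          rcases hQ.singleton hedge with h | h
          · rw [← h]
            simp [hx]
          · have h' : Q = {k}ᶜ := by rw [h, compl_compl]
            rw [h']
            simp [hx]
        rw [hx i hi, hx _ hne1]
      refine (Projectivization.mk_eq_mk_iff' ℂ _ _ _ _).2 ⟨α (l s₀) / α₀ (l s₀), ?_⟩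
      funext i
      rw [Pi.smul_apply, smul_eq_mul]
      by_cases hi : i = k
      · rw [hi, hβk]
        have := hα₀0 (l s₀)
        field_simp
        linear_combination -h3 - h1
      · rw [hβne i hi, ← hconst i hi, div_mul_cancel₀ _ (hα₀0 i)]
    · rintro rfl
      have hβr : ∀ s, β (r s) = ρ s * β (l s) := fun s => by
        rw [hβne _ (hedge s).2, hβne _ (hedge s).1, hα₀r]
      refine ⟨β, hβv, rfl, hβ0, fun s => ?_, ?_⟩
      · by_cases hs : s = s₀
        · rw [hs, hlin₀ β, hβr, hρs₀, hβk, hβne _ hne1]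
          field_simp
          ring
        · rw [hlin β s hs, hβr, hρs s hs]
      · rw [hK, hprodC, hlk1, hll, hlr, zpow_one, zpow_one, zpow_neg, zpow_ofNat, hβr, hρs₀, hβk,
          hβne _ hne1]
        have := hα₀0 (l s₀)
        field_simp
        linear_combination (-4) * hmonmid
  rw [hsingle]
  exact ⟨Set.finite_singleton _, Set.ncard_singleton _⟩

/-! ### The two possible configurations -/

theorem height_smul_add (v : Fin 3 → ℚ) (lam : Fin (N + 2) → ℤ) (w : Fin (N + 2) → Fin 3 → ℤ)
    (C : Finset (Fin (N + 2))) (h : ∀ j, ∑ i ∈ C, lam i * w i j = 0) :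
    ∑ i ∈ C, (lam i : ℚ) * height v (w i) = 0 := by
  simp only [height, Finset.mul_sum]
  rw [Finset.sum_comm]
  refine Finset.sum_eq_zero fun j _ => ?_
  have h1 : ((∑ i ∈ C, lam i * w i j : ℤ) : ℚ) = 0 := by rw [h j]; rfl
  push_cast at h1
  calc ∑ i ∈ C, (lam i : ℚ) * (v j * w i j) = v j * ∑ i ∈ C, (lam i : ℚ) * w i j := by
        rw [Finset.mul_sum]
        exact Finset.sum_congr rfl fun i _ => by ring
    _ = 0 := by rw [h1, mul_zero]

/-- A circuit on three consecutive lattice points consists of the points of a segment of lattice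
length two: reflecting the point in the middle gives a lattice point between the outer ones. -/
theorem eq_midpoint_of_circuit_subset {Δ : Set (Fin 3 → ℝ)} (hΔ : Convex ℝ Δ) {v : Fin 3 → ℚ}
    {w : Fin (N + 2) → Fin 3 → ℤ} (hw : Set.range w = latticePoints Δ)
    (hmono : StrictMono fun i => height v (w i)) {a k b : Fin (N + 2)} (hak : a < k) (hkb : k < b)
    (hka : (k : ℕ) = a + 1) (hbk : (b : ℕ) = k + 1) {C : Finset (Fin (N + 2))}
    {lam : Fin (N + 2) → ℤ} (hlam : IsPrimitiveRelation w C lam)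
    (hC : ∀ i ∈ C, i = a ∨ i = k ∨ i = b) :
    C = {a, k, b} ∧ ∀ j, 2 * w k j = w a j + w b j := by
  classical
  have hne1 : a ≠ k := hak.ne
  have hne2 : k ≠ b := hkb.ne
  have hne3 : a ≠ b := (hak.trans hkb).ne
  have hsum3 : ∀ g : Fin (N + 2) → ℤ, (∀ i ∉ C, g i = 0) → ∑ i, g i = g a + (g k + g b) := by
    intro g hg
    rw [← Finset.sum_subset (Finset.subset_univ {a, k, b}),
      Finset.sum_insert (by simp [hne1, hne3]), Finset.sum_pair hne2]
    intro i _ hi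
    refine hg i fun hiC => hi ?_
    simpa using hC i hiC
  have hlam0 : ∀ i ∉ C, lam i = 0 := fun i hi => by
    by_contra hne
    exact hi ((hlam.ne_zero_iff i).1 hne)
  have h1 : lam a + (lam k + lam b) = 0 := by rw [← hsum3 lam hlam0, hlam.sum_eq]
  have h2 : ∀ j, lam a * w a j + (lam k * w k j + lam b * w b j) = 0 := fun j => by
    rw [← hsum3 (fun i => lam i * w i j) fun i hi => by rw [hlam0 i hi, zero_mul],
      hlam.moment_eq j]
  have hh1 : height v (w a) < height v (w k) := hmono hak
  have hh2 : height v (w k) < height v (w b) := hmono hkb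
  have h3 : (lam a : ℚ) * height v (w a) + (lam k * height v (w k) + lam b * height v (w b)) = 0 := by
    have := height_smul_add v lam w {a, k, b} fun j => by
      rw [Finset.sum_insert (by simp [hne1, hne3]), Finset.sum_pair hne2, h2 j]
    rwa [Finset.sum_insert (by simp [hne1, hne3]), Finset.sum_pair hne2] at this
  have h1q : (lam a : ℚ) + (lam k + lam b) = 0 := by exact_mod_cast h1
  have h4 : (lam a : ℚ) * (height v (w k) - height v (w a)) =
      lam b * (height v (w b) - height v (w k)) := by
    have : (lam k : ℚ) = -lam a - lam b := by linarith
    rw [this] at h3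
    linarith
  -- all three coefficients are nonzero
  have hall : ¬ (lam a = 0 ∧ lam k = 0 ∧ lam b = 0) := by
    rintro ⟨ha, hk, hb⟩
    obtain ⟨i, hi⟩ := hlam.nonempty
    have := (hlam.ne_zero_iff i).2 hi
    rcases hC i hi with rfl | rfl | rfl <;> contradiction
  have hab : lam a = 0 ↔ lam b = 0 := by
    constructor
    · intro h
      rw [h, Int.cast_zero, zero_mul] at h4
      exact_mod_cast (mul_eq_zero.1 h4.symm).resolve_right (by linarith)
    · intro h
      rw [h, Int.cast_zero, zero_mul] at h4
      exact_mod_cast (mul_eq_zero.1 h4).resolve_right (by linarith)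
  have ha0 : lam a ≠ 0 := by
    intro h
    have hb := hab.1 h
    exact hall ⟨h, by omega, hb⟩
  have hb0 : lam b ≠ 0 := fun h => ha0 (hab.2 h)
  -- `lam a` and `lam b` have the same sign
  have hpos : 0 < (lam a : ℚ) * lam b := by
    have hx : 0 < height v (w k) - height v (w a) := by linarith
    have hy : 0 < height v (w b) - height v (w k) := by linarith
    have ha0q : (lam a : ℚ) ≠ 0 := by exact_mod_cast ha0
    have h5 : (lam a : ℚ) * lam b * (height v (w b) - height v (w k)) =
        lam a ^ 2 * (height v (w k) - height v (w a)) := by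
      rw [mul_assoc, ← h4]
      ring
    have h6 : 0 < (lam a : ℚ) ^ 2 * (height v (w k) - height v (w a)) := by positivity
    rw [← h5] at h6
    exact pos_of_mul_pos_left h6 hy.le
  have hk0 : lam k ≠ 0 := by
    intro h
    have : lam b = -lam a := by omega
    rw [this] at hpos
    push_cast at hpos
    have h7 : 0 ≤ (lam a : ℚ) * lam a := mul_self_nonneg _
    linarith
  refine ⟨?_, ?_⟩
  · refine Finset.Subset.antisymm (fun i hi => by simpa using hC i hi) fun i hi => ?_
    simp only [Finset.mem_insert, Finset.mem_singleton] at hi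
    rcases hi with rfl | rfl | rfl
    exacts [(hlam.ne_zero_iff _).1 ha0, (hlam.ne_zero_iff _).1 hk0, (hlam.ne_zero_iff _).1 hb0]
  · have hmem : ∀ i, toReal (w i) ∈ Δ := fun i => by
      have : w i ∈ latticePoints Δ := hw ▸ ⟨i, rfl⟩
      exact this
    have hposR : 0 < (lam a : ℝ) * lam b := by exact_mod_cast hpos
    have hkR : (lam k : ℝ) = -(lam a + lam b) := by
      have : lam k = -(lam a + lam b) := by omega
      exact_mod_cast this
    have hsumne : (lam a + lam b : ℝ) ≠ 0 := by
      intro h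
      rw [h, neg_zero] at hkR
      exact hk0 (by exact_mod_cast hkR)
    have hrefl : w a + w b - w k ∈ latticePoints Δ := by
      have hconv := hΔ (hmem a) (hmem b)
        (a := (lam b : ℝ) / (lam a + lam b)) (b := (lam a : ℝ) / (lam a + lam b)) ?_ ?_ ?_
      · change toReal (w a + w b - w k) ∈ Δ
        convert hconv using 1
        funext j
        have h8 : (lam a : ℝ) * w a j + (lam k * w k j + lam b * w b j) = 0 := by
          exact_mod_cast h2 j
        rw [hkR] at h8
        simp only [toReal, Pi.add_apply, Pi.sub_apply, Pi.smul_apply, smul_eq_mul]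
        push_cast
        field_simp
        linear_combination h8
      · have : (lam b : ℝ) / (lam a + lam b) = (lam a * lam b + lam b ^ 2) / (lam a + lam b) ^ 2 := by
          field_simp
        rw [this]
        positivity
      · have : (lam a : ℝ) / (lam a + lam b) = (lam a * lam b + lam a ^ 2) / (lam a + lam b) ^ 2 := by
          field_simp
          ring
        rw [this]
        positivity
      · field_simp
        ring
    rw [← hw] at hrefl
    obtain ⟨q, hq⟩ := hrefl
    have hhq : height v (w q) = height v (w a) + height v (w b) - height v (w k) := by
      rw [hq]
      simp only [height, Pi.add_apply, Pi.sub_apply, ← Finset.sum_add_distrib,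
        ← Finset.sum_sub_distrib]
      refine Finset.sum_congr rfl fun j _ => ?_
      push_cast
      ring
    have haq : a < q := hmono.lt_iff_lt.1 (show height v (w a) < height v (w q) by linarith)
    have hqb : q < b := hmono.lt_iff_lt.1 (show height v (w q) < height v (w b) by linarith)
    have hqk : q = k := by
      have h9 : (a : ℕ) < q := haq
      have h10 : (q : ℕ) < b := hqb
      exact Fin.ext (by omega)
    intro j
    have h11 := congrFun hq j
    rw [hqk] at h11
    simp only [Pi.add_apply, Pi.sub_apply] at h11
    omega

/-- For rapidly growing `M`, either the circuit consists of the points of a segment of lattice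
length two that is dual to the face through one of the points `M_s v`, or all points `M_s v` lie on
faces dual to segments without further lattice points, and then the number of enhancements is the
absolute value of the sum of the primitive relation over a component of the lattice path. -/
theorem exists_growth_bound_enhancements {Δ : Set (Fin 3 → ℝ)} (hΔ : Convex ℝ Δ) {v : Fin 3 → ℚ}
    {w : Fin (N + 2) → Fin 3 → ℤ} (hw : Set.range w = latticePoints Δ)
    (hmono : StrictMono fun i => height v (w i)) :
    ∃ R : ℚ, 0 < R ∧ ∀ M : Fin N → ℚ, IsRapidlyGrowing R M →
      ∀ p, IsLiftOf v M p → ∀ c, (∀ s, tropPoint v M s ∈ tropSurface w c) →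
      ∀ C, IsCircuitOf w c C → ∃ l r, IsStepData (fun i => height v (w i)) c M
        (tropMax (fun i => height v (w i)) c M) l r ∧
        ((∃ s k, l s < k ∧ k < r s ∧ C = {l s, k, r s} ∧
            dualCell w c (tropPoint v M s) = (C : Set (Fin (N + 2))) ∧
            (enhancements w c C p).Finite ∧ (enhancements w c C p).ncard = 1) ∨
          (∀ s, dualCell w c (tropPoint v M s) = {l s, r s}) ∧
          ∃ Q, IsComponent l r Q ∧ (∃ k, Q = {k} ∨ Q = Finset.univ.filter (k < ·)) ∧
            ∀ lam, IsPrimitiveRelation w C lam → ∑ i ∈ Q, lam i ≠ 0 ∧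
              (enhancements w c C p).Finite ∧
              ((enhancements w c C p).ncard : ℤ) = |∑ i ∈ Q, lam i|) := by
  classical
  obtain ⟨R, hR, hRM⟩ := exists_growth_bound_circuits (w := w) hmono
  refine ⟨R, by linarith, fun M hM p hp c hS C hC => ?_⟩
  have hMmono : StrictMono M := by
    intro s s' hs
    have h1 := hM.2 s s' hs
    have h2 := hM.1 s
    have h3 : M s ≤ R * M s := le_mul_of_one_le_left (by linarith) hR
    linarith
  obtain ⟨l, r, hd⟩ := exists_isStepData hmono hMmono hS
  obtain ⟨Q, hQ, hQk⟩ := hd.chain.exists_isComponent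
  obtain ⟨hsum, htie⟩ := hRM M hM c _ l r hd Q hQ C hC.1 hC.isOrthogonalToRelations
  refine ⟨l, r, hd, ?_⟩
  by_cases hex : ∃ s k, l s < k ∧ k < r s ∧
      c k + M s * height v (w k) = tropMax (fun i => height v (w i)) c M s
  · obtain ⟨s, k, hlk, hkr, hk⟩ := hex
    obtain ⟨lam, hlam⟩ := hC.1.exists_isPrimitiveRelation
    obtain ⟨hka, hrk, -, -⟩ := hd.chain.eq_of_between hlk hkr
    obtain ⟨hCeq, hmid⟩ := eq_midpoint_of_circuit_subset hΔ hw hmono hlk hkr hka hrk hlam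
      (htie s k hlk hkr hk)
    refine Or.inl ⟨s, k, hlk, hkr, hCeq, ?_,
      ncard_enhancements_of_midpoint hp hd hQ hlk hkr hk hCeq hC.1 hmid⟩
    ext i
    rw [mem_dualCell_tropPoint, hCeq]
    simp only [Finset.coe_insert, Finset.coe_singleton, Set.mem_insert_iff, Set.mem_singleton_iff]
    constructor
    · intro hi
      have h1 : (l s : ℕ) ≤ i := hd.left_le s i hi
      have h2 : (i : ℕ) ≤ r s := hd.le_right s i hi
      simp only [Fin.ext_iff]
      omega
    · rintro (rfl | rfl | rfl)
      exacts [hd.left_eq s, hk, hd.right_eq s]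
  · push Not at hex
    have hpair : ∀ s i, c i + M s * height v (w i) =
        tropMax (fun i => height v (w i)) c M s → i = l s ∨ i = r s := by
      intro s i hi
      by_contra hcon
      push Not at hcon
      exact hex s i ((hd.left_le s i hi).lt_of_ne hcon.1.symm)
        ((hd.le_right s i hi).lt_of_ne hcon.2) hi
    refine Or.inr ⟨fun s => ?_, Q, hQ, hQk, fun lam hlam => ⟨hsum lam hlam,
      ncard_enhancements_of_pairs hp hd hpair hQ hC.1 hlam (hsum lam hlam)⟩⟩
    ext i
    rw [mem_dualCell_tropPoint]
    simp only [Set.mem_insert_iff, Set.mem_singleton_iff]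
    constructor
    · exact hpair s i
    · rintro (rfl | rfl)
      exacts [hd.left_eq s, hd.right_eq s]

/-! ### Lattice paths, and models of circuits -/

/-- The linear extension of `height v` to `ℝ³`. -/
def heightReal (v : Fin 3 → ℚ) : (Fin 3 → ℝ) →ₗ[ℝ] ℝ :=
  ∑ j, (v j : ℝ) • LinearMap.proj j

theorem heightReal_toReal (v : Fin 3 → ℚ) (ω : Fin 3 → ℤ) :
    heightReal v (toReal ω) = ((height v ω : ℚ) : ℝ) := by
  simp [heightReal, height, toReal]

theorem toReal_mem_hull (w : Fin (N + 2) → Fin 3 → ℤ) {S : Set (Fin (N + 2))} {i : Fin (N + 2)}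
    (hi : i ∈ S) : toReal (w i) ∈ hull w S :=
  subset_convexHull ℝ _ ⟨w i, ⟨i, hi, rfl⟩, rfl⟩

theorem hull_pair (w : Fin (N + 2) → Fin 3 → ℤ) (i j : Fin (N + 2)) :
    hull w {i, j} = segment ℝ (toReal (w i)) (toReal (w j)) := by
  rw [hull, points, Set.image_pair, Set.image_pair, convexHull_pair]

theorem isLeast_image_hull {v : Fin 3 → ℚ} {w : Fin (N + 2) → Fin 3 → ℤ}
    (hmono : StrictMono fun i => height v (w i)) {S : Set (Fin (N + 2))} {l : Fin (N + 2)}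
    (hl : IsLeast S l) : IsLeast (heightReal v '' hull w S) ((height v (w l) : ℚ) : ℝ) := by
  refine ⟨⟨_, toReal_mem_hull w hl.1, heightReal_toReal v _⟩, ?_⟩
  rintro _ ⟨x, hx, rfl⟩
  refine convexHull_min (t := {x | ((height v (w l) : ℚ) : ℝ) ≤ heightReal v x}) ?_
    (convex_halfSpace_ge (heightReal v).isLinear _) hx
  rintro _ ⟨_, ⟨i, hi, rfl⟩, rfl⟩
  change ((height v (w l) : ℚ) : ℝ) ≤ heightReal v (toReal (w i))
  rw [heightReal_toReal, Rat.cast_le]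
  exact hmono.le_iff_le.2 (hl.2 hi)

theorem isGreatest_image_hull {v : Fin 3 → ℚ} {w : Fin (N + 2) → Fin 3 → ℤ}
    (hmono : StrictMono fun i => height v (w i)) {S : Set (Fin (N + 2))} {r : Fin (N + 2)}
    (hr : IsGreatest S r) :
    IsGreatest (heightReal v '' hull w S) ((height v (w r) : ℚ) : ℝ) := by
  refine ⟨⟨_, toReal_mem_hull w hr.1, heightReal_toReal v _⟩, ?_⟩
  rintro _ ⟨x, hx, rfl⟩
  refine convexHull_min (t := {x | heightReal v x ≤ ((height v (w r) : ℚ) : ℝ)}) ?_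
    (convex_halfSpace_le (heightReal v).isLinear _) hx
  rintro _ ⟨_, ⟨i, hi, rfl⟩, rfl⟩
  change heightReal v (toReal (w i)) ≤ ((height v (w r) : ℚ) : ℝ)
  rw [heightReal_toReal, Rat.cast_le]
  exact hmono.le_iff_le.2 (hr.2 hi)

/-- The convex hull of a set of lattice points determines its lowest and its highest point. -/
theorem eq_and_eq_of_hull_eq {v : Fin 3 → ℚ} {w : Fin (N + 2) → Fin 3 → ℤ}
    (hmono : StrictMono fun i => height v (w i)) {S S' : Set (Fin (N + 2))}
    {l l' r r' : Fin (N + 2)} (hl : IsLeast S l) (hr : IsGreatest S r) (hl' : IsLeast S' l')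
    (hr' : IsGreatest S' r') (h : hull w S = hull w S') : l = l' ∧ r = r' := by
  have h1 := isLeast_image_hull hmono hl
  have h2 := isGreatest_image_hull hmono hr
  rw [h] at h1 h2
  have h3 := h1.unique (isLeast_image_hull hmono hl')
  have h4 := h2.unique (isGreatest_image_hull hmono hr')
  exact ⟨hmono.injective (by exact_mod_cast h3), hmono.injective (by exact_mod_cast h4)⟩

theorem isLeast_pair_of_lt {i j : Fin (N + 2)} (h : i < j) :
    IsLeast ({i, j} : Set (Fin (N + 2))) i := by
  refine ⟨Set.mem_insert _ _, ?_⟩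
  rintro x (rfl | rfl)
  exacts [le_rfl, h.le]

theorem isGreatest_pair_of_lt {i j : Fin (N + 2)} (h : i < j) :
    IsGreatest ({i, j} : Set (Fin (N + 2))) j := by
  refine ⟨Set.mem_insert_of_mem _ rfl, ?_⟩
  rintro x (rfl | rfl)
  exacts [h.le, le_rfl]

/-- The endpoints of an edge of the surface path that belongs to a complete lattice path are
consecutive elements of the support of that path. -/
theorem mem_of_mem_completePath {v : Fin 3 → ℚ} {w : Fin (N + 2) → Fin 3 → ℤ}
    (hmono : StrictMono fun i => height v (w i)) {a b : Fin (N + 2)} (hab : a < b)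
    {A : Set (Fin (N + 2))} (h : hull w {a, b} ∈ completePath w A) : a ∈ A ∧ b ∈ A := by
  obtain ⟨i, hi, j, hj, hij, -, heq⟩ := h
  rw [← hull_pair] at heq
  obtain ⟨rfl, rfl⟩ := eq_and_eq_of_hull_eq hmono (isLeast_pair_of_lt hab)
    (isGreatest_pair_of_lt hab) (isLeast_pair_of_lt hij) (isGreatest_pair_of_lt hij) heq
  exact ⟨hi, hj⟩

theorem edge_mem_surfacePath {w : Fin (N + 2) → Fin 3 → ℤ} {c : Fin (N + 2) → ℚ}
    {x : Fin N → Fin 3 → ℝ} {l r : Fin N → Fin (N + 2)}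
    (hcell : ∀ s, dualCell w c (x s) = {l s, r s}) (s : Fin N) :
    hull w {l s, r s} ∈ surfacePath w c x :=
  ⟨s, by rw [hcell s]⟩

theorem ne_of_surfacePath_eq_gam {v : Fin 3 → ℚ} {w : Fin (N + 2) → Fin 3 → ℤ}
    (hmono : StrictMono fun i => height v (w i)) {c : Fin (N + 2) → ℚ} {x : Fin N → Fin 3 → ℝ}
    {l r : Fin N → Fin (N + 2)} (hlr : ∀ s, l s < r s)
    (hcell : ∀ s, dualCell w c (x s) = {l s, r s}) {k : Fin (N + 2)}
    (h : surfacePath w c x = Gam w k) (s : Fin N) : l s ≠ k ∧ r s ≠ k :=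
  mem_of_mem_completePath hmono (hlr s) (A := {i | i ≠ k}) (by
    have hs := edge_mem_surfacePath hcell s
    rw [h] at hs
    exact hs)

theorem lt_iff_lt_of_surfacePath_eq_gamGap {v : Fin 3 → ℚ} {w : Fin (N + 2) → Fin 3 → ℤ}
    (hmono : StrictMono fun i => height v (w i)) {c : Fin (N + 2) → ℚ} {x : Fin N → Fin 3 → ℝ}
    {l r : Fin N → Fin (N + 2)} (hlr : ∀ s, l s < r s)
    (hcell : ∀ s, dualCell w c (x s) = {l s, r s}) {k : Fin (N + 2)}
    (h : surfacePath w c x = GamGap w k) (s : Fin N) : k < l s ↔ k < r s := by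
  have hs := edge_mem_surfacePath hcell s
  rw [h] at hs
  rcases hs with hs | hs
  · obtain ⟨h1, h2⟩ := mem_of_mem_completePath hmono (hlr s) hs
    exact iff_of_false (not_lt.2 h1) (not_lt.2 h2)
  · obtain ⟨h1, h2⟩ := mem_of_mem_completePath hmono (hlr s) hs
    exact iff_of_true h1 h2

/-- The differences between a constant and the values `c i + M * h i` of the monomials satisfy the
relations of the circuit, as both `c` and the height do. -/
theorem sum_relation_mul_gap {w : Fin (N + 2) → Fin 3 → ℤ} {h c : Fin (N + 2) → ℚ} {v : Fin 3 → ℚ}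
    (hh : h = fun i => height v (w i)) {C : Finset (Fin (N + 2))}
    (hCc : IsOrthogonalToRelations w c C) {lam : Fin (N + 2) → ℤ}
    (hlam : IsPrimitiveRelation w C lam) (M T : ℚ) :
    ∑ i, (lam i : ℚ) * (T - (c i + M * h i)) = 0 := by
  have hmom : ∑ i, (lam i : ℚ) * h i = 0 := by
    rw [hh]
    exact height_smul_add v lam w Finset.univ hlam.moment_eq
  have hsum : ∑ i, (lam i : ℚ) = 0 := by exact_mod_cast hlam.sum_eq
  have : ∀ i, (lam i : ℚ) * (T - (c i + M * h i)) =
      lam i * T - lam i * c i - M * (lam i * h i) := fun i => by ring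
  simp only [this, Finset.sum_sub_distrib, ← Finset.mul_sum, ← Finset.sum_mul, hsum,
    hCc lam hlam, hmom]
  ring

/-- The point of a circuit that lies in the relative interior of the convex hull of the others is
not an endpoint of an edge of the path: a linear function that is maximal there is constant on the
circuit. -/
theorem ne_of_interior {w : Fin (N + 2) → Fin 3 → ℤ} {h c : Fin (N + 2) → ℚ} {v : Fin 3 → ℚ}
    (hh : h = fun i => height v (w i)) {M T : Fin N → ℚ} {l r : Fin N → Fin (N + 2)}
    (hd : IsStepData h c M T l r)
    (hpair : ∀ s i, c i + M s * h i = T s → i = l s ∨ i = r s)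
    {C : Finset (Fin (N + 2))} (hCc : IsOrthogonalToRelations w c C)
    {lam : Fin (N + 2) → ℤ} (hlam : IsPrimitiveRelation w C lam) (hcard : 3 ≤ C.card)
    {o : Fin (N + 2)} (hpos : ∀ i ∈ C, i ≠ o → 0 < lam i) (s : Fin N) : l s ≠ o ∧ r s ≠ o := by
  classical
  have hlam0 : ∀ i ∉ C, lam i = 0 := fun i hi => by
    by_contra hne
    exact hi ((hlam.ne_zero_iff i).1 hne)
  have htotal := sum_relation_mul_gap hh hCc hlam (M s) (T s)
  suffices H : c o + M s * h o ≠ T s by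
    exact ⟨fun h1 => H (h1 ▸ hd.left_eq s), fun h1 => H (h1 ▸ hd.right_eq s)⟩
  intro ho
  have hnonneg : ∀ i ∈ Finset.univ, 0 ≤ (lam i : ℚ) * (T s - (c i + M s * h i)) := by
    intro i _
    by_cases hi : i ∈ C
    · by_cases hio : i = o
      · rw [hio, ho, sub_self, mul_zero]
      · refine mul_nonneg ?_ (sub_nonneg.2 (hd.le s i))
        exact_mod_cast (hpos i hi hio).le
    · rw [hlam0 i hi]
      simp
  have hzero := (Finset.sum_eq_zero_iff_of_nonneg hnonneg).1 htotal
  have hsub : C ⊆ {l s, r s} := by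
    intro i hi
    have h1 : c i + M s * h i = T s := by
      by_cases hio : i = o
      · rw [hio, ho]
      · have h2 := hzero i (Finset.mem_univ i)
        have h3 : (lam i : ℚ) ≠ 0 := by exact_mod_cast (hpos i hi hio).ne'
        linarith [(mul_eq_zero.1 h2).resolve_left h3]
    simpa using hpair s i h1
  have := (Finset.card_le_card hsub).trans Finset.card_le_two
  omega

/-- The positions of the points of a circuit in the order of a model. -/
theorem exists_model_positions {w : Fin (N + 2) → Fin 3 → ℤ} (hw : Function.Injective w)
    {C : Finset (Fin (N + 2))} {m : ℕ} {y : Fin m → Fin 3 → ℤ} (hy : Function.Injective y)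
    {Φ : AffAut} (hΦ : Φ '' points w C = Set.range y) :
    ∃ e : Fin m → Fin (N + 2), Function.Injective e ∧ (∀ k, Φ (w (e k)) = y k) ∧
      C = Finset.univ.image e := by
  have hex : ∀ k, ∃ i ∈ C, Φ (w i) = y k := by
    intro k
    have : y k ∈ Φ '' points w C := hΦ ▸ ⟨k, rfl⟩
    rw [points, Set.image_image] at this
    exact this
  choose e heC he using hex
  refine ⟨e, fun k k' h => hy (by rw [← he, ← he, h]), he, ?_⟩
  ext i
  simp only [Finset.mem_image, Finset.mem_univ, true_and]
  constructor
  · intro hi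
    have : Φ (w i) ∈ Set.range y := hΦ ▸ ⟨w i, ⟨i, hi, rfl⟩, rfl⟩
    obtain ⟨k, hk⟩ := this
    exact ⟨k, hw (Φ.injective (by rw [he, hk]))⟩
  · rintro ⟨k, rfl⟩
    exact heC k

/-- The weights `μ` on a model, transported to the positions `e k` and extended by zero. -/
def pushWeights {m : ℕ} (e : Fin m → Fin (N + 2)) (μ : Fin m → ℤ) (i : Fin (N + 2)) : ℤ :=
  ∑ k, if e k = i then μ k else 0

theorem pushWeights_apply {m : ℕ} {e : Fin m → Fin (N + 2)} (he : Function.Injective e)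
    (μ : Fin m → ℤ) (k : Fin m) : pushWeights e μ (e k) = μ k := by
  simp [pushWeights, he.eq_iff]

theorem pushWeights_of_notMem {m : ℕ} {e : Fin m → Fin (N + 2)} {μ : Fin m → ℤ} {i : Fin (N + 2)}
    (hi : i ∉ Finset.univ.image e) : pushWeights e μ i = 0 :=
  Finset.sum_eq_zero fun k _ => if_neg fun h => hi (by simp [← h])

theorem sum_pushWeights_smul {m : ℕ} (e : Fin m → Fin (N + 2)) (μ : Fin m → ℤ) {X : Type*}
    [AddCommGroup X] (F : Fin (N + 2) → X) :
    ∑ i, pushWeights e μ i • F i = ∑ k, μ k • F (e k) := by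
  simp only [pushWeights, Finset.sum_smul]
  rw [Finset.sum_comm]
  refine Finset.sum_congr rfl fun k _ => ?_
  simp

/-- A primitive relation on a model of the circuit is transported by an affine automorphism. -/
theorem isPrimitiveRelation_pushWeights {w : Fin (N + 2) → Fin 3 → ℤ} {C : Finset (Fin (N + 2))}
    {m : ℕ} {y : Fin m → Fin 3 → ℤ} {Φ : AffAut} {e : Fin m → Fin (N + 2)}
    (he : Function.Injective e) (hey : ∀ k, Φ (w (e k)) = y k) (hC : C = Finset.univ.image e)
    {μ : Fin m → ℤ} (hμ : ∀ k, μ k ≠ 0) (hsum : ∑ k, μ k = 0) (hmom : ∑ k, μ k • y k = 0)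
    (hprim : ∃ n : Fin m → ℤ, ∑ k, n k * μ k = 1) :
    IsPrimitiveRelation w C (pushWeights e μ) := by
  refine ⟨fun i => ⟨fun hi => ?_, fun hi => ?_⟩, ?_, fun j => ?_, ?_⟩
  · by_contra hiC
    exact hi (pushWeights_of_notMem (hC ▸ hiC))
  · rw [hC] at hi
    obtain ⟨k, -, rfl⟩ := Finset.mem_image.1 hi
    rw [pushWeights_apply he]
    exact hμ k
  · have := sum_pushWeights_smul e μ fun _ => (1 : ℤ)
    simpa [hsum] using this
  · have h1 := sum_pushWeights_smul e μ w
    have h2 : ∑ k, μ k • w (e k) = 0 := by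
      have h3 : ∀ k, w (e k) = Φ.symm.linear (y k) + Φ.symm 0 := fun k => by
        rw [← hey, ← AffineEquiv.symm_apply_apply Φ (w (e k)), AffineEquiv.apply_symm_apply]
        simpa using Φ.symm.map_vadd 0 (Φ (w (e k)))
      rw [Finset.sum_congr rfl fun k _ => (congrArg (μ k • ·) (h3 k)).trans (smul_add _ _ _),
        Finset.sum_add_distrib, ← Finset.sum_smul, hsum, zero_smul, add_zero]
      have h4 : ∑ k, μ k • Φ.symm.linear (y k) = Φ.symm.linear (∑ k, μ k • y k) := by
        rw [map_sum]
        exact Finset.sum_congr rfl fun x _ => (map_zsmul _ _ _).symm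
      rw [h4, hmom, map_zero]
    rw [h2] at h1
    have h5 := congrFun h1 j
    simpa using h5
  · obtain ⟨n, hn⟩ := hprim
    have h1 := sum_pushWeights_smul e μ (pushWeights e n)
    simp only [pushWeights_apply he, smul_eq_mul] at h1
    refine ⟨pushWeights e n, ?_⟩
    rw [← hn, Finset.sum_congr rfl fun k _ => mul_comm (n k) (μ k), ← h1]
    exact Finset.sum_congr rfl fun i _ => mul_comm _ _

/-! ### Lattice volumes -/

open MeasureTheory
open scoped Nat

/-- The simplex `x ≥ 0`, `∑ xᵢ ≤ a` in `ℝⁿ`. -/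
def cornerSimplex (n : ℕ) (a : ℝ) : Set (Fin n → ℝ) := {x | (∀ i, 0 ≤ x i) ∧ ∑ i, x i ≤ a}

theorem convex_cornerSimplex (n : ℕ) (a : ℝ) : Convex ℝ (cornerSimplex n a) := by
  rintro x ⟨hx, hx'⟩ y ⟨hy, hy'⟩ s t hs ht hst
  refine ⟨fun i => ?_, ?_⟩
  · have h1 := hx i
    have h2 := hy i
    simp only [Pi.add_apply, Pi.smul_apply, smul_eq_mul]
    positivity
  · simp only [Pi.add_apply, Pi.smul_apply, smul_eq_mul, Finset.sum_add_distrib, ← Finset.mul_sum]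
    calc s * ∑ i, x i + t * ∑ i, y i ≤ s * a + t * a := by gcongr
      _ = a := by rw [← add_mul, hst, one_mul]

theorem volume_cornerSimplex (n : ℕ) {a : ℝ} (ha : 0 ≤ a) :
    volume (cornerSimplex n a) = ENNReal.ofReal (a ^ n / n !) := by
  induction n generalizing a with
  | zero =>
    have : cornerSimplex 0 a = Set.univ := by
      ext x
      simp [cornerSimplex, ha]
    rw [this, volume_pi, Measure.pi_empty_univ]
    simp
  | succ n ih =>
    set S : Set (ℝ × (Fin n → ℝ)) := {z | 0 ≤ z.1 ∧ (∀ i, 0 ≤ z.2 i) ∧ z.1 + ∑ i, z.2 i ≤ a}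
      with hS
    have hSclosed : IsClosed S := by
      have h1 : IsClosed {z : ℝ × (Fin n → ℝ) | 0 ≤ z.1} := isClosed_le continuous_const (by fun_prop)
      have h2 : IsClosed {z : ℝ × (Fin n → ℝ) | ∀ i, 0 ≤ z.2 i} := by
        simp only [Set.ofPred_forall]
        exact isClosed_iInter fun i => isClosed_le continuous_const (by fun_prop)
      have h3 : IsClosed {z : ℝ × (Fin n → ℝ) | z.1 + ∑ i, z.2 i ≤ a} :=
        isClosed_le (by fun_prop) continuous_const
      exact h1.inter (h2.inter h3)
    have hpre : cornerSimplex (n + 1) a =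
        MeasurableEquiv.piFinSuccAbove (fun _ : Fin (n + 1) => ℝ) 0 ⁻¹' S := by
      ext x
      simp only [cornerSimplex, hS, Set.mem_preimage, Set.mem_ofPred_eq,
        MeasurableEquiv.piFinSuccAbove_apply, Fin.forall_fin_succ, Fin.sum_univ_succ]
      simp [Fin.insertNthEquiv, Fin.tail, and_assoc]
    rw [hpre, (volume_preserving_piFinSuccAbove (fun _ : Fin (n + 1) => ℝ) 0).measure_preimage
      hSclosed.measurableSet.nullMeasurableSet, Measure.volume_eq_prod,
      Measure.prod_apply hSclosed.measurableSet]
    have hslice : ∀ t, volume (Prod.mk t ⁻¹' S) =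
        (Set.Icc 0 a).indicator (fun t => ENNReal.ofReal ((a - t) ^ n / n !)) t := by
      intro t
      by_cases ht : t ∈ Set.Icc 0 a
      · rw [Set.indicator_of_mem ht, ← ih (sub_nonneg.2 ht.2)]
        congr 1
        ext y
        simp only [hS, cornerSimplex, Set.mem_preimage, Set.mem_ofPred_eq, ht.1, true_and,
          le_sub_iff_add_le']
      · rw [Set.indicator_of_notMem ht]
        have : Prod.mk t ⁻¹' S = ∅ := by
          ext y
          simp only [hS, Set.mem_preimage, Set.mem_ofPred_eq, Set.mem_empty_iff_false, iff_false]
          rintro ⟨h1, h2, h3⟩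
          have : 0 ≤ ∑ i, y i := Finset.sum_nonneg fun i _ => h2 i
          exact ht ⟨h1, by linarith⟩
        rw [this, measure_empty]
    simp only [hslice]
    rw [lintegral_indicator measurableSet_Icc, ← ofReal_integral_eq_lintegral_ofReal]
    · congr 1
      rw [integral_Icc_eq_integral_Ioc, ← intervalIntegral.integral_of_le ha,
        intervalIntegral.integral_div, intervalIntegral.integral_comp_sub_left (fun x => x ^ n)]
      simp only [sub_self, sub_zero, integral_pow]
      rw [Nat.factorial_succ]
      push_cast
      field_simp
      ring
    · exact (Continuous.integrableOn_Icc (by fun_prop))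
    · refine (ae_restrict_iff' measurableSet_Icc).2 (Filter.Eventually.of_forall fun t ht => ?_)
      have := sub_nonneg.2 ht.2
      simp only [Pi.zero_apply]
      positivity

/-- The convex hull of a set of points that contains the vertices of a simplex and is contained in
it. -/
theorem convexHull_eq_image_cornerSimplex {n : ℕ} {E : Type*} [AddCommGroup E] [Module ℝ E]
    (p : E) (b : Fin n → E) {P : Set E} (h0 : p ∈ P) (hb : ∀ i, p + b i ∈ P)
    (hP : P ⊆ (fun x : Fin n → ℝ => p + ∑ i, x i • b i) '' cornerSimplex n 1) :
    convexHull ℝ P = (fun x : Fin n → ℝ => p + ∑ i, x i • b i) '' cornerSimplex n 1 := by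
  refine Set.Subset.antisymm (convexHull_min hP ?_) ?_
  · rintro _ ⟨x, hx, rfl⟩ _ ⟨y, hy, rfl⟩ s t hs ht hst
    refine ⟨s • x + t • y, convex_cornerSimplex n 1 hx hy hs ht hst, ?_⟩
    simp only [Pi.add_apply, Pi.smul_apply, smul_eq_mul, add_smul, mul_smul,
      Finset.sum_add_distrib, ← Finset.smul_sum, smul_add]
    have : p = s • p + t • p := by rw [← add_smul, hst, one_smul]
    nth_rewrite 1 [this]
    abel
  · rintro _ ⟨x, ⟨hx0, hx1⟩, rfl⟩
    have h := (convex_convexHull ℝ P).sum_mem (t := (Finset.univ : Finset (Option (Fin n))))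
      (w := fun o => o.elim (1 - ∑ i, x i) x) (z := fun o => o.elim p fun i => p + b i) ?_ ?_ ?_
    · rw [Fintype.sum_option] at h
      simp only [Option.elim, smul_add, Finset.sum_add_distrib, ← Finset.sum_smul] at h
      rw [← add_assoc, ← add_smul, sub_add_cancel, one_smul] at h
      exact h
    · rintro (_ | i) _
      · exact sub_nonneg.2 hx1
      · exact hx0 i
    · rw [Fintype.sum_option]
      simp
    · rintro (_ | i) _
      · exact subset_convexHull ℝ P h0
      · exact subset_convexHull ℝ P (hb i)

/-- The volume of the simplex in `ℝⁿ` with the vertices `p` and `p + bᵢ`. -/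
theorem volume_image_cornerSimplex {n : ℕ} (p : Fin n → ℝ) (b : Fin n → Fin n → ℝ) :
    volume ((fun x : Fin n → ℝ => p + ∑ i, x i • b i) '' cornerSimplex n 1) =
      ENNReal.ofReal (|(Matrix.of b).det| / n !) := by
  have h1 : (fun x : Fin n → ℝ => p + ∑ i, x i • b i) '' cornerSimplex n 1 =
      (fun y => p + y) '' (Matrix.toLin' (Matrix.of b).transpose '' cornerSimplex n 1) := by
    rw [Set.image_image]
    refine Set.image_congr fun x _ => ?_
    congr 1
    funext j
    simp [Matrix.toLin'_apply, Matrix.mulVec, dotProduct, Matrix.transpose_apply, mul_comm]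
  rw [h1, Set.image_add_left, measure_preimage_add, Measure.addHaar_image_linearMap,
    LinearMap.det_toLin', Matrix.det_transpose, volume_cornerSimplex n zero_le_one,
    ← ENNReal.ofReal_mul (abs_nonneg _), one_pow, mul_one_div]

/-! ### Affine automorphisms of the lattice -/

/-- The matrix of the linear part of an affine automorphism of `ℤ³`. -/
def linMatrix (Φ : AffAut) : Matrix (Fin 3) (Fin 3) ℤ :=
  LinearMap.toMatrix' (Φ.linear : (Fin 3 → ℤ) →ₗ[ℤ] (Fin 3 → ℤ))

/-- The extension of an affine automorphism of `ℤ³` to `ℝ³`. -/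
def extend (Φ : AffAut) : (Fin 3 → ℝ) →ᵃ[ℝ] (Fin 3 → ℝ) :=
  (Matrix.toLin' ((linMatrix Φ).map (Int.cast : ℤ → ℝ))).toAffineMap +
    AffineMap.const ℝ (Fin 3 → ℝ) (toReal (Φ 0))

theorem extend_apply (Φ : AffAut) (x : Fin 3 → ℝ) :
    extend Φ x = ((linMatrix Φ).map (Int.cast : ℤ → ℝ)).mulVec x + toReal (Φ 0) := by
  simp [extend]

theorem apply_eq_linear_add (Φ : AffAut) (ω : Fin 3 → ℤ) : Φ ω = Φ.linear ω + Φ 0 := by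
  simpa using Φ.map_vadd 0 ω

theorem linMatrix_mulVec (Φ : AffAut) (ω : Fin 3 → ℤ) : (linMatrix Φ).mulVec ω = Φ.linear ω := by
  rw [linMatrix, ← Matrix.toLin'_apply, Matrix.toLin'_toMatrix']
  rfl

theorem toReal_add (ω ω' : Fin 3 → ℤ) : toReal (ω + ω') = toReal ω + toReal ω' := by
  funext j
  simp [toReal]

theorem map_mulVec_toReal (A : Matrix (Fin 3) (Fin 3) ℤ) (ω : Fin 3 → ℤ) :
    (A.map (Int.cast : ℤ → ℝ)).mulVec (toReal ω) = toReal (A.mulVec ω) := by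
  funext j
  simp [Matrix.mulVec, dotProduct, toReal]

theorem extend_toReal (Φ : AffAut) (ω : Fin 3 → ℤ) : extend Φ (toReal ω) = toReal (Φ ω) := by
  rw [extend_apply, map_mulVec_toReal, linMatrix_mulVec, ← toReal_add, ← apply_eq_linear_add]

theorem linMatrix_mul_symm (Φ : AffAut) : linMatrix Φ * linMatrix Φ.symm = 1 := by
  rw [linMatrix, linMatrix, ← LinearMap.toMatrix'_comp, ← LinearMap.toMatrix'_id]
  congr 1
  ext x : 1
  simp

theorem extend_extend_symm (Φ : AffAut) (x : Fin 3 → ℝ) : extend Φ (extend Φ.symm x) = x := by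
  have h1 : extend Φ (toReal (Φ.symm 0)) = 0 := by
    rw [extend_toReal, AffineEquiv.apply_symm_apply]
    funext j
    simp [toReal]
  rw [extend_apply] at h1
  rw [extend_apply, extend_apply, Matrix.mulVec_add, add_assoc, h1, add_zero, Matrix.mulVec_mulVec]
  have h2 : (linMatrix Φ).map (Int.cast : ℤ → ℝ) * (linMatrix Φ.symm).map (Int.cast : ℤ → ℝ) =
      1 := by
    have := congrArg (fun A : Matrix (Fin 3) (Fin 3) ℤ => A.map (Int.castRingHom ℝ))
      (linMatrix_mul_symm Φ)
    simp only [Matrix.map_mul] at this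
    rw [Matrix.map_one _ (map_zero _) (map_one _)] at this
    exact this
  rw [h2, Matrix.one_mulVec]

theorem extend_symm_extend (Φ : AffAut) (x : Fin 3 → ℝ) : extend Φ.symm (extend Φ x) = x :=
  extend_extend_symm Φ.symm x

theorem extend_injective (Φ : AffAut) : Function.Injective (extend Φ) :=
  Function.LeftInverse.injective (extend_symm_extend Φ)

/-- Affine automorphisms of the lattice preserve volumes. -/
theorem volume_image_extend (Φ : AffAut) (s : Set (Fin 3 → ℝ)) :
    volume (extend Φ '' s) = volume s := by
  have h1 : extend Φ '' s = (fun y => y + toReal (Φ 0)) ''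
      (Matrix.toLin' ((linMatrix Φ).map (Int.cast : ℤ → ℝ)) '' s) := by
    rw [Set.image_image]
    exact Set.image_congr fun x _ => by rw [extend_apply, Matrix.toLin'_apply]
  have h2 : |((linMatrix Φ).map (Int.cast : ℤ → ℝ)).det| = 1 := by
    have h3 : IsUnit (linMatrix Φ).det := by
      refine IsUnit.of_mul_eq_one (linMatrix Φ.symm).det ?_
      rw [← Matrix.det_mul, linMatrix_mul_symm, Matrix.det_one]
    have h4 : ((linMatrix Φ).map (Int.cast : ℤ → ℝ)).det = (((linMatrix Φ).det : ℤ) : ℝ) :=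
      ((Int.castRingHom ℝ).map_det (linMatrix Φ)).symm
    rw [h4]
    rcases Int.isUnit_iff.1 h3 with h5 | h5 <;> rw [h5] <;> simp
  rw [h1, Set.image_add_right, measure_preimage_add_right, Measure.addHaar_image_linearMap,
    LinearMap.det_toLin', h2, ENNReal.ofReal_one, one_mul]

theorem image_toReal_eq {C T : Set (Fin 3 → ℤ)} {Φ : AffAut} (hΦ : Φ '' C = T) :
    toReal '' C = extend Φ.symm '' (toReal '' T) := by
  rw [← hΦ, Set.image_image, Set.image_image]
  refine Set.image_congr fun ω _ => ?_
  rw [extend_toReal, AffineEquiv.symm_apply_apply]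

theorem convexHull_image_toReal_eq {C T : Set (Fin 3 → ℤ)} {Φ : AffAut} (hΦ : Φ '' C = T) :
    convexHull ℝ (toReal '' C) = extend Φ.symm '' convexHull ℝ (toReal '' T) := by
  rw [image_toReal_eq hΦ, AffineMap.image_convexHull]

/-- The lattice volume of a lattice polytope, computed on a model of its set of lattice points that
spans a coordinate subspace. -/
theorem isLatticeVolume_of_model {d : ℕ} (ι : Fin d → Fin 3) (hι : Function.Injective ι)
    {C T : Set (Fin 3 → ℤ)} {Φ : AffAut} (hΦ : Φ '' C = T)
    (hspan : ∀ ω : Fin 3 → ℤ, toReal ω ∈ affineSpan ℝ (toReal '' T) ↔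
      ∃ n : Fin d → ℤ, ω = ∑ i, n i • Pi.single (ι i) 1) :
    IsLatticeVolume (convexHull ℝ (toReal '' C)) ((d ! : ℝ) *
      (volume {u : Fin d → ℝ | ∑ i, u i • Pi.single (ι i) (1 : ℝ) ∈
        convexHull ℝ (toReal '' T)}).toReal) := by
  refine ⟨d, Φ.symm 0, fun i => Φ.symm.linear (Pi.single (ι i) 1), ?_, ?_, ?_⟩
  · have h1 := ((Pi.basisFun ℤ (Fin 3)).linearIndependent.map'
      (Φ.symm.linear : (Fin 3 → ℤ) →ₗ[ℤ] (Fin 3 → ℤ)) (LinearEquiv.ker _)).comp ι hι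
    have h2 : (fun i => Φ.symm.linear (Pi.single (ι i) 1)) =
        ((Φ.symm.linear : (Fin 3 → ℤ) →ₗ[ℤ] (Fin 3 → ℤ)) ∘ Pi.basisFun ℤ (Fin 3)) ∘ ι := by
      funext i
      simp
    rw [h2]
    exact h1
  · ext ω
    simp only [Set.mem_ofPred_eq]
    rw [affineSpan_convexHull, image_toReal_eq hΦ, ← AffineSubspace.map_span,
      AffineSubspace.mem_map]
    have h1 : (∃ y ∈ affineSpan ℝ (toReal '' T), extend Φ.symm y = toReal ω) ↔
        toReal (Φ ω) ∈ affineSpan ℝ (toReal '' T) := by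
      constructor
      · rintro ⟨y, hy, hyω⟩
        rw [← extend_toReal, ← hyω, extend_extend_symm]
        exact hy
      · intro h
        exact ⟨_, h, by rw [← extend_toReal, extend_symm_extend]⟩
    rw [h1, hspan]
    refine exists_congr fun n => ?_
    have h2 : Φ.symm 0 + ∑ i, n i • Φ.symm.linear (Pi.single (ι i) 1) =
        Φ.symm (∑ i, n i • Pi.single (ι i) 1) := by
      refine Eq.trans ?_ (apply_eq_linear_add Φ.symm _).symm
      rw [map_sum, add_comm]
      congr 1
      exact Finset.sum_congr rfl fun i _ => (map_zsmul _ _ _).symm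
    rw [h2]
    constructor
    · intro h
      rw [← h, AffineEquiv.symm_apply_apply]
    · intro h
      rw [h, AffineEquiv.apply_symm_apply]
  · congr 3
    ext u
    simp only [Set.mem_ofPred_eq]
    have h1 : toReal (Φ.symm 0) + ∑ i, u i • toReal (Φ.symm.linear (Pi.single (ι i) 1)) =
        extend Φ.symm (∑ i, u i • Pi.single (ι i) (1 : ℝ)) := by
      rw [extend_apply, add_comm, Matrix.mulVec_sum]
      congr 1
      refine Finset.sum_congr rfl fun i _ => ?_
      rw [Matrix.mulVec_smul, ← linMatrix_mulVec, ← map_mulVec_toReal]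
      congr 2
      funext j
      simp [toReal, Pi.single_apply]
    rw [h1, convexHull_image_toReal_eq hΦ, (extend_injective _).mem_set_image]

/-! ### Circuits in an edge configuration -/

/-- All points `M_s v` lie on faces dual to segments `[w (l s), w (r s)]` without further lattice
points; `Q` is a component of the lattice path formed by these segments, and the enhancements are
counted by the sum over `Q` of the primitive relation of the circuit, which is orthogonal to `c`. -/
structure IsEdgeConfiguration (w : Fin (N + 2) → Fin 3 → ℤ) (v : Fin 3 → ℚ) (M : Fin N → ℚ)
    (c : Fin (N + 2) → ℚ) (p : Fin N → Fin 3 → HahnSeries ℚ ℂ) (C : Finset (Fin (N + 2)))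
    (l r : Fin N → Fin (N + 2)) (Q : Finset (Fin (N + 2))) : Prop where
  stepData : IsStepData (fun i => height v (w i)) c M (tropMax (fun i => height v (w i)) c M) l r
  cell : ∀ s, dualCell w c (tropPoint v M s) = {l s, r s}
  component : IsComponent l r Q
  form : ∃ k, Q = {k} ∨ Q = Finset.univ.filter (k < ·)
  orthogonal : IsOrthogonalToRelations w c C
  sum_ne_zero : ∀ lam, IsPrimitiveRelation w C lam → ∑ i ∈ Q, lam i ≠ 0
  ncard_eq : ∀ lam, IsPrimitiveRelation w C lam →
    ((enhancements w c C p).ncard : ℤ) = |∑ i ∈ Q, lam i|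

section EdgeConfiguration

variable {w : Fin (N + 2) → Fin 3 → ℤ} {v : Fin 3 → ℚ} {M : Fin N → ℚ} {c : Fin (N + 2) → ℚ}
  {p : Fin N → Fin 3 → HahnSeries ℚ ℂ} {C : Finset (Fin (N + 2))} {l r : Fin N → Fin (N + 2)}
  {Q : Finset (Fin (N + 2))} {lam : Fin (N + 2) → ℤ}

theorem IsEdgeConfiguration.pair (h : IsEdgeConfiguration w v M c p C l r Q) (s : Fin N)
    (i : Fin (N + 2))
    (hi : c i + M s * height v (w i) = tropMax (fun i => height v (w i)) c M s) :
    i = l s ∨ i = r s := by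
  have h1 := (mem_dualCell_tropPoint w c v M s i).2 hi
  rw [h.cell s] at h1
  exact h1

theorem IsEdgeConfiguration.ncard_eq_of_ne (h : IsEdgeConfiguration w v M c p C l r Q)
    (hlam : IsPrimitiveRelation w C lam) {o : Fin (N + 2)} (ho : ∀ s, l s ≠ o ∧ r s ≠ o) :
    ((enhancements w c C p).ncard : ℤ) = |lam o| := by
  rw [h.ncard_eq lam hlam,
    abs_sum_eq_of_eq_or_eq_compl (h.component.singleton ho) lam hlam.sum_eq, Finset.sum_singleton]

theorem IsEdgeConfiguration.ncard_eq_of_interior (h : IsEdgeConfiguration w v M c p C l r Q)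
    (hlam : IsPrimitiveRelation w C lam) (hcard : 3 ≤ C.card) {o : Fin (N + 2)}
    (hpos : ∀ i ∈ C, i ≠ o → 0 < lam i) : ((enhancements w c C p).ncard : ℤ) = |lam o| :=
  h.ncard_eq_of_ne hlam (ne_of_interior rfl h.stepData h.pair h.orthogonal hlam hcard hpos)

theorem IsEdgeConfiguration.ncard_eq_of_gam (h : IsEdgeConfiguration w v M c p C l r Q)
    (hmono : StrictMono fun i => height v (w i)) (hlam : IsPrimitiveRelation w C lam)
    {k : Fin (N + 2)} (hk : surfacePath w c (tropPoint v M) = Gam w k) :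
    ((enhancements w c C p).ncard : ℤ) = |lam k| :=
  h.ncard_eq_of_ne hlam (ne_of_surfacePath_eq_gam hmono h.stepData.chain.1 h.cell hk)

theorem IsEdgeConfiguration.ncard_eq_of_gamGap (h : IsEdgeConfiguration w v M c p C l r Q)
    (hmono : StrictMono fun i => height v (w i)) (hlam : IsPrimitiveRelation w C lam)
    {k k₁ : Fin (N + 2)} (hk₁ : k < k₁)
    (hk : surfacePath w c (tropPoint v M) = GamGap w k) :
    ((enhancements w c C p).ncard : ℤ) = |∑ i ∈ Finset.univ.filter (k < ·), lam i| := by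
  rw [h.ncard_eq lam hlam]
  refine abs_sum_eq_of_eq_or_eq_compl (h.component.eq_or_eq_compl ⟨k₁, by simp [hk₁]⟩
    ⟨k, by simp⟩ fun s => ?_) lam hlam.sum_eq
  simpa using lt_iff_lt_of_surfacePath_eq_gamGap hmono h.stepData.chain.1 h.cell hk s

/-- For the vertices of a unit parallelogram the sum of the relation over a component is `±1`: the
sum over an upper set cannot be `±2`, as both diagonals have the same midpoint. -/
theorem IsEdgeConfiguration.ncard_of_parallelogram (h : IsEdgeConfiguration w v M c p C l r Q)
    (hmono : StrictMono fun i => height v (w i)) {e : Fin 4 → Fin (N + 2)}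
    (he : Function.Injective e)
    (hlam : IsPrimitiveRelation w C (pushWeights e ![1, -1, -1, 1])) :
    (enhancements w c C p).ncard = 1 := by
  set lam := pushWeights e ![1, -1, -1, 1] with hlamdef
  have hne := h.sum_ne_zero lam hlam
  have hcount := h.ncard_eq lam hlam
  suffices H : |∑ i ∈ Q, lam i| = 1 by
    rw [H] at hcount
    exact_mod_cast hcount
  obtain ⟨k, hk | hk⟩ := h.form
  · rw [hk, Finset.sum_singleton] at hne ⊢
    have hkC : k ∈ Finset.univ.image e := by
      by_contra hcon
      exact hne (pushWeights_of_notMem hcon)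
    obtain ⟨m, -, rfl⟩ := Finset.mem_image.1 hkC
    rw [hlamdef, pushWeights_apply he]
    fin_cases m <;> simp
  · have hsum : ∑ i ∈ Q, lam i = (if k < e 0 then 1 else 0) - (if k < e 1 then 1 else 0) -
        (if k < e 2 then 1 else 0) + (if k < e 3 then 1 else 0) := by
      have h1 := sum_pushWeights_smul e ![1, -1, -1, 1] fun i => if k < i then (1 : ℤ) else 0
      rw [hk, Finset.sum_filter]
      simp only [smul_eq_mul, mul_ite, mul_one, mul_zero] at h1
      rw [hlamdef, h1]
      simp only [Fin.sum_univ_four, Matrix.cons_val_zero, Matrix.cons_val_one, Matrix.cons_val]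
      split_ifs <;> rfl
    have hheight : height v (w (e 0)) + height v (w (e 3)) =
        height v (w (e 1)) + height v (w (e 2)) := by
      have h1 := height_smul_add v lam w Finset.univ hlam.moment_eq
      have h2 := sum_pushWeights_smul e ![1, -1, -1, 1] fun i => height v (w i)
      simp only [zsmul_eq_mul] at h2
      rw [hlamdef, h2] at h1
      simp [Fin.sum_univ_four] at h1
      linarith
    have hcmp : ∀ i j, i ≤ k → k < j → height v (w i) < height v (w j) := fun i j hi hj =>
      hmono (hi.trans_lt hj)
    rw [hsum] at hne ⊢
    clear hsum
    have h03 : ¬ (k < e 0 ∧ k < e 3 ∧ ¬ k < e 1 ∧ ¬ k < e 2) := by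
      rintro ⟨a, b, c, d⟩
      have h1 := hcmp _ _ (not_lt.1 c) a
      have h2 := hcmp _ _ (not_lt.1 d) b
      linarith
    have h12 : ¬ (k < e 1 ∧ k < e 2 ∧ ¬ k < e 0 ∧ ¬ k < e 3) := by
      rintro ⟨a, b, c, d⟩
      have h1 := hcmp _ _ (not_lt.1 c) a
      have h2 := hcmp _ _ (not_lt.1 d) b
      linarith
    by_cases a0 : k < e 0 <;> by_cases a1 : k < e 1 <;> by_cases a2 : k < e 2 <;>
      by_cases a3 : k < e 3 <;> simp [a0, a1, a2, a3] at hne h03 h12 ⊢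

end EdgeConfiguration

/-! ### The lattice tetrahedra of type B -/

/-- The lattice simplex with the vertices `0, e₁, e₂, u`, possibly with additional points. -/
theorem volume_convexHull_tetrahedron {u : Fin 3 → ℤ} (hu : 0 < u 2) {P : Set (Fin 3 → ℤ)}
    (hP : {![0, 0, 0], ![1, 0, 0], ![0, 1, 0], u} ⊆ P)
    (hP' : ∀ x ∈ P, ∃ (m : ℤ) (a : Fin 4 → ℤ), 0 < m ∧ (∀ k, 0 ≤ a k) ∧ ∑ k, a k = m ∧
      m • x = a 1 • ![1, 0, 0] + a 2 • ![0, 1, 0] + a 3 • u) :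
    convexHull ℝ (toReal '' P) = (fun x : Fin 3 → ℝ => 0 + ∑ i, x i •
      ![toReal ![1, 0, 0], toReal ![0, 1, 0], toReal u] i) '' cornerSimplex 3 1 ∧
    volume (convexHull ℝ (toReal '' P)) = ENNReal.ofReal ((u 2 : ℝ) / 6) := by
  have h0 : toReal ![0, 0, 0] = 0 := by
    funext j
    fin_cases j <;> simp [toReal]
  have heq := convexHull_eq_image_cornerSimplex (P := toReal '' P) 0
    ![toReal ![1, 0, 0], toReal ![0, 1, 0], toReal u]
    ⟨![0, 0, 0], hP (by simp), h0⟩ (fun i => by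
      rw [zero_add]
      fin_cases i
      · exact ⟨_, hP (by simp), rfl⟩
      · exact ⟨_, hP (by simp), rfl⟩
      · exact ⟨_, hP (by simp), rfl⟩) (by
      rintro _ ⟨x, hx, rfl⟩
      obtain ⟨m, a, hm, ha, hsum, hmx⟩ := hP' x hx
      have hmR : (0 : ℝ) < m := by exact_mod_cast hm
      have haR : ∀ k, (0 : ℝ) ≤ a k := fun k => by exact_mod_cast ha k
      rw [Fin.sum_univ_four] at hsum
      have hsumR : (a 0 : ℝ) + a 1 + a 2 + a 3 = m := by exact_mod_cast hsum
      refine ⟨![a 1 / m, a 2 / m, a 3 / m], ⟨fun i => ?_, ?_⟩, ?_⟩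
      · fin_cases i
        · exact div_nonneg (haR 1) hmR.le
        · exact div_nonneg (haR 2) hmR.le
        · exact div_nonneg (haR 3) hmR.le
      · simp only [Fin.sum_univ_three, Matrix.cons_val_zero, Matrix.cons_val_one, Matrix.cons_val]
        rw [← add_div, ← add_div, div_le_one hmR]
        linarith [haR 0]
      · funext j
        have h1 : (m : ℝ) * x j = a 1 * (![1, 0, 0] : Fin 3 → ℤ) j +
            a 2 * (![0, 1, 0] : Fin 3 → ℤ) j + a 3 * u j := by
          have := congrFun hmx j
          simp only [Pi.smul_apply, Pi.add_apply, smul_eq_mul] at this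
          exact_mod_cast this
        simp only [Pi.zero_apply, zero_add, Fin.sum_univ_three, Matrix.cons_val_zero,
          Matrix.cons_val_one, Matrix.cons_val, Pi.add_apply, Pi.smul_apply, smul_eq_mul, toReal]
        field_simp
        linear_combination -h1)
  refine ⟨heq, ?_⟩
  rw [heq, volume_image_cornerSimplex]
  congr 1
  have huR : (0 : ℝ) < u 2 := by exact_mod_cast hu
  have hdet : (Matrix.of ![toReal ![1, 0, 0], toReal ![0, 1, 0], toReal u]).det = u 2 := by
    rw [Matrix.det_fin_three]
    simp [toReal]
  rw [hdet, abs_of_pos huR]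
  norm_num [Nat.factorial]

theorem affineSpan_eq_top_of_volume_ne_zero {P : Set (Fin 3 → ℝ)}
    (h : volume (convexHull ℝ P) ≠ 0) : affineSpan ℝ P = ⊤ := by
  by_contra hne
  have h1 := Measure.addHaar_affineSubspace (volume : Measure (Fin 3 → ℝ)) _ hne
  exact h (measure_mono_null (convexHull_subset_affineSpan P) h1)

/-- The barycentric coordinates of the interior lattice points of the eight tetrahedra. -/
theorem exists_weights_of_mem_tetrahedra {T : (Fin 3 → ℤ) × (Fin 3 → ℤ)} (hT : T ∈ tetrahedra) :
    ∃ (m : ℤ) (a n : Fin 4 → ℤ), (∀ k, 0 < a k) ∧ ∑ k, a k = m ∧ ∑ k, n k * a k = 1 ∧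
      m • T.2 = a 1 • ![1, 0, 0] + a 2 • ![0, 1, 0] + a 3 • T.1 ∧ 0 < T.2 2 ∧ T.2 2 < T.1 2 ∧
      (T.1 2 = m ∧ T.1 2 ≠ 20 ∨ T.1 = ![3, 7, 20] ∧ m = 4) := by
  simp only [tetrahedra, Set.mem_insert_iff, Set.mem_singleton_iff] at hT
  rcases hT with rfl | rfl | rfl | rfl | rfl | rfl | rfl | rfl
  · exact ⟨4, ![1, 1, 1, 1], ![1, 0, 0, 0], by decide, by decide, by decide, by decide, by decide,
      by decide, by decide⟩
  · exact ⟨5, ![1, 1, 1, 2], ![1, 0, 0, 0], by decide, by decide, by decide, by decide, by decide,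
      by decide, by decide⟩
  · exact ⟨7, ![1, 1, 2, 3], ![1, 0, 0, 0], by decide, by decide, by decide, by decide, by decide,
      by decide, by decide⟩
  · exact ⟨11, ![2, 1, 3, 5], ![0, 1, 0, 0], by decide, by decide, by decide, by decide, by decide,
      by decide, by decide⟩
  · exact ⟨13, ![1, 3, 4, 5], ![1, 0, 0, 0], by decide, by decide, by decide, by decide, by decide,
      by decide, by decide⟩
  · exact ⟨17, ![2, 3, 5, 7], ![-1, 1, 0, 0], by decide, by decide, by decide, by decide, by decide,
      by decide, by decide⟩
  · exact ⟨19, ![3, 5, 4, 7], ![-1, 0, 1, 0], by decide, by decide, by decide, by decide, by decide,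
      by decide, by decide⟩
  · exact ⟨4, ![1, 1, 1, 1], ![1, 0, 0, 0], by decide, by decide, by decide, by decide, by decide,
      by decide, by decide⟩

/-! ### The five types of circuits -/

section Types

variable {w : Fin (N + 2) → Fin 3 → ℤ} {v : Fin 3 → ℚ} {M : Fin N → ℚ} {c : Fin (N + 2) → ℚ}
  {p : Fin N → Fin 3 → HahnSeries ℚ ℂ} {C : Finset (Fin (N + 2))} {l r : Fin N → Fin (N + 2)}
  {Q : Finset (Fin (N + 2))} {lam : Fin (N + 2) → ℤ}

theorem card_image_univ_of_injective {m : ℕ} {e : Fin m → Fin (N + 2)}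
    (he : Function.Injective e) : (Finset.univ.image e).card = m := by
  rw [Finset.card_image_of_injective _ he, Finset.card_univ, Fintype.card_fin]

/-- The exponents of the discriminantal equation form a primitive relation of the pentatope. -/
theorem isPrimitiveRelation_discExponent (hw : Function.Injective w) {a b : ℕ} {Φ : AffAut}
    (hC : IsTypeAVia (points w C) a b Φ) :
    C.card = 5 ∧ IsPrimitiveRelation w C fun i => discExponent a b (Φ (w i)) := by
  obtain ⟨ha, hb, -, hΦ⟩ := hC
  set y : Fin 5 → Fin 3 → ℤ :=
    ![![0, 0, 0], ![1, 0, 0], ![0, 1, 0], ![0, 0, 1], ![1, (a : ℤ), (b : ℤ)]] with hydef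
  set μ : Fin 5 → ℤ := ![(a : ℤ) + b, -1, -a, -b, 1] with hμdef
  have hrange : Φ '' points w C = Set.range y := by
    rw [hΦ, pentatope]
    ext x
    simp [hydef]
    tauto
  have hy : Function.Injective y := by
    intro i j h
    have h0 := congrFun h 0
    have h1 := congrFun h 1
    have h2 := congrFun h 2
    fin_cases i <;> fin_cases j <;> simp [hydef] at h0 h1 h2 ⊢ <;> omega
  have hμ0 : ∀ k, μ k ≠ 0 := by
    intro k
    fin_cases k <;> simp [hμdef] <;> omega
  have hdisc : ∀ k, discExponent a b (y k) = μ k := by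
    intro k
    fin_cases k <;> simp [discExponent, hydef, hμdef, ha.ne', hb.ne']
  obtain ⟨e, he, hey, hCe⟩ := exists_model_positions hw hy hrange
  refine ⟨by rw [hCe, card_image_univ_of_injective he], ?_⟩
  have heq : (fun i => discExponent a b (Φ (w i))) = pushWeights e μ := by
    funext i
    by_cases hi : i ∈ Finset.univ.image e
    · obtain ⟨k, -, rfl⟩ := Finset.mem_image.1 hi
      rw [pushWeights_apply he, hey, hdisc]
    · rw [pushWeights_of_notMem hi]
      have hne : ∀ k, Φ (w i) ≠ y k := fun k h =>
        hi (Finset.mem_image.2 ⟨k, Finset.mem_univ _, hw (Φ.injective (by rw [hey, h]))⟩)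
      exact (if_neg (hne 0)).trans <| (if_neg (hne 1)).trans <| (if_neg (hne 2)).trans <|
        (if_neg (hne 3)).trans <| if_neg (hne 4)
  rw [heq]
  refine isPrimitiveRelation_pushWeights he hey hCe hμ0 ?_ ?_ ⟨![0, 0, 0, 0, 1], ?_⟩
  · simp only [hμdef, Fin.sum_univ_five, Matrix.cons_val_zero, Matrix.cons_val_one,
      Matrix.cons_val]
    ring
  · funext j
    fin_cases j <;> simp [hμdef, hydef, Fin.sum_univ_five]
  · simp [hμdef, Fin.sum_univ_five]

theorem sum_filter_lt_eq_of_isGreatest (hlam : IsPrimitiveRelation w C lam)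
    {k k₁ : Fin (N + 2)} (hk₁ : (k₁ : ℕ) = k + 1) (hC : IsGreatest (C : Set (Fin (N + 2))) k₁) :
    ∑ i ∈ Finset.univ.filter (k < ·), lam i = lam k₁ := by
  refine Finset.sum_eq_single_of_mem k₁ ?_ fun i hi hne => ?_
  · exact Finset.mem_filter.2 ⟨Finset.mem_univ _, Fin.lt_def.2 (by omega)⟩
  · by_contra h0
    have h1 : i ≤ k₁ := hC.2 ((hlam.ne_zero_iff i).1 h0)
    simp only [Finset.mem_filter, Finset.mem_univ, true_and, Fin.lt_def] at hi
    rw [Fin.le_def] at h1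
    exact hne (Fin.ext (by omega))

theorem sum_filter_lt_eq_add_of_isGreatest (hlam : IsPrimitiveRelation w C lam)
    {k k₁ k₂ : Fin (N + 2)} (hk₁ : (k₁ : ℕ) = k + 1) (hk₂ : (k₂ : ℕ) = k + 2)
    (hC : IsGreatest (C : Set (Fin (N + 2))) k₂) :
    ∑ i ∈ Finset.univ.filter (k < ·), lam i = lam k₂ + lam k₁ := by
  have hne : k₂ ≠ k₁ := fun h => by rw [h] at hk₂; omega
  rw [← Finset.sum_pair hne]
  symm
  refine Finset.sum_subset ?_ fun i hi hi' => ?_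
  · intro i hi
    simp only [Finset.mem_insert, Finset.mem_singleton] at hi
    simp only [Finset.mem_filter, Finset.mem_univ, true_and, Fin.lt_def]
    rcases hi with rfl | rfl <;> omega
  · by_contra h0
    have h1 : i ≤ k₂ := hC.2 ((hlam.ne_zero_iff i).1 h0)
    simp only [Finset.mem_filter, Finset.mem_univ, true_and, Fin.lt_def] at hi
    simp only [Finset.mem_insert, Finset.mem_singleton, not_or, Fin.ext_iff] at hi'
    rw [Fin.le_def] at h1
    omega

theorem sum_smul_single_id {R : Type*} [Semiring R] (u : Fin 3 → R) :
    ∑ i, u i • Pi.single (id i) (1 : R) = u := by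
  funext j
  simp [Finset.sum_apply, Pi.single_apply]

/-- The relation of a circuit of type B is given by the barycentric coordinates of its interior
point, and the lattice volume is the last coordinate of the fourth vertex of the model. -/
theorem exists_relation_of_isTypeB (hw : Function.Injective w) (hC : IsTypeB (points w C)) :
    C.card = 5 ∧ ∃ (m V : ℤ) (lam : Fin (N + 2) → ℤ) (o : Fin (N + 2)),
      IsPrimitiveRelation w C lam ∧ (∀ i ∈ C, i ≠ o → 0 < lam i) ∧ |lam o| = m ∧
      IsLatticeVolume (hull w C) V ∧ (¬ IsExceptional (points w C) → V = m) ∧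
      (IsExceptional (points w C) → V = 20 ∧ m = 4) := by
  obtain ⟨T, hT, Φ, hΦ⟩ := hC
  obtain ⟨m, a, n, ha, hsum, hn, hmo, ho, hou, hm⟩ := exists_weights_of_mem_tetrahedra hT
  have hm0 : 0 < m := hsum ▸ Finset.sum_pos (fun k _ => ha k) Finset.univ_nonempty
  have hu := ho.trans hou
  set P : Set (Fin 3 → ℤ) := {![0, 0, 0], ![1, 0, 0], ![0, 1, 0], T.1, T.2} with hP
  -- every vertex and the interior point are convex combinations of the vertices
  have hvertices : ∀ x ∈ ({![0, 0, 0], ![1, 0, 0], ![0, 1, 0], T.1} : Set (Fin 3 → ℤ)),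
      ∃ (m : ℤ) (a : Fin 4 → ℤ), 0 < m ∧ (∀ k, 0 ≤ a k) ∧ ∑ k, a k = m ∧
        m • x = a 1 • ![1, 0, 0] + a 2 • ![0, 1, 0] + a 3 • T.1 := by
    rintro x (rfl | rfl | rfl | rfl)
    · exact ⟨1, ![1, 0, 0, 0], by decide, by decide, by decide, by simp⟩
    · exact ⟨1, ![0, 1, 0, 0], by decide, by decide, by decide, by simp⟩
    · exact ⟨1, ![0, 0, 1, 0], by decide, by decide, by decide, by simp⟩
    · exact ⟨1, ![0, 0, 0, 1], by decide, by decide, by decide, by simp⟩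
  obtain ⟨hhull, hvol⟩ := volume_convexHull_tetrahedron (P := P) hu
    (by
      rintro x (rfl | rfl | rfl | rfl) <;> simp [hP])
    (by
      rintro x (rfl | rfl | rfl | rfl | rfl)
      · exact hvertices _ (by simp)
      · exact hvertices _ (by simp)
      · exact hvertices _ (by simp)
      · exact hvertices _ (by simp)
      · exact ⟨m, a, hm0, fun k => (ha k).le, hsum, hmo⟩)
  have huR : (0 : ℝ) < T.1 2 := by exact_mod_cast hu
  set y : Fin 5 → Fin 3 → ℤ := ![![0, 0, 0], ![1, 0, 0], ![0, 1, 0], T.1, T.2] with hydef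
  set μ : Fin 5 → ℤ := ![a 0, a 1, a 2, a 3, -m] with hμdef
  have hrange : Φ '' points w C = Set.range y := by
    rw [hΦ, hP]
    ext x
    simp [hydef]
    tauto
  have hy : Function.Injective y := by
    intro i j h
    have h0 := congrFun h 0
    have h1 := congrFun h 1
    have h2 := congrFun h 2
    fin_cases i <;> fin_cases j <;> simp [hydef] at h0 h1 h2 ⊢ <;> omega
  obtain ⟨e, he, hey, hCe⟩ := exists_model_positions hw hy hrange
  have hpos : ∀ k, k ≠ 4 → 0 < μ k := by
    intro k hk
    fin_cases k
    · exact ha 0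
    · exact ha 1
    · exact ha 2
    · exact ha 3
    · exact absurd rfl hk
  refine ⟨by rw [hCe, card_image_univ_of_injective he], m, T.1 2, pushWeights e μ, e 4,
    isPrimitiveRelation_pushWeights he hey hCe ?_ ?_ ?_ ?_, ?_, ?_, ?_, ?_, ?_⟩
  · intro k
    by_cases hk : k = 4
    · rw [hk]
      exact neg_ne_zero.2 hm0.ne'
    · exact (hpos k hk).ne'
  · rw [← hsum] at hμdef
    simp only [hμdef, Fin.sum_univ_five, Fin.sum_univ_four, Matrix.cons_val_zero,
      Matrix.cons_val_one, Matrix.cons_val]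
    ring
  · simp only [hμdef, hydef, Fin.sum_univ_five, Matrix.cons_val_zero, Matrix.cons_val_one,
      Matrix.cons_val, neg_smul, hmo]
    funext j
    fin_cases j <;> simp
  · refine ⟨![n 0, n 1, n 2, n 3, 0], ?_⟩
    rw [Fin.sum_univ_four] at hn
    simpa [hμdef, Fin.sum_univ_five] using hn
  · intro i hi hne
    rw [hCe] at hi
    obtain ⟨k, -, rfl⟩ := Finset.mem_image.1 hi
    rw [pushWeights_apply he]
    exact hpos k fun h => hne (by rw [h])
  · rw [pushWeights_apply he]
    change |-m| = m
    rw [abs_neg, abs_of_pos hm0]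
  · have h1 := isLatticeVolume_of_model (d := 3) id Function.injective_id hΦ (by
      intro ω
      rw [affineSpan_eq_top_of_volume_ne_zero (by
        rw [hvol, ENNReal.ofReal_ne_zero_iff]
        positivity)]
      exact iff_of_true (AffineSubspace.mem_top _ _ _) ⟨ω, (sum_smul_single_id ω).symm⟩)
    simp only [sum_smul_single_id] at h1
    have h2 : {u : Fin 3 → ℝ | u ∈ convexHull ℝ (toReal '' P)} = convexHull ℝ (toReal '' P) := rfl
    rw [h2, hvol, ENNReal.toReal_ofReal (by positivity)] at h1
    have h3 : ((3 ! : ℕ) : ℝ) * ((T.1 2 : ℝ) / 6) = T.1 2 := by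
      norm_num [Nat.factorial]
      ring
    rw [h3] at h1
    exact h1
  · intro hexc
    rcases hm with ⟨hm, -⟩ | ⟨hm, -⟩
    · exact hm
    · refine absurd ⟨Φ, ?_⟩ hexc
      rw [hΦ, hhull, ← hm]
      exact (volume_convexHull_tetrahedron hu subset_rfl hvertices).1.symm
  · rintro ⟨Ψ, hΨ⟩
    have h1 : volume (convexHull ℝ (toReal '' (Ψ '' points w C))) =
        volume (convexHull ℝ (toReal '' (Φ '' points w C))) := by
      have h2 := convexHull_image_toReal_eq (C := points w C) (Φ := Ψ) rfl
      have h3 := convexHull_image_toReal_eq (C := points w C) (Φ := Φ) rfl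
      rw [← volume_image_extend Ψ.symm, ← h2, h3, volume_image_extend]
    have h5 := (volume_convexHull_tetrahedron (u := ![3, 7, 20]) (by decide) subset_rfl (by
      rintro x (rfl | rfl | rfl | rfl)
      · exact ⟨1, ![1, 0, 0, 0], by decide, by decide, by decide, by decide⟩
      · exact ⟨1, ![0, 1, 0, 0], by decide, by decide, by decide, by decide⟩
      · exact ⟨1, ![0, 0, 1, 0], by decide, by decide, by decide, by decide⟩
      · exact ⟨1, ![0, 0, 0, 1], by decide, by decide, by decide, by decide⟩)).2
    rw [hΨ, h5, hΦ, hvol, ENNReal.ofReal_eq_ofReal_iff (by simp; positivity) (by positivity)] at h1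
    have h6 : T.1 2 = 20 := by
      have h7 : (T.1 2 : ℝ) = 20 := by
        simp at h1
        linarith
      exact_mod_cast h7
    rcases hm with ⟨-, hm⟩ | ⟨-, hm⟩
    · exact absurd h6 hm
    · exact ⟨h6, hm⟩

/-- In a circuit of type C three times the interior point is the sum of the vertices. -/
theorem exists_relation_of_isTypeC (hw : Function.Injective w) (hC : IsTypeC (points w C)) :
    C.card = 4 ∧ ∃ (lam : Fin (N + 2) → ℤ) (o : Fin (N + 2)),
      IsPrimitiveRelation w C lam ∧ (∀ i ∈ C, i ≠ o → 0 < lam i) ∧ lam o = -3 := by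
  obtain ⟨Φ, hΦ⟩ := hC
  have hrange : Φ '' points w C =
      Set.range ![![1, 0, 0], ![2, 1, 0], ![0, 2, 0], ![1, 1, 0]] := by
    rw [hΦ]
    ext x
    simp
    tauto
  obtain ⟨e, he, hey, hCe⟩ := exists_model_positions hw (by decide) hrange
  refine ⟨by rw [hCe, card_image_univ_of_injective he], pushWeights e ![1, 1, 1, -3], e 3,
    isPrimitiveRelation_pushWeights he hey hCe (by decide) (by decide) (by decide)
      ⟨![1, 0, 0, 0], by decide⟩, ?_, pushWeights_apply he _ 3⟩
  intro i hi hne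
  rw [hCe] at hi
  obtain ⟨k, -, rfl⟩ := Finset.mem_image.1 hi
  rw [pushWeights_apply he]
  have h1 : ∀ k : Fin 4, k ≠ 3 → 0 < (![1, 1, 1, -3] : Fin 4 → ℤ) k := by decide
  exact h1 k fun h => hne (by rw [h])

/-- A triangle of type C is taken to the plane spanned by the first two coordinate vectors, where it is
the image of the standard triangle under an affine map of determinant `3`. -/
theorem isLatticeVolume_of_isTypeC (hC : IsTypeC (points w C)) :
    IsLatticeVolume (hull w C) 3 := by
  obtain ⟨Φ, hΦ⟩ := hC
  set P : Set (Fin 3 → ℤ) := {![1, 0, 0], ![2, 1, 0], ![0, 2, 0], ![1, 1, 0]} with hP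
  have hvec : ∀ x y z : ℤ, toReal ![x, y, z] = ![(x : ℝ), y, z] := fun x y z => by
    funext j
    fin_cases j <;> rfl
  have himage : toReal '' P = {![1, 0, 0], ![2, 1, 0], ![0, 2, 0], ![1, 1, 0]} := by
    simp only [hP, Set.image_insert_eq, Set.image_singleton, hvec]
    norm_num
  have hhull := convexHull_eq_image_cornerSimplex (P := toReal '' P) ![1, 0, 0]
    ![![1, 1, 0], ![-1, 2, 0]] (by rw [himage]; simp) (by
      intro i
      rw [himage]
      fin_cases i
      · exact Or.inr (Or.inl (by norm_num))
      · exact Or.inr (Or.inr (Or.inl (by norm_num)))) (by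
      rw [himage]
      rintro x (rfl | rfl | rfl | rfl)
      · exact ⟨![0, 0], ⟨by simp [Fin.forall_fin_two], by simp⟩, by simp⟩
      · exact ⟨![1, 0], ⟨by simp [Fin.forall_fin_two], by simp⟩, by norm_num⟩
      · exact ⟨![0, 1], ⟨by simp [Fin.forall_fin_two], by simp⟩, by norm_num⟩
      · exact ⟨![1 / 3, 1 / 3], ⟨by simp [Fin.forall_fin_two], by norm_num⟩, by
          norm_num [Fin.sum_univ_two]⟩)
  have hspan : ∀ ω : Fin 3 → ℤ, toReal ω ∈ affineSpan ℝ (toReal '' P) ↔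
      ∃ n : Fin 2 → ℤ, ω = ∑ i, n i • Pi.single (Fin.castSucc i) 1 := by
    intro ω
    constructor
    · intro hω
      have hle : affineSpan ℝ (toReal '' P) ≤
          (LinearMap.ker (LinearMap.proj 2 : (Fin 3 → ℝ) →ₗ[ℝ] ℝ)).toAffineSubspace := by
        rw [affineSpan_le, himage]
        rintro x (rfl | rfl | rfl | rfl) <;> simp
      have h2 : toReal ω 2 = 0 := by simpa using hle hω
      have h3 : ω 2 = 0 := by simpa [toReal] using h2
      refine ⟨![ω 0, ω 1], ?_⟩
      funext j
      fin_cases j <;> simp [Fin.sum_univ_two, Pi.single_apply, h3]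
    · rintro ⟨n, rfl⟩
      have h1 : ![1, 0, 0] ∈ affineSpan ℝ (toReal '' P) :=
        subset_affineSpan ℝ _ (by rw [himage]; simp)
      have h2 : ![2, 1, 0] ∈ affineSpan ℝ (toReal '' P) :=
        subset_affineSpan ℝ _ (by rw [himage]; simp)
      have h3 : ![1, 1, 0] ∈ affineSpan ℝ (toReal '' P) :=
        subset_affineSpan ℝ _ (by rw [himage]; simp)
      have h4 := AffineSubspace.smul_vsub_vadd_mem _ (n 0 - 1 : ℝ) h2 h3 
        (AffineSubspace.smul_vsub_vadd_mem _ (n 1 : ℝ) h3 h1 h1)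
      convert h4 using 1
      funext j
      fin_cases j
      · simp [Fin.sum_univ_two, toReal, Pi.single_apply]
        ring
      · simp [Fin.sum_univ_two, toReal, Pi.single_apply]
      · simp [Fin.sum_univ_two, toReal, Pi.single_apply]
  have hset : {u : Fin 2 → ℝ | ∑ i, u i • Pi.single (Fin.castSucc i) (1 : ℝ) ∈
      convexHull ℝ (toReal '' P)} = (fun x : Fin 2 → ℝ => ![1, 0] + ∑ i, x i •
        ![![1, 1], ![-1, 2]] i) '' cornerSimplex 2 1 := by
    rw [hhull]
    ext u
    simp only [Set.mem_ofPred_eq, Set.mem_image]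
    refine exists_congr fun x => and_congr_right fun _ => ?_
    constructor
    · intro h
      have h0 := congrFun h 0
      have h1 := congrFun h 1
      funext j
      fin_cases j
      · simpa [Fin.sum_univ_two, Pi.single_apply] using h0
      · simpa [Fin.sum_univ_two, Pi.single_apply] using h1
    · rintro rfl
      funext j
      fin_cases j <;> simp [Fin.sum_univ_two, Pi.single_apply]
  have h1 := isLatticeVolume_of_model (d := 2) Fin.castSucc (Fin.castSucc_injective 2) hΦ hspan
  have hdet : (Matrix.of ![![(1 : ℝ), 1], ![-1, 2]]).det = 3 := by
    rw [Matrix.det_fin_two]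
    norm_num
  rw [hset, volume_image_cornerSimplex, hdet, ENNReal.toReal_ofReal (by positivity)] at h1
  have h3 : ((2 ! : ℕ) : ℝ) * (|(3 : ℝ)| / (2 ! : ℕ)) = 3 := by
    norm_num [Nat.factorial]
  rw [h3] at h1
  exact h1

/-- In a circuit of type D both diagonals have the same midpoint. -/
theorem exists_relation_of_isTypeD (hw : Function.Injective w) (hC : IsTypeD (points w C)) :
    C.card = 4 ∧ ∃ e : Fin 4 → Fin (N + 2), Function.Injective e ∧
      IsPrimitiveRelation w C (pushWeights e ![1, -1, -1, 1]) := by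
  obtain ⟨Φ, hΦ⟩ := hC
  have hrange : Φ '' points w C =
      Set.range ![![0, 0, 0], ![1, 0, 0], ![0, 1, 0], ![1, 1, 0]] := by
    rw [hΦ]
    ext x
    simp
    tauto
  obtain ⟨e, he, hey, hCe⟩ := exists_model_positions hw (by decide) hrange
  exact ⟨by rw [hCe, card_image_univ_of_injective he], e, he,
    isPrimitiveRelation_pushWeights he hey hCe (by decide) (by decide) (by decide)
      ⟨![1, 0, 0, 0], by decide⟩⟩

/-- In a circuit of type E twice the midpoint is the sum of the endpoints. -/
theorem exists_relation_of_isTypeE (hw : Function.Injective w) (hC : IsTypeE (points w C)) :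
    ∃ e : Fin 3 → Fin (N + 2), Function.Injective e ∧ C = Finset.univ.image e ∧
      IsPrimitiveRelation w C (pushWeights e ![1, -2, 1]) := by
  obtain ⟨Φ, hΦ⟩ := hC
  have hrange : Φ '' points w C = Set.range ![![0, 0, 0], ![0, 0, 1], ![0, 0, 2]] := by
    rw [hΦ]
    ext x
    simp
    tauto
  obtain ⟨e, he, hey, hCe⟩ := exists_model_positions hw (by decide) hrange
  exact ⟨e, he, hCe, isPrimitiveRelation_pushWeights he hey hCe (by decide) (by decide)
    (by decide) ⟨![1, 0, 0], by decide⟩⟩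

/-- If all points lie on faces dual to segments without further lattice points, the midpoint of a
circuit of type E is not an endpoint of such a segment, and so the whole circuit cannot be an edge
of the path. -/
theorem IsEdgeConfiguration.ncard_eq_two (h : IsEdgeConfiguration w v M c p C l r Q)
    (hmono : StrictMono fun i => height v (w i)) {e : Fin 3 → Fin (N + 2)}
    (he : Function.Injective e) (hCe : C = Finset.univ.image e)
    (hlam : IsPrimitiveRelation w C (pushWeights e ![1, -2, 1])) :
    (enhancements w c C p).ncard = 2 ∧ hull w C ∉ surfacePath w c (tropPoint v M) := by
  have hcard : C.card = 3 := by rw [hCe, card_image_univ_of_injective he]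
  have hpos : ∀ i ∈ C, i ≠ e 1 → 0 < pushWeights e ![1, -2, 1] i := by
    intro i hi hne
    rw [hCe] at hi
    obtain ⟨k, -, rfl⟩ := Finset.mem_image.1 hi
    rw [pushWeights_apply he]
    have h1 : ∀ k : Fin 3, k ≠ 1 → 0 < (![1, -2, 1] : Fin 3 → ℤ) k := by decide
    exact h1 k fun h => hne (by rw [h])
  constructor
  · have h1 := h.ncard_eq_of_interior hlam hcard.ge hpos
    rw [pushWeights_apply he] at h1
    have h2 : |(![1, -2, 1] : Fin 3 → ℤ) 1| = 2 := by decide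
    rw [h2] at h1
    exact_mod_cast h1
  · rintro ⟨s, hs⟩
    rw [h.cell s] at hs
    have hCne : C.Nonempty := Finset.card_pos.1 (by omega)
    have hlr := h.stepData.chain.1 s
    obtain ⟨h1, h2⟩ := eq_and_eq_of_hull_eq hmono (C.isLeast_min' hCne) (C.isGreatest_max' hCne)
      (isLeast_pair_of_lt hlr) (isGreatest_pair_of_lt hlr) hs
    have hl : l s ∈ C := h1 ▸ C.min'_mem hCne
    have hr : r s ∈ C := h2 ▸ C.max'_mem hCne
    obtain ⟨hl1, hr1⟩ := ne_of_interior rfl h.stepData h.pair h.orthogonal hlam hcard.ge hpos s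
    have hval : ∀ k, k ≠ 1 → c (e k) + M s * height v (w (e k)) =
        tropMax (fun i => height v (w i)) c M s := by
      intro k hk
      rw [hCe] at hl hr
      obtain ⟨i, -, hi⟩ := Finset.mem_image.1 hl
      obtain ⟨j, -, hj⟩ := Finset.mem_image.1 hr
      have h3 : k = i ∨ k = j := by
        have hi1 : i ≠ 1 := fun h => hl1 (by rw [← hi, h])
        have hj1 : j ≠ 1 := fun h => hr1 (by rw [← hj, h])
        have hij : i ≠ j := fun h => hlr.ne (by rw [← hi, ← hj, h])
        omega
      rcases h3 with rfl | rfl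
      · rw [hi]
        exact h.stepData.left_eq s
      · rw [hj]
        exact h.stepData.right_eq s
    have h4 := sum_relation_mul_gap (v := v) rfl h.orthogonal hlam (M s)
      (tropMax (fun i => height v (w i)) c M s)
    have h5 := sum_pushWeights_smul e ![1, -2, 1] fun i =>
      tropMax (fun i => height v (w i)) c M s - (c i + M s * height v (w i))
    simp only [zsmul_eq_mul] at h5
    rw [h5] at h4
    simp [Fin.sum_univ_three, hval 0 (by decide), hval 2 (by decide)] at h4
    rcases h.pair s (e 1) (by linarith) with h6 | h6
    · exact hl1 h6.symm
    · exact hr1 h6.symm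

end Types

end TropSurf

end

open TropSurf in
theorem lemma4p2 (Δ : Set (Fin 3 → ℝ)) (hΔ : TropSurf.IsLatticePolytope Δ)
    (hgen : TropSurf.GeneratesLattice Δ) (v : Fin 3 → ℚ)
    (hv : TropSurf.IsGenericDirection Δ v) (N : ℕ) (hN : 0 < N)
    (w : Fin (N + 2) → Fin 3 → ℤ) (hw : Set.range w = TropSurf.latticePoints Δ)
    (hmono : StrictMono fun i => TropSurf.height v (w i)) :
    ∃ R : ℚ, 0 < R ∧ ∀ M : Fin N → ℚ, TropSurf.IsRapidlyGrowing R M →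
      ∀ p : Fin N → Fin 3 → HahnSeries ℚ ℂ, TropSurf.IsLiftOf v M p →
      ∀ c : Fin (N + 2) → ℚ, TropSurf.IsSingularTropicalSurface w c →
      (∀ s, TropSurf.tropPoint v M s ∈ TropSurf.tropSurface w c) →
      ∀ C : Finset (Fin (N + 2)), TropSurf.IsCircuitOf w c C →
        (TropSurf.enhancements w c C p).Finite ∧
        -- type A
        (∀ (a b : ℕ) (Φ : TropSurf.AffAut), TropSurf.IsTypeAVia (TropSurf.points w C) a b Φ →
          (∀ k : Fin (N + 2),
            TropSurf.surfacePath w c (TropSurf.tropPoint v M) = TropSurf.Gam w k →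
            ((TropSurf.enhancements w c C p).ncard : ℤ) =
              |TropSurf.discExponent a b (Φ (w k))|) ∧
          (∀ k k₁ : Fin (N + 2), 1 ≤ (k : ℕ) → (k₁ : ℕ) = k + 1 →
            TropSurf.surfacePath w c (TropSurf.tropPoint v M) = TropSurf.GamGap w k →
            IsGreatest (C : Set (Fin (N + 2))) k₁ →
            ((TropSurf.enhancements w c C p).ncard : ℤ) =
              |TropSurf.discExponent a b (Φ (w k₁))|) ∧
          (∀ k k₁ k₂ : Fin (N + 2), 1 ≤ (k : ℕ) → (k₁ : ℕ) = k + 1 → (k₂ : ℕ) = k + 2 →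
            TropSurf.surfacePath w c (TropSurf.tropPoint v M) = TropSurf.GamGap w k →
            IsGreatest (C : Set (Fin (N + 2))) k₂ →
            ((TropSurf.enhancements w c C p).ncard : ℤ) =
              |TropSurf.discExponent a b (Φ (w k₂)) + TropSurf.discExponent a b (Φ (w k₁))|)) ∧
        -- type B
        (TropSurf.IsTypeB (TropSurf.points w C) →
          (¬ TropSurf.IsExceptional (TropSurf.points w C) →
            ∃ V : ℝ, TropSurf.IsLatticeVolume (TropSurf.hull w C) V ∧
              ((TropSurf.enhancements w c C p).ncard : ℝ) = V) ∧
          (TropSurf.IsExceptional (TropSurf.points w C) →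
            ∃ V : ℝ, TropSurf.IsLatticeVolume (TropSurf.hull w C) V ∧
              ((TropSurf.enhancements w c C p).ncard : ℝ) = 1 / 5 * V ∧
              (TropSurf.enhancements w c C p).ncard = 4)) ∧
        -- type C
        (TropSurf.IsTypeC (TropSurf.points w C) →
          (TropSurf.enhancements w c C p).ncard = 3 ∧
          TropSurf.IsLatticeVolume (TropSurf.hull w C) 3) ∧
        -- type D
        (TropSurf.IsTypeD (TropSurf.points w C) →
          (TropSurf.enhancements w c C p).ncard = 1) ∧
        -- type E
        (TropSurf.IsTypeE (TropSurf.points w C) →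
          (TropSurf.hull w C ∈ TropSurf.surfacePath w c (TropSurf.tropPoint v M) →
            (TropSurf.enhancements w c C p).ncard = 1) ∧
          (TropSurf.hull w C ∉ TropSurf.surfacePath w c (TropSurf.tropPoint v M) →
            (TropSurf.enhancements w c C p).ncard = 2)) := by
  classical
  have hΔ' : Convex ℝ Δ := by
    obtain ⟨V, rfl⟩ := hΔ
    exact convex_convexHull ℝ _
  have hw' : Function.Injective w := fun i j h => hmono.injective (congrArg (height v) h)
  obtain ⟨R, hR, hRM⟩ := exists_growth_bound_enhancements (N := N) hΔ' hw hmono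
  refine ⟨R, hR, fun M hM p hp c _ hS C hC => ?_⟩
  obtain ⟨l, r, hd, ⟨s, k, -, -, hCeq, hcell, hfin, hone⟩ | ⟨hcell, Q, hQ, hform, hsum⟩⟩ :=
    hRM M hM p hp c hS C hC
  -- a face dual to a segment of lattice length two: the circuit has three points, so it is of type E
  · have hcard : C.card ≤ 3 := hCeq ▸ Finset.card_le_three
    refine ⟨hfin, fun a b Φ hA => ?_, fun hB => ?_, fun hC => ?_, fun hD => ?_, fun _ =>
      ⟨fun _ => hone, fun hE => absurd ⟨s, by rw [hcell]⟩ hE⟩⟩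
    · have := (isPrimitiveRelation_discExponent hw' hA).1
      omega
    · have := (exists_relation_of_isTypeB hw' hB).1
      omega
    · have := (exists_relation_of_isTypeC hw' hC).1
      omega
    · have := (exists_relation_of_isTypeD hw' hD).1
      omega
  -- all faces dual to segments without further lattice points
  · have h : IsEdgeConfiguration w v M c p C l r Q :=
      ⟨hd, hcell, hQ, hform, hC.isOrthogonalToRelations, fun lam hlam => (hsum lam hlam).1,
        fun lam hlam => (hsum lam hlam).2.2⟩
    obtain ⟨lam₀, hlam₀⟩ := hC.1.exists_isPrimitiveRelation
    refine ⟨(hsum lam₀ hlam₀).2.1, fun a b Φ hA => ?_, fun hB => ?_, fun hC => ?_, fun hD => ?_,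
      fun hE => ?_⟩
    · have hlam := (isPrimitiveRelation_discExponent hw' hA).2
      refine ⟨fun k hk => h.ncard_eq_of_gam hmono hlam hk, fun k k₁ _ hk₁ hk hmax => ?_,
        fun k k₁ k₂ _ hk₁ hk₂ hk hmax => ?_⟩
      · rw [h.ncard_eq_of_gamGap hmono hlam (Fin.lt_def.2 (by omega) : k < k₁) hk,
          sum_filter_lt_eq_of_isGreatest hlam hk₁ hmax]
      · rw [h.ncard_eq_of_gamGap hmono hlam (Fin.lt_def.2 (by omega) : k < k₁) hk,
          sum_filter_lt_eq_add_of_isGreatest hlam hk₁ hk₂ hmax]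
    · obtain ⟨hcard, m, V, lam, o, hlam, hpos, hm, hV, hne, hexc⟩ :=
        exists_relation_of_isTypeB hw' hB
      have h1 := h.ncard_eq_of_interior hlam (by omega) hpos
      rw [hm] at h1
      refine ⟨fun hE => ⟨V, hV, ?_⟩, fun hE => ⟨V, hV, ?_, ?_⟩⟩
      · rw [hne hE]
        exact_mod_cast h1
      · obtain ⟨rfl, rfl⟩ := hexc hE
        have h2 : (enhancements w c C p).ncard = 4 := by exact_mod_cast h1
        rw [h2]
        norm_num
      · rw [(hexc hE).2] at h1
        exact_mod_cast h1
    · obtain ⟨hcard, lam, o, hlam, hpos, ho⟩ := exists_relation_of_isTypeC hw' hC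
      have h1 := h.ncard_eq_of_interior hlam (by omega) hpos
      rw [ho, abs_neg, Nat.abs_ofNat] at h1
      exact ⟨by exact_mod_cast h1, isLatticeVolume_of_isTypeC hC⟩
    · obtain ⟨-, e, he, hlam⟩ := exists_relation_of_isTypeD hw' hD
      exact h.ncard_of_parallelogram hmono he hlam
    · obtain ⟨e, he, hCe, hlam⟩ := exists_relation_of_isTypeE hw' hE
      obtain ⟨h1, h2⟩ := h.ncard_eq_two hmono he hCe hlam
      exact ⟨fun h3 => absurd h3 h2, fun _ => h1⟩
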